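/- **Theorem (Completeness).** Let $\mathcal C_1=\Gamma_1\triangleright W_1$ and $\mathcal C_2=\Gamma_2\triangleright W_2$ be well-formed configurations of the calculus CCCP described below, in each of which infinitely many channels are idle (so that channels fresh for a configuration can always be picked). If $\mathcal C_1\simeq\mathcal C_2$ (reduction barbed congruence), then $\mathcal C_1\approx\mathcal C_2$ (weak bisimilarity in the extensional LTS). *Terms.* Fix a set of channels $c,d,\dots$ and a set of closed values $v,w,\dots$ with a special value $\mathsf{err}$ and a transmission time $\delta_v\in\mathbb N$, $\delta_v>0$, for each $v$. Expressions $e$ are built from closed values and data-variables by interpreted operators; $[\![e]\!]$ is the value of a closed expression $e$, with $[\![v]\!]=v$. Station code and system terms are $$P,Q::=c!\langle e\rangle.P\mid\lfloor c?(x).P\rfloor Q\mid\sigma.P\mid\tau.P\mid P+Q\mid[b]P,Q\mid X\mid\mathsf{nil}\mid\mathsf{fix}\,X.P,\qquad W::=P\mid c[x].P\mid W_1|W_2\mid\nu c{:}(n,v).W,$$ where $b$ is $e_1=e_2$ or $\mathsf{exp}(c)$, and $c[x].P$ is an active receiver. Terms are taken up to $\alpha$-conversion; in $\mathsf{fix}\,X.P$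 every free occurrence of $X$ in $P$ lies in a continuation of a broadcast, in a branch of a receiver or of a matching, or under a prefix $\sigma$. A channel environment $\Gamma$ maps each channel to some $(n,v)$ with $n\in\mathbb N$; $c$ is idle if $n=0$ and exposed otherwise. A configuration $\Gamma\triangleright W$ has $W$ closed. *Updates.* $\mathrm{upd}_\sigma(\Gamma)$ lowers every exposure time by one ($0$ stays $0$) and keeps the values; $\mathrm{upd}_\tau(\Gamma)=\Gamma$; $\mathrm{upd}_{c!v}(\Gamma)=\mathrm{upd}_{c?v}(\Gamma)$ changes $\Gamma$ at $c$ only, to $(\delta_v,v)$ if $c$ is idle, and to $(\max(\delta_v,n),\mathsf{err})$ if $\Gamma(c)=(n,w)$ with $n>0$. *Intensional transitions* $\Gamma\triangleright W\xrightarrow{\lambda}W'$, $\lambda\in\{c!v,c?v,\sigma,\tau\}$ (symmetric rules omitted). Let $\mathsf{rcv}(W,c)$ mean that $W$ has an unguarded receiver $\lfloor c?(x).P\rfloor Q$ on the free channel $c$, where $+$, $\mathsf{fix}$, $|$ and $\nu$ are transparent and every other construct guards; and $\mathsf{rcv}(\Gamma\triangleright W,c)$ that, moreover, $c$ is idle in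 $\Gamma$. - Transmission: $c!\langle e\rangle.P\xrightarrow{c!v}\sigma^{\delta_v}.P$ if $[\![e]\!]=v$; $\lfloor c?(x).P\rfloor Q\xrightarrow{c?v}c[x].P$ if $c$ is idle; $W\xrightarrow{c?v}W$ if not $\mathsf{rcv}(\Gamma\triangleright W,c)$; $W_1|W_2\xrightarrow{c!v}W_1'|W_2'$ if $W_1\xrightarrow{c!v}W_1'$ and $W_2\xrightarrow{c?v}W_2'$; $W_1|W_2\xrightarrow{c?v}W_1'|W_2'$ if both components do $c?v$. - Time: $\mathsf{nil}\xrightarrow{\sigma}\mathsf{nil}$; $\sigma.P\xrightarrow{\sigma}P$; $c[x].P\xrightarrow{\sigma}c[x].P$ if $\Gamma(c)=(n,w)$, $n>1$; $c[x].P\xrightarrow{\sigma}\{w/x\}P$ if $\Gamma(c)=(1,w)$; $\lfloor c?(x).P\rfloor Q\xrightarrow{\sigma}Q$ if $c$ is idle; $W_1|W_2$ and $P+Q$ do $\sigma$ if both components do, to $W_1'|W_2'$ and $P'+Q'$. - Internal: $\lfloor c?(x).P\rfloor Q\xrightarrow{\tau}c[x].\{\mathsf{err}/x\}P$ if $c$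 is exposed; $\tau.P\xrightarrow{\tau}P$; $[b]P,Q\xrightarrow{\tau}\sigma.P$ if $b$ holds and $\xrightarrow{\tau}\sigma.Q$ if not ($\mathsf{exp}(c)$ holds iff $c$ is exposed in $\Gamma$); $W_1|W_2\xrightarrow{\tau}W_1'|W_2$ if $W_1\xrightarrow{\tau}W_1'$. - Structure: $\mathsf{fix}\,X.P\xrightarrow{\lambda}W$ if $\{\mathsf{fix}\,X.P/X\}P\xrightarrow{\lambda}W$; $P+Q\xrightarrow{\lambda}W$ if $P\xrightarrow{\lambda}W$ and either $\lambda\in\{\tau,c!v\}$, or $\lambda=c?v$ and $\mathsf{rcv}(\Gamma\triangleright P,c)$. With $\Gamma_c=\Gamma[c\mapsto(n,v)]$: if $\Gamma_c\triangleright W\xrightarrow{c!w}W'$ then $\Gamma\triangleright\nu c{:}(n,v).W\xrightarrow{\tau}\nu c{:}\mathrm{upd}_{c!w}(\Gamma_c)(c).W'$; if $\Gamma_c\triangleright W\xrightarrow{\lambda}W'$ and $c$ does not occur in $\lambda$ then $\Gamma\triangleright\nu c{:}(n,v).W\xrightarrow{\lambda}\nu c{:}\mathrm{upd}_{\lambda}(\Gamma_c)(c).W'$.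 *Barbed congruence.* $\Gamma\triangleright W\to\Gamma'\triangleright W'$ if $\Gamma\triangleright W\xrightarrow{\lambda}W'$ and $\Gamma'=\mathrm{upd}_\lambda(\Gamma)$ for some $\lambda$ among $c!v,\sigma,\tau$. A configuration has a weak barb on $c$ if it reduces in zero or more steps to one in which $c$ is exposed. $\simeq$ is the largest symmetric relation $\mathcal R$ over configurations that is barb preserving (related configurations have the same weak barbs), reduction-closed ($\mathcal C_1\mathrel{\mathcal R}\mathcal C_2$ and $\mathcal C_1\to\mathcal C_1'$ imply $\mathcal C_2\to^*\mathcal C_2'$ for some $\mathcal C_2'$ with $\mathcal C_1'\mathrel{\mathcal R}\mathcal C_2'$) and contextual ($\Gamma_1\triangleright W_1\mathrel{\mathcal R}\Gamma_2\triangleright W_2$ implies $\Gamma_1\triangleright(W_1|W)\mathrel{\mathcal R}\Gamma_2\triangleright(W_2|W)$ for every closed system term $W$). *Bisimilarity.* The extensional LTS has the following transitions from $\Gamma\triangleright W$. If $\Gamma\triangleright W\xrightarrow{\lambda}W'$, there is a transition to $\mathrm{upd}_\lambda(\Gamma)\triangleright W'$ labelled $c?v$ for $\lambda=c?v$, labelled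 $\tau$ for $\lambda=\tau$ and for $\lambda=c!v$, labelled $\sigma$ for $\lambda=\sigma$, and labelled $\gamma(c,v)$ for $\lambda=\sigma$ when $\Gamma(c)=(1,v)$. If $c$ is idle in $\Gamma$ there is a transition labelled $\iota(c)$ from $\Gamma\triangleright W$ to itself. $\approx$ is the union of all relations in which each transition labelled $\alpha$ of either member of a related pair is matched, up to the relation, by the other member through $\tau^*$ if $\alpha=\tau$ and through $\tau^*\alpha\,\tau^*$ otherwise. *Well-formedness.* The well-formed configurations are the least set that contains every $\Gamma\triangleright P$ and every $\Gamma\triangleright c[x].P$ with $c$ exposed in $\Gamma$, contains $\Gamma\triangleright W_1|W_2$ whenever it contains $\Gamma\triangleright W_1$ and $\Gamma\triangleright W_2$, and contains $\Gamma\triangleright\nu c{:}(n,v).W$ whenever it contains $\Gamma[c\mapsto(n,v)]\triangleright W$. -/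

import Mathlib

/-! # CCCP: a timed broadcast process calculus with collisions

Binders are nameless, so that terms are identified up to alpha-conversion by construction:
data-variables and process variables are well-scoped de Bruijn indices, and `ν` passes from the
set `C` of channels to `Option C`, where `none` is the restricted channel. -/

universe u v w

namespace CCCP

/-- The parameters of the calculus: closed values with an error value and a strictly positive
transmission time, and the operators from which expressions are built. -/
structure Signature where
  Val : Type v
  err : Val
  delta : Val → ℕ
  delta_pos : ∀ x, 0 < delta x
  Op : Type w
  arity : Op → ℕ
  interp : (f : Op) → (Fin (arity f) → Val) → Val

/-! ## Terms -/

/-- Expressions with data-variables in `Fin n`. -/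
inductive Expr (S : Signature.{v, w}) (n : ℕ) : Type (max v w) where
  | val (x : S.Val) : Expr S n
  | var (i : Fin n) : Expr S n
  | app (f : S.Op) (args : Fin (S.arity f) → Expr S n) : Expr S n

/-- Boolean expressions: equality tests and exposure checks. -/
inductive BExp (S : Signature.{v, w}) (C : Type u) (n : ℕ) : Type (max u v w) where
  | eq (e₁ e₂ : Expr S n) : BExp S C n
  | exposed (c : C) : BExp S C n

/-- Station code with free data-variables in `Fin n` and free process variables in `Fin m`. -/
inductive Proc (S : Signature.{v, w}) (C : Type u) : ℕ → ℕ → Type (max u v w) where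
  /-- `c!⟨e⟩.P` -/
  | bcast {n m : ℕ} (c : C) (e : Expr S n) (P : Proc S C n m) : Proc S C n m
  /-- `⌊c?(x).P⌋Q`, where `x` is the data-variable `0` of `P` -/
  | rcv {n m : ℕ} (c : C) (P : Proc S C (n + 1) m) (Q : Proc S C n m) : Proc S C n m
  /-- `σ.P` -/
  | delay {n m : ℕ} (P : Proc S C n m) : Proc S C n m
  /-- `τ.P` -/
  | tau {n m : ℕ} (P : Proc S C n m) : Proc S C n m
  /-- `P + Q` -/
  | choice {n m : ℕ} (P Q : Proc S C n m) : Proc S C n m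
  /-- `[b]P,Q` -/
  | cond {n m : ℕ} (b : BExp S C n) (P Q : Proc S C n m) : Proc S C n m
  | var {n m : ℕ} (X : Fin m) : Proc S C n m
  | nil {n m : ℕ} : Proc S C n m
  /-- `fix X.P`, where `X` is the process variable `0` of `P` -/
  | fix {n m : ℕ} (P : Proc S C n (m + 1)) : Proc S C n m

/-- Closed system terms over the set `C` of channels. -/
inductive Sys (S : Signature.{v, w}) : Type u → Type (max (u + 1) v w) where
  | proc {C : Type u} (P : Proc S C 0 0) : Sys S C
  /-- active receiver `c[x].P`, where `x` is the data-variable `0` of `P` -/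
  | arcv {C : Type u} (c : C) (P : Proc S C 1 0) : Sys S C
  | par {C : Type u} (W₁ W₂ : Sys S C) : Sys S C
  /-- `νc:(n,v).W`, where the channel `c` is `none` in `W` -/
  | res {C : Type u} (s : ℕ × S.Val) (W : Sys S (Option C)) : Sys S C

variable {S : Signature.{v, w}} {C : Type u}

/-! ## Substitution -/

namespace Expr

/-- Simultaneous substitution of expressions for data-variables. -/
def subst {n k : ℕ} (f : Fin n → Expr S k) : Expr S n → Expr S k
  | val x => val x
  | var i => f i
  | app g args => app g (fun j => (args j).subst f)

/-- The evaluation of closed expressions. -/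
def eval : Expr S 0 → S.Val
  | val x => x
  | app f args => S.interp f (fun j => (args j).eval)

/-- Pushing a substitution under a binder of a data-variable. -/
def up {n k : ℕ} (f : Fin n → Expr S k) : Fin (n + 1) → Expr S (k + 1) :=
  Fin.cases (var 0) (fun i => (f i).subst (fun j => var j.succ))

end Expr

/-- Substitution in Boolean expressions. -/
def BExp.subst {n k : ℕ} (f : Fin n → Expr S k) : BExp S C n → BExp S C k
  | eq e₁ e₂ => eq (e₁.subst f) (e₂.subst f)
  | exposed c => exposed c

namespace Proc

/-- Simultaneous capture-avoiding substitution of expressions for data-variables. -/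
def substData {n k m : ℕ} (f : Fin n → Expr S k) : Proc S C n m → Proc S C k m
  | bcast c e P => bcast c (e.subst f) (P.substData f)
  | rcv c P Q => rcv c (P.substData (Expr.up f)) (Q.substData f)
  | delay P => delay (P.substData f)
  | tau P => tau (P.substData f)
  | choice P Q => choice (P.substData f) (Q.substData f)
  | cond b P Q => cond (b.subst f) (P.substData f) (Q.substData f)
  | var X => var X
  | nil => nil
  | fix P => fix (P.substData f)

/-- A term seen as a term with one more data-variable, which does not occur in it. -/
def weaken {n m : ℕ} (P : Proc S C n m) : Proc S C (n + 1) m :=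
  P.substData (fun i => Expr.var i.succ)

/-- `{x/0}P`: the closed value `x` replaces the data-variable `0`. -/
def inst {n m : ℕ} (P : Proc S C (n + 1) m) (x : S.Val) : Proc S C n m :=
  P.substData (Fin.cases (Expr.val x) Expr.var)

/-- Renaming of process variables. -/
def renameVar {n m l : ℕ} (f : Fin m → Fin l) : Proc S C n m → Proc S C n l
  | bcast c e P => bcast c e (P.renameVar f)
  | rcv c P Q => rcv c (P.renameVar f) (Q.renameVar f)
  | delay P => delay (P.renameVar f)
  | tau P => tau (P.renameVar f)
  | choice P Q => choice (P.renameVar f) (Q.renameVar f)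
  | cond b P Q => cond b (P.renameVar f) (Q.renameVar f)
  | var X => var (f X)
  | nil => nil
  | fix P => fix (P.renameVar (Fin.cases 0 (fun i => (f i).succ)))

/-- Simultaneous capture-avoiding substitution of station code for process variables. -/
def substVar {n m l : ℕ} (f : Fin m → Proc S C n l) : Proc S C n m → Proc S C n l
  | bcast c e P => bcast c e (P.substVar f)
  | rcv c P Q => rcv c (P.substVar (fun i => (f i).weaken)) (Q.substVar f)
  | delay P => delay (P.substVar f)
  | tau P => tau (P.substVar f)
  | choice P Q => choice (P.substVar f) (Q.substVar f)
  | cond b P Q => cond b (P.substVar f) (Q.substVar f)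
  | var X => f X
  | nil => nil
  | fix P => fix (P.substVar (Fin.cases (var 0) (fun i => (f i).renameVar Fin.succ)))

/-- `{fix X.P / X}P` -/
def unfold {n m : ℕ} (P : Proc S C n (m + 1)) : Proc S C n m :=
  P.substVar (Fin.cases (fix P) var)

/-- `σ^k.P` -/
def delays {n m : ℕ} (k : ℕ) (P : Proc S C n m) : Proc S C n m := delay^[k] P

/-! ## Guardedness -/

/-- Every free occurrence of the process variable `X` lies within a broadcast, an input residual,
a timeout branch, a time delay prefix or a branch of a matching construct. -/
def GuardedIn {n m : ℕ} (X : Fin m) : Proc S C n m → Prop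
  | bcast _ _ _ => True
  | rcv _ _ _ => True
  | delay _ => True
  | tau P => P.GuardedIn X
  | choice P Q => P.GuardedIn X ∧ Q.GuardedIn X
  | cond _ _ _ => True
  | var Y => Y ≠ X
  | nil => True
  | fix P => P.GuardedIn X.succ

/-- In every subterm `fix X.P`, the variable `X` is guarded in `P`. -/
def Guarded {n m : ℕ} : Proc S C n m → Prop
  | bcast _ _ P => P.Guarded
  | rcv _ P Q => P.Guarded ∧ Q.Guarded
  | delay P => P.Guarded
  | tau P => P.Guarded
  | choice P Q => P.Guarded ∧ Q.Guarded
  | cond _ P Q => P.Guarded ∧ Q.Guarded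
  | var _ => True
  | nil => True
  | fix P => P.GuardedIn 0 ∧ P.Guarded

/-- The code has an unguarded receiver along `c`. -/
def IsRcv {n m : ℕ} (c : C) : Proc S C n m → Prop
  | rcv d _ _ => d = c
  | choice P Q => P.IsRcv c ∨ Q.IsRcv c
  | fix P => P.IsRcv c
  | _ => False

end Proc

namespace Sys

/-- All recursive definitions in the system term are guarded. -/
def Guarded : {C : Type u} → Sys S C → Prop
  | _, proc P => P.Guarded
  | _, arcv _ P => P.Guarded
  | _, par W₁ W₂ => W₁.Guarded ∧ W₂.Guarded
  | _, res _ W => W.Guarded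

/-- Some parallel component of the system term has an unguarded receiver along `c`. -/
def IsRcv : {C : Type u} → C → Sys S C → Prop
  | _, c, proc P => P.IsRcv c
  | _, _, arcv _ _ => False
  | _, c, par W₁ W₂ => W₁.IsRcv c ∨ W₂.IsRcv c
  | _, c, res _ W => W.IsRcv (some c)

end Sys

/-! ## Channel environments -/

/-- `Γ c = (n, x)`: the value `x` is in transmission along `c` for the next `n` time slots. -/
abbrev Env (S : Signature.{v, w}) (C : Type u) : Type (max u v) := C → ℕ × S.Val

/-- The channel `c` is idle in `Γ`. -/
def Idle (Γ : Env S C) (c : C) : Prop := (Γ c).1 = 0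

/-- The channel `c` is exposed in `Γ`. -/
def Exposed (Γ : Env S C) (c : C) : Prop := ¬ Idle Γ c

/-- `Γ[c ↦ s]` for the restricted channel `c`. -/
def Env.ext (Γ : Env S C) (s : ℕ × S.Val) : Env S (Option C)
  | none => s
  | some c => Γ c

/-- The truth of a closed Boolean expression in `Γ`. -/
def BExp.Holds (Γ : Env S C) : BExp S C 0 → Prop
  | eq e₁ e₂ => e₁.eval = e₂.eval
  | exposed c => Exposed Γ c

/-- Intensional actions `c!x`, `c?x`, `σ`, `τ`. -/
inductive Act (S : Signature.{v, w}) (C : Type u) : Type (max u v) where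
  | snd (c : C) (x : S.Val) : Act S C
  | rcv (c : C) (x : S.Val) : Act S C
  | sigma : Act S C
  | tau : Act S C

/-- An action seen as an action that does not mention the restricted channel. -/
def Act.lift : Act S C → Act S (Option C)
  | snd c x => snd (some c) x
  | rcv c x => rcv (some c) x
  | sigma => sigma
  | tau => tau

open Classical in
/-- The effect on `Γ` of the start of a transmission of `x` along `c`. -/
noncomputable def Env.transmit (Γ : Env S C) (c : C) (x : S.Val) : Env S C := fun d =>
  if d = c then
    if Idle Γ c then (S.delta x, x) else (max (S.delta x) (Γ c).1, S.err)
  else Γ d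

/-- The effect of an action on a channel environment. -/
noncomputable def upd : Act S C → Env S C → Env S C
  | .snd c x, Γ => Γ.transmit c x
  | .rcv c x, Γ => Γ.transmit c x
  | .sigma, Γ => fun d => ((Γ d).1 - 1, (Γ d).2)
  | .tau, Γ => Γ

/-! ## Intensional semantics -/

open Proc Sys in
/-- The intensional transitions `Γ ▷ W --a--> W'`. -/
inductive Step : {C : Type u} → Env S C → Sys S C → Act S C → Sys S C → Prop where
  -- transmission
  | snd {C : Type u} {Γ : Env S C} (c : C) (e : Expr S 0) (P : Proc S C 0 0) :
      Step Γ (proc (bcast c e P)) (.snd c e.eval) (proc (delays (S.delta e.eval) P))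
  | rcv {C : Type u} {Γ : Env S C} (c : C) (x : S.Val) (P : Proc S C 1 0) (Q : Proc S C 0 0) :
      Idle Γ c → Step Γ (proc (Proc.rcv c P Q)) (.rcv c x) (arcv c P)
  | rcvIgn {C : Type u} {Γ : Env S C} (c : C) (x : S.Val) (W : Sys S C) :
      ¬ (Idle Γ c ∧ W.IsRcv c) → Step Γ W (.rcv c x) W
  | syncL {C : Type u} {Γ : Env S C} {c : C} {x : S.Val} {W₁ W₂ W₁' W₂' : Sys S C} :
      Step Γ W₁ (.snd c x) W₁' → Step Γ W₂ (.rcv c x) W₂' →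
      Step Γ (par W₁ W₂) (.snd c x) (par W₁' W₂')
  | syncR {C : Type u} {Γ : Env S C} {c : C} {x : S.Val} {W₁ W₂ W₁' W₂' : Sys S C} :
      Step Γ W₁ (.rcv c x) W₁' → Step Γ W₂ (.snd c x) W₂' →
      Step Γ (par W₁ W₂) (.snd c x) (par W₁' W₂')
  | rcvPar {C : Type u} {Γ : Env S C} {c : C} {x : S.Val} {W₁ W₂ W₁' W₂' : Sys S C} :
      Step Γ W₁ (.rcv c x) W₁' → Step Γ W₂ (.rcv c x) W₂' →
      Step Γ (par W₁ W₂) (.rcv c x) (par W₁' W₂')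
  -- timed transitions
  | timeNil {C : Type u} {Γ : Env S C} : Step Γ (proc nil) .sigma (proc nil)
  | sleep {C : Type u} {Γ : Env S C} (P : Proc S C 0 0) :
      Step Γ (proc (delay P)) .sigma (proc P)
  | actRcv {C : Type u} {Γ : Env S C} (c : C) (P : Proc S C 1 0) :
      1 < (Γ c).1 → Step Γ (arcv c P) .sigma (arcv c P)
  | endRcv {C : Type u} {Γ : Env S C} (c : C) (P : Proc S C 1 0) :
      (Γ c).1 = 1 → Step Γ (arcv c P) .sigma (proc (P.inst (Γ c).2))
  | timeout {C : Type u} {Γ : Env S C} (c : C) (P : Proc S C 1 0) (Q : Proc S C 0 0) :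
      Idle Γ c → Step Γ (proc (Proc.rcv c P Q)) .sigma (proc Q)
  -- internal activity
  | rcvLate {C : Type u} {Γ : Env S C} (c : C) (P : Proc S C 1 0) (Q : Proc S C 0 0) :
      Exposed Γ c → Step Γ (proc (Proc.rcv c P Q)) .tau (arcv c (P.inst S.err).weaken)
  | tau {C : Type u} {Γ : Env S C} (P : Proc S C 0 0) :
      Step Γ (proc (Proc.tau P)) .tau (proc P)
  | condThen {C : Type u} {Γ : Env S C} (b : BExp S C 0) (P Q : Proc S C 0 0) :
      b.Holds Γ → Step Γ (proc (cond b P Q)) .tau (proc (delay P))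
  | condElse {C : Type u} {Γ : Env S C} (b : BExp S C 0) (P Q : Proc S C 0 0) :
      ¬ b.Holds Γ → Step Γ (proc (cond b P Q)) .tau (proc (delay Q))
  -- structural rules
  | timePar {C : Type u} {Γ : Env S C} {W₁ W₂ W₁' W₂' : Sys S C} :
      Step Γ W₁ .sigma W₁' → Step Γ W₂ .sigma W₂' →
      Step Γ (par W₁ W₂) .sigma (par W₁' W₂')
  | tauParL {C : Type u} {Γ : Env S C} {W₁ W₁' : Sys S C} (W₂ : Sys S C) :
      Step Γ W₁ .tau W₁' → Step Γ (par W₁ W₂) .tau (par W₁' W₂)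
  | tauParR {C : Type u} {Γ : Env S C} {W₂ W₂' : Sys S C} (W₁ : Sys S C) :
      Step Γ W₂ .tau W₂' → Step Γ (par W₁ W₂) .tau (par W₁ W₂')
  | recur {C : Type u} {Γ : Env S C} {P : Proc S C 0 1} {a : Act S C} {W : Sys S C} :
      Step Γ (proc P.unfold) a W → Step Γ (proc (fix P)) a W
  | sumTauL {C : Type u} {Γ : Env S C} {P : Proc S C 0 0} {W : Sys S C} (Q : Proc S C 0 0) :
      Step Γ (proc P) .tau W → Step Γ (proc (choice P Q)) .tau W
  | sumTauR {C : Type u} {Γ : Env S C} {Q : Proc S C 0 0} {W : Sys S C} (P : Proc S C 0 0) :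
      Step Γ (proc Q) .tau W → Step Γ (proc (choice P Q)) .tau W
  | sumSndL {C : Type u} {Γ : Env S C} {c : C} {x : S.Val} {P : Proc S C 0 0} {W : Sys S C}
      (Q : Proc S C 0 0) :
      Step Γ (proc P) (.snd c x) W → Step Γ (proc (choice P Q)) (.snd c x) W
  | sumSndR {C : Type u} {Γ : Env S C} {c : C} {x : S.Val} {Q : Proc S C 0 0} {W : Sys S C}
      (P : Proc S C 0 0) :
      Step Γ (proc Q) (.snd c x) W → Step Γ (proc (choice P Q)) (.snd c x) W
  | sumTime {C : Type u} {Γ : Env S C} {P Q P' Q' : Proc S C 0 0} :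
      Step Γ (proc P) .sigma (proc P') → Step Γ (proc Q) .sigma (proc Q') →
      Step Γ (proc (choice P Q)) .sigma (proc (choice P' Q'))
  | sumRcvL {C : Type u} {Γ : Env S C} {c : C} {x : S.Val} {P : Proc S C 0 0} {W : Sys S C}
      (Q : Proc S C 0 0) :
      Step Γ (proc P) (.rcv c x) W → Idle Γ c → P.IsRcv c →
      Step Γ (proc (choice P Q)) (.rcv c x) W
  | sumRcvR {C : Type u} {Γ : Env S C} {c : C} {x : S.Val} {Q : Proc S C 0 0} {W : Sys S C}
      (P : Proc S C 0 0) :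
      Step Γ (proc Q) (.rcv c x) W → Idle Γ c → Q.IsRcv c →
      Step Γ (proc (choice P Q)) (.rcv c x) W
  | resI {C : Type u} {Γ : Env S C} {s : ℕ × S.Val} {x : S.Val} {W W' : Sys S (Option C)} :
      Step (Γ.ext s) W (.snd none x) W' →
      Step Γ (res s W) .tau (res (upd (.snd none x) (Γ.ext s) none) W')
  | resV {C : Type u} {Γ : Env S C} {s : ℕ × S.Val} {a : Act S C} {W W' : Sys S (Option C)} :
      Step (Γ.ext s) W a.lift W' →
      Step Γ (res s W) a (res (upd a.lift (Γ.ext s) none) W')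

/-! ## Configurations, reduction and reduction barbed congruence -/

/-- A configuration `Γ ▷ W`: a channel environment and a closed system term, all of whose
recursive definitions are guarded. -/
structure Config (S : Signature.{v, w}) (C : Type u) where
  env : Env S C
  sys : Sys S C
  guarded : sys.Guarded

namespace Config

/-- From `Γ ▷ W₁` to `Γ ▷ (W₁ | W)`. -/
def par (K : Config S C) (W : Sys S C) (hW : W.Guarded) : Config S C :=
  ⟨K.env, .par K.sys W, ⟨K.guarded, hW⟩⟩

/-- `K` performs the intensional action `a`, with its effect on the channel environment. -/
def Performs (K : Config S C) (a : Act S C) (K' : Config S C) : Prop :=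
  Step K.env K.sys a K'.sys ∧ K'.env = upd a K.env

/-- Reductions: transmission, passage of time, internal activity. -/
inductive Red : Config S C → Config S C → Prop where
  | transmission {K K' : Config S C} (c : C) (x : S.Val) : K.Performs (.snd c x) K' → Red K K'
  | time {K K' : Config S C} : K.Performs .sigma K' → Red K K'
  | internal {K K' : Config S C} : K.Performs .tau K' → Red K K'

/-- Strong barb on `c`. -/
def Barb (K : Config S C) (c : C) : Prop := Exposed K.env c

/-- Weak barb on `c`. -/
def WeakBarb (K : Config S C) (c : C) : Prop :=
  ∃ K', Relation.ReflTransGen Red K K' ∧ K'.Barb c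

end Config

/-- Barb preserving relations over configurations. -/
def BarbPreserving (R : Config S C → Config S C → Prop) : Prop :=
  ∀ K₁ K₂, R K₁ K₂ → ∀ c, K₁.WeakBarb c → K₂.WeakBarb c

/-- Reduction-closed relations over configurations. -/
def ReductionClosed (R : Config S C → Config S C → Prop) : Prop :=
  ∀ K₁ K₂, R K₁ K₂ → ∀ K₁', Config.Red K₁ K₁' →
    ∃ K₂', Relation.ReflTransGen Config.Red K₂ K₂' ∧ R K₁' K₂'

/-- Contextual relations over configurations. -/
def Contextual (R : Config S C → Config S C → Prop) : Prop :=
  ∀ K₁ K₂, R K₁ K₂ → ∀ (W : Sys S C) (hW : W.Guarded), R (K₁.par W hW) (K₂.par W hW)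

/-- Reduction barbed congruence `≃`: the union of all symmetric relations that are barb
preserving, reduction-closed and contextual (which is the largest such relation). -/
def BarbedCongruent (K₁ K₂ : Config S C) : Prop :=
  ∃ R : Config S C → Config S C → Prop,
    (∀ K L, R K L → R L K) ∧ BarbPreserving R ∧ ReductionClosed R ∧ Contextual R ∧ R K₁ K₂

/-! ## Extensional semantics and bisimilarity -/

/-- Extensional actions `τ`, `σ`, `c?x`, `γ(c,x)`, `ι(c)`. -/
inductive ExtAct (S : Signature.{v, w}) (C : Type u) : Type (max u v) where
  | tau : ExtAct S C
  | sigma : ExtAct S C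
  | input (c : C) (x : S.Val) : ExtAct S C
  | deliver (c : C) (x : S.Val) : ExtAct S C
  | idle (c : C) : ExtAct S C

/-- The extensional transitions. -/
inductive ExtStep : Config S C → ExtAct S C → Config S C → Prop where
  | input {K K' : Config S C} (c : C) (x : S.Val) :
      K.Performs (.rcv c x) K' → ExtStep K (.input c x) K'
  | time {K K' : Config S C} : K.Performs .sigma K' → ExtStep K .sigma K'
  | shh {K K' : Config S C} (c : C) (x : S.Val) : K.Performs (.snd c x) K' → ExtStep K .tau K'
  | tauExt {K K' : Config S C} : K.Performs .tau K' → ExtStep K .tau K'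
  | deliver {K K' : Config S C} (c : C) (x : S.Val) :
      K.env c = (1, x) → K.Performs .sigma K' → ExtStep K (.deliver c x) K'
  | idle {K : Config S C} (c : C) : Idle K.env c → ExtStep K (.idle c) K

/-- A finite sequence of extensional `τ`-transitions. -/
def ExtTaus : Config S C → Config S C → Prop :=
  Relation.ReflTransGen (fun K K' => ExtStep K .tau K')

/-- The weak extensional transitions used to match an action: `τ*` for `τ`, and `τ* α τ*` for
`α ≠ τ`. -/
def WeakExtStep (K : Config S C) (α : ExtAct S C) (K' : Config S C) : Prop :=
  (α = .tau ∧ ExtTaus K K') ∨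
    (α ≠ .tau ∧ ∃ L L', ExtTaus K L ∧ ExtStep L α L' ∧ ExtTaus L' K')

/-- Weak bisimulations. -/
def IsBisimulation (R : Config S C → Config S C → Prop) : Prop :=
  ∀ K₁ K₂, R K₁ K₂ → ∀ α,
    (∀ K₁', ExtStep K₁ α K₁' → ∃ K₂', WeakExtStep K₂ α K₂' ∧ R K₁' K₂') ∧
    (∀ K₂', ExtStep K₂ α K₂' → ∃ K₁', WeakExtStep K₁ α K₁' ∧ R K₁' K₂')

/-- Weak bisimilarity `≈`. -/
def Bisimilar (K₁ K₂ : Config S C) : Prop :=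
  ∃ R : Config S C → Config S C → Prop, IsBisimulation R ∧ R K₁ K₂

/-! ## Well-formed configurations -/

/-- The least set of pairs `Γ ▷ W` that contains no active receiver along an idle channel. -/
inductive WNets : {C : Type u} → Env S C → Sys S C → Prop where
  | proc {C : Type u} {Γ : Env S C} (P : Proc S C 0 0) : WNets Γ (.proc P)
  | arcv {C : Type u} {Γ : Env S C} (c : C) (P : Proc S C 1 0) :
      Exposed Γ c → WNets Γ (.arcv c P)
  | par {C : Type u} {Γ : Env S C} {W₁ W₂ : Sys S C} :
      WNets Γ W₁ → WNets Γ W₂ → WNets Γ (.par W₁ W₂)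
  | res {C : Type u} {Γ : Env S C} {s : ℕ × S.Val} {W : Sys S (Option C)} :
      WNets (Γ.ext s) W → WNets Γ (.res s W)

/-- Well-formed configurations. -/
def Config.WellFormed (K : Config S C) : Prop := WNets K.env K.sys

/-- Infinitely many channels are idle. As finitely many channels occur in a system term, this
says that fresh channels (idle and not occurring in a given term) can always be picked. -/
def Config.HasFreshChannels (K : Config S C) : Prop := {c | Idle K.env c}.Infinite

end CCCP

/-! Barbed congruence is preserved by every context, and each observable action can be detected by a
context. An input `c?x` is provoked by a component that transmits `x` along `c`, idleness is read
off by a test of `exp(c)`, and the end of a transmission by an active receiver that compares the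
received value with `x`. The tests report through fresh channels. A fresh channel that a test can
still signal on is a weak barb; one that the test has given up is `Dead`, that is, idle and not
occurring, and never becomes a barb again. Presence and absence of such barbs reveal the branch that
a test has taken.

There are two obstacles. The first is that a reduction may be instantaneous or a passage of time,
and that it is answered by any sequence of reductions. Configurations are therefore kept next to
`halt g h`, the choice between two signals. It blocks time while it is pending, and when it fires it
loses one of its two barbs. As long as both barbs remain, only instantaneous steps have occurred
(`Rel.tau`). To match one `σ`, a delayed `gate e f p` is added and `halt g h` is made to fire on
`g`. After time has passed, the gate turns into a new `halt e f` and gives up `p`. Barbs on `e` and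
`f` without one on `p` then certify exactly one `σ` (`Rel.sigma`).

The second is that a spent test cannot be cancelled from a context. So the bisimulation is not
barbed congruence but `Rel`: barbed congruence next to private terms over a finite set `F` of
channels that do not occur in the configurations, and next to a `halt`. What remains of a test is
absorbed into the private term (`Armed.absorb`). The environment of the composition may then differ
at `F` from that of the configuration; there it is only recorded that the two configurations
`Agree`, which settles the actions on private channels. Private terms must not stop time for ever.
This follows from well-formedness and guarded recursion, by a measure of urgency that instantaneous
steps decrease (`Config.WellFormed.exists_time`).

Contexts have to be rearranged, and ignoring a message may unfold recursion. Hence everything is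
done up to `SEq`, a strong bisimulation in every environment (`SEq.simulate`) under which barbed
congruence is closed (`BarbedCongruent.congr`). The analysis of runs next to tests rests on
`Testing.red`, and the matching of all actions is put together in `Rel.extStep`. -/

namespace CCCP

variable {S : Signature.{v, w}} {C : Type u}

/-! ## Free channels -/

/-- The channels of a Boolean expression. -/
def BExp.chans {n : ℕ} : BExp S C n → Set C
  | eq _ _ => ∅
  | exposed c => {c}

/-- The channels of station code. -/
def Proc.chans {n m : ℕ} : Proc S C n m → Set C
  | bcast c _ P => insert c P.chans
  | rcv c P Q => insert c (P.chans ∪ Q.chans)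
  | delay P => P.chans
  | tau P => P.chans
  | choice P Q => P.chans ∪ Q.chans
  | cond b P Q => b.chans ∪ (P.chans ∪ Q.chans)
  | var _ => ∅
  | nil => ∅
  | fix P => P.chans

/-- The free channels of a system term. -/
def Sys.chans : {C : Type u} → Sys S C → Set C
  | _, proc P => P.chans
  | _, arcv c P => insert c P.chans
  | _, par W₁ W₂ => W₁.chans ∪ W₂.chans
  | _, res _ W => some ⁻¹' W.chans

theorem BExp.finite_chans {n : ℕ} (b : BExp S C n) : b.chans.Finite := by
  cases b <;> simp [chans]

theorem Proc.finite_chans {n m : ℕ} (P : Proc S C n m) : P.chans.Finite := by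
  induction P <;> simp_all [chans, BExp.finite_chans]

theorem Sys.finite_chans {C : Type u} (W : Sys S C) : W.chans.Finite := by
  induction W with
  | proc P => exact P.finite_chans
  | arcv c P => exact P.finite_chans.insert _
  | par W₁ W₂ h₁ h₂ => exact h₁.union h₂
  | res s W h => exact h.preimage (Option.some_injective _).injOn

namespace Proc

@[simp] theorem chans_substData {n k m : ℕ} (P : Proc S C n m) (f : Fin n → Expr S k) :
    (P.substData f).chans = P.chans := by
  induction P generalizing k with
  | cond b P Q hP hQ => cases b <;> simp_all [chans, substData, BExp.subst, BExp.chans]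
  | _ => simp_all [chans, substData]

@[simp] theorem chans_weaken {n m : ℕ} (P : Proc S C n m) : P.weaken.chans = P.chans :=
  chans_substData _ _

@[simp] theorem chans_inst {n m : ℕ} (P : Proc S C (n + 1) m) (x : S.Val) :
    (P.inst x).chans = P.chans :=
  chans_substData _ _

@[simp] theorem chans_renameVar {n m l : ℕ} (P : Proc S C n m) (f : Fin m → Fin l) :
    (P.renameVar f).chans = P.chans := by
  induction P generalizing l <;> simp_all [chans, renameVar]

theorem chans_subset_substVar {n m l : ℕ} (P : Proc S C n m) (f : Fin m → Proc S C n l) :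
    P.chans ⊆ (P.substVar f).chans := by
  induction P generalizing l with
  | var X => simp [chans]
  | nil => simp [chans]
  | bcast c e P h => exact Set.insert_subset_insert (h _)
  | rcv c P Q hP hQ => exact Set.insert_subset_insert (Set.union_subset_union (hP _) (hQ _))
  | delay P h => exact h _
  | tau P h => exact h _
  | choice P Q hP hQ => exact Set.union_subset_union (hP _) (hQ _)
  | cond b P Q hP hQ =>
    exact Set.union_subset_union subset_rfl (Set.union_subset_union (hP _) (hQ _))
  | fix P h => exact h _

theorem chans_substVar_subset {n m l : ℕ} (P : Proc S C n m) (f : Fin m → Proc S C n l)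
    {A : Set C} (hf : ∀ X, (f X).chans ⊆ A) (hP : P.chans ⊆ A) : (P.substVar f).chans ⊆ A := by
  induction P generalizing l with
  | var X => exact hf X
  | nil => exact hP
  | bcast c e P h =>
    simp only [chans, substVar, Set.insert_subset_iff] at hP ⊢
    exact ⟨hP.1, h _ hf hP.2⟩
  | rcv c P Q h₁ h₂ =>
    simp only [chans, substVar, Set.insert_subset_iff, Set.union_subset_iff] at hP ⊢
    exact ⟨hP.1, h₁ _ (by simpa using hf) hP.2.1, h₂ _ hf hP.2.2⟩
  | delay P h => exact h _ hf hP
  | tau P h => exact h _ hf hP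
  | choice P Q h₁ h₂ =>
    simp only [chans, substVar, Set.union_subset_iff] at hP ⊢
    exact ⟨h₁ _ hf hP.1, h₂ _ hf hP.2⟩
  | cond b P Q h₁ h₂ =>
    simp only [chans, substVar, Set.union_subset_iff] at hP ⊢
    exact ⟨hP.1, h₁ _ hf hP.2.1, h₂ _ hf hP.2.2⟩
  | fix P h =>
    refine h _ (fun X => ?_) hP
    cases X using Fin.cases
    · simp [chans]
    · simpa using hf _

@[simp] theorem chans_unfold {n m : ℕ} (P : Proc S C n (m + 1)) : P.unfold.chans = P.chans := by
  refine (chans_substVar_subset _ _ (fun X => ?_) subset_rfl).antisymm (chans_subset_substVar _ _)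
  cases X using Fin.cases <;> simp [chans]

@[simp] theorem chans_delays {n m : ℕ} (k : ℕ) (P : Proc S C n m) :
    (delays k P).chans = P.chans := by
  induction k with
  | zero => rfl
  | succ k h => rw [delays, Function.iterate_succ_apply']; exact h

/-! ## Unguarded receivers -/

theorem IsRcv.mem_chans {n m : ℕ} {P : Proc S C n m} {c : C} (h : P.IsRcv c) : c ∈ P.chans := by
  induction P <;> simp_all [IsRcv, chans]
  tauto

@[simp] theorem isRcv_renameVar {n m l : ℕ} (P : Proc S C n m) (f : Fin m → Fin l) (c : C) :
    (P.renameVar f).IsRcv c ↔ P.IsRcv c := by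
  induction P generalizing l <;> simp_all [IsRcv, renameVar]

theorem IsRcv.substVar {n m l : ℕ} {P : Proc S C n m} {c : C} (h : P.IsRcv c)
    (f : Fin m → Proc S C n l) : (P.substVar f).IsRcv c := by
  induction P generalizing l with
  | choice P Q hP hQ => exact h.imp (fun h => hP h f) (fun h => hQ h f)
  | fix P hP => exact hP h _
  | rcv => exact h
  | _ => exact h.elim

theorem IsRcv.of_substVar {n m l : ℕ} {P : Proc S C n m} {c : C} {f : Fin m → Proc S C n l}
    (h : (P.substVar f).IsRcv c) : P.IsRcv c ∨ ∃ X, (f X).IsRcv c := by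
  induction P generalizing l with
  | choice P Q hP hQ =>
    rcases h with h | h
    · exact (hP h).imp_left Or.inl
    · exact (hQ h).imp_left Or.inr
  | fix P hP =>
    rcases hP h with h | ⟨X, h⟩
    · exact .inl h
    · cases X using Fin.cases with
      | zero => exact h.elim
      | succ X => exact .inr ⟨X, by simpa using h⟩
  | rcv => exact .inl h
  | var X => exact .inr ⟨X, h⟩
  | _ => exact h.elim

-- Guardedness plays no role here: a receiver that the substitution brings to an unguarded
-- occurrence of the variable is a receiver of `fix P`, hence one of `P`.
@[simp] theorem isRcv_unfold {n m : ℕ} (P : Proc S C n (m + 1)) (c : C) :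
    P.unfold.IsRcv c ↔ P.IsRcv c := by
  refine ⟨fun h => ?_, fun h => h.substVar _⟩
  rcases h.of_substVar with h | ⟨X, h⟩
  · exact h
  · cases X using Fin.cases with
    | zero => exact h
    | succ X => exact h.elim

/-! ## Guardedness and substitution -/

@[simp] theorem guardedIn_substData {n k m : ℕ} (P : Proc S C n m) (f : Fin n → Expr S k)
    (X : Fin m) : (P.substData f).GuardedIn X ↔ P.GuardedIn X := by
  induction P generalizing k <;> simp_all [GuardedIn, substData]

@[simp] theorem guarded_substData {n k m : ℕ} (P : Proc S C n m) (f : Fin n → Expr S k) :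
    (P.substData f).Guarded ↔ P.Guarded := by
  induction P generalizing k <;> simp_all [Guarded, substData]

theorem guardedIn_renameVar {n m l : ℕ} (P : Proc S C n m) (f : Fin m → Fin l) (Y : Fin l)
    (h : ∀ X, f X = Y → P.GuardedIn X) : (P.renameVar f).GuardedIn Y := by
  induction P generalizing l with
  | var X => exact fun e => h X e rfl
  | tau P hP => exact hP _ _ h
  | choice P Q hP hQ => exact ⟨hP _ _ fun X e => (h X e).1, hQ _ _ fun X e => (h X e).2⟩
  | fix P hP =>
    refine hP _ _ fun X e => ?_
    cases X using Fin.cases with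
    | zero => exact absurd e (Fin.succ_ne_zero _).symm
    | succ X => exact h X (Fin.succ_injective _ e)
  | _ => trivial

theorem guarded_renameVar {n m l : ℕ} (P : Proc S C n m) (f : Fin m → Fin l)
    (h : P.Guarded) : (P.renameVar f).Guarded := by
  induction P generalizing l with
  | fix P hP =>
    refine ⟨guardedIn_renameVar _ _ _ fun X e => ?_, hP _ h.2⟩
    cases X using Fin.cases with
    | zero => exact h.1
    | succ X => exact absurd e (Fin.succ_ne_zero _)
  | _ => simp_all [Guarded, renameVar]

theorem guardedIn_substVar {n m l : ℕ} (P : Proc S C n m) (f : Fin m → Proc S C n l) (Y : Fin l)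
    (h : ∀ X, P.GuardedIn X ∨ (f X).GuardedIn Y) : (P.substVar f).GuardedIn Y := by
  induction P generalizing l with
  | var X => exact (h X).resolve_left fun h => h rfl
  | tau P hP => exact hP _ _ h
  | choice P Q hP hQ =>
    exact ⟨hP _ _ fun X => (h X).imp_left And.left, hQ _ _ fun X => (h X).imp_left And.right⟩
  | fix P hP =>
    refine hP _ _ fun X => ?_
    cases X using Fin.cases with
    | zero => exact .inr (Fin.succ_ne_zero _).symm
    | succ X =>
      refine (h X).imp_right fun h => guardedIn_renameVar _ _ _ fun Z e => ?_
      rwa [Fin.succ_injective _ e]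
  | _ => trivial

theorem guarded_substVar {n m l : ℕ} (P : Proc S C n m) (f : Fin m → Proc S C n l)
    (hf : ∀ X, (f X).Guarded) (h : P.Guarded) : (P.substVar f).Guarded := by
  induction P generalizing l with
  | var X => exact hf X
  | rcv c P Q hP hQ =>
    exact ⟨hP _ (fun X => (guarded_substData _ _).2 (hf X)) h.1, hQ _ hf h.2⟩
  | fix P hP =>
    refine ⟨guardedIn_substVar _ _ _ fun X => ?_, hP _ (fun X => ?_) h.2⟩
    · cases X using Fin.cases with
      | zero => exact .inl h.1
      | succ X => exact .inr (guardedIn_renameVar _ _ _ fun Z e => absurd e (Fin.succ_ne_zero _))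
    · cases X using Fin.cases with
      | zero => trivial
      | succ X => exact guarded_renameVar _ _ (hf X)
  | _ => simp_all [Guarded, substVar]

theorem guarded_unfold {n m : ℕ} {P : Proc S C n (m + 1)} (h : (fix P).Guarded) :
    P.unfold.Guarded := by
  refine guarded_substVar _ _ (fun X => ?_) h.2
  cases X using Fin.cases with
  | zero => exact h
  | succ X => trivial

theorem guarded_delays {n m : ℕ} (k : ℕ) {P : Proc S C n m} (h : P.Guarded) :
    (delays k P).Guarded := by
  induction k with
  | zero => exact h
  | succ k h => rw [delays, Function.iterate_succ_apply']; exact h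

/-- The number of unguarded constructors that stand in the way of the passage of time; it bounds
the number of consecutive instantaneous transitions. -/
def urgency {n m : ℕ} : Proc S C n m → ℕ
  | bcast _ _ _ => 1
  | rcv _ _ _ => 1
  | delay _ => 0
  | tau P => P.urgency + 1
  | choice P Q => P.urgency + Q.urgency + 1
  | cond _ _ _ => 1
  | var _ => 0
  | nil => 0
  | fix P => P.urgency + 1

@[simp] theorem urgency_renameVar {n m l : ℕ} (P : Proc S C n m) (f : Fin m → Fin l) :
    (P.renameVar f).urgency = P.urgency := by
  induction P generalizing l <;> simp_all [urgency, renameVar]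

/-- A guarded variable lies under a constructor whose urgency ignores its continuations; any other
variable has urgency zero, as has the code that replaces it. -/
theorem urgency_substVar {n m l : ℕ} (P : Proc S C n m) (f : Fin m → Proc S C n l)
    (h : ∀ X, P.GuardedIn X ∨ (f X).urgency = 0) : (P.substVar f).urgency = P.urgency := by
  induction P generalizing l with
  | var X => exact (h X).resolve_left fun h => h rfl
  | tau P hP => exact congrArg (· + 1) (hP _ h)
  | choice P Q hP hQ =>
    simp only [urgency, substVar]
    rw [hP _ fun X => (h X).imp_left And.left, hQ _ fun X => (h X).imp_left And.right]
  | fix P hP =>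
    refine congrArg (· + 1) (hP _ fun X => ?_)
    cases X using Fin.cases with
    | zero => exact .inr rfl
    | succ X => exact (h X).imp_right (urgency_renameVar _ _).trans
  | _ => rfl

/-- Since `fix P` has urgency one more than `P`, unfolding guarded recursion lowers the urgency.
This replaces structural induction, for which `P.unfold` is out of reach. -/
theorem urgency_unfold {n m : ℕ} {P : Proc S C n (m + 1)} (h : (fix P).Guarded) :
    P.unfold.urgency = P.urgency := by
  refine urgency_substVar _ _ fun X => ?_
  cases X using Fin.cases with
  | zero => exact .inl h.1
  | succ X => exact .inr rfl

theorem urgency_delays {n m k : ℕ} (hk : 0 < k) (P : Proc S C n m) :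
    (delays k P).urgency = 0 := by
  obtain ⟨k, rfl⟩ := Nat.exists_eq_add_of_lt hk
  rw [delays, Function.iterate_succ_apply']
  rfl

end Proc

/-- The urgency of a system term. -/
def Sys.urgency : {C : Type u} → Sys S C → ℕ
  | _, proc P => P.urgency
  | _, arcv _ _ => 0
  | _, par W₁ W₂ => W₁.urgency + W₂.urgency
  | _, res _ W => W.urgency

theorem Sys.IsRcv.mem_chans {C : Type u} {W : Sys S C} {c : C} (h : W.IsRcv c) :
    c ∈ W.chans := by
  induction W with
  | proc P => exact Proc.IsRcv.mem_chans h
  | arcv d P => exact h.elim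
  | par W₁ W₂ h₁ h₂ => exact h.imp h₁ h₂
  | res s W hW => exact hW h

/-! ## Channel environments -/

section Env

variable {Γ Γ' : Env S C} {c d : C} {x : S.Val}

theorem Env.transmit_of_ne (h : d ≠ c) : Γ.transmit c x d = Γ d := if_neg h

theorem Env.exposed_transmit : Exposed (Γ.transmit c x) c := by
  have := S.delta_pos x
  unfold Exposed Idle Env.transmit
  rw [if_pos rfl]
  split_ifs
  · exact this.ne'
  · exact (lt_max_of_lt_left this).ne'

theorem Exposed.transmit (h : Exposed Γ d) : Exposed (Γ.transmit c x) d := by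
  by_cases e : d = c
  · subst e; exact Env.exposed_transmit
  · unfold Exposed Idle; rwa [Env.transmit_of_ne e]

theorem Env.transmit_idle (h : Idle Γ c) : Γ.transmit c x c = (S.delta x, x) := by
  rw [Env.transmit, if_pos rfl, if_pos h]

theorem Env.transmit_exposed (h : Exposed Γ c) :
    Γ.transmit c x c = (max (S.delta x) (Γ c).1, S.err) := by
  rw [Env.transmit, if_pos rfl, if_neg h]

theorem Env.transmit_congr (h : Γ d = Γ' d) : Γ.transmit c x d = Γ'.transmit c x d := by
  by_cases e : d = c
  · subst e
    by_cases hi : Idle Γ d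
    · rw [Env.transmit_idle hi, Env.transmit_idle (by rwa [Idle, ← h])]
    · rw [Env.transmit_exposed hi, Env.transmit_exposed (by rwa [Exposed, Idle, ← h]), h]
  · rw [Env.transmit_of_ne e, Env.transmit_of_ne e, h]

theorem upd_congr (a : Act S C) (h : Γ d = Γ' d) : upd a Γ d = upd a Γ' d := by
  cases a with
  | snd c x => exact Env.transmit_congr h
  | rcv c x => exact Env.transmit_congr h
  | sigma => simp only [upd, h]
  | tau => exact h

theorem upd_lift_none_of_ne_sigma {a : Act S C} (ha : a ≠ .sigma) (Γ : Env S (Option C)) :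
    upd a.lift Γ none = Γ none := by
  cases a with
  | snd c x => exact Env.transmit_of_ne (Option.some_ne_none c).symm
  | rcv c x => exact Env.transmit_of_ne (Option.some_ne_none c).symm
  | sigma => exact absurd rfl ha
  | tau => rfl

/-- Inside a restriction an update is an update of the outer environment together with a new state
of the restricted channel; in this form the induction hypothesis applies under `ν`. -/
theorem upd_lift_ext (a : Act S C) (Γ : Env S C) (s : ℕ × S.Val) :
    upd a.lift (Γ.ext s) = (upd a Γ).ext (upd a.lift (Γ.ext s) none) := by
  funext d
  cases d with
  | none => rfl
  | some d =>
    have key : ∀ (c : C) (x : S.Val),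
        Env.transmit (Γ.ext s) (some c) x (some d) = Γ.transmit c x d := by
      intro c x
      by_cases e : d = c
      · subst e
        by_cases hi : Idle Γ d
        · rw [Env.transmit_idle hi, Env.transmit_idle (by exact hi)]
        · rw [Env.transmit_exposed hi, Env.transmit_exposed (by exact hi)]; rfl
      · rw [Env.transmit_of_ne e, Env.transmit_of_ne (by simpa using e)]; rfl
    cases a with
    | snd c x => exact key c x
    | rcv c x => exact key c x
    | sigma => rfl
    | tau => rfl

theorem upd_snd_none_ext (Γ : Env S C) (s : ℕ × S.Val) (x : S.Val) :
    upd (.snd none x) (Γ.ext s) = Γ.ext (upd (.snd none x) (Γ.ext s) none) := by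
  funext d
  cases d with
  | none => rfl
  | some d => exact Env.transmit_of_ne (Option.some_ne_none d)

end Env

/-! ## Invariants of the intensional transitions -/

theorem Sys.guarded_step {C : Type u} {Γ : Env S C} {W W' : Sys S C} {a : Act S C}
    (h : Step Γ W a W') (hW : W.Guarded) : W'.Guarded := by
  induction h with
  | snd c e P => exact Proc.guarded_delays _ hW
  | rcv c x P Q _ => exact hW.1
  | rcvIgn => exact hW
  | syncL _ _ h₁ h₂ => exact ⟨h₁ hW.1, h₂ hW.2⟩
  | syncR _ _ h₁ h₂ => exact ⟨h₁ hW.1, h₂ hW.2⟩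
  | rcvPar _ _ h₁ h₂ => exact ⟨h₁ hW.1, h₂ hW.2⟩
  | timeNil => exact hW
  | sleep P => exact hW
  | actRcv c P _ => exact hW
  | endRcv c P _ => exact (Proc.guarded_substData _ _).2 hW
  | timeout c P Q _ => exact hW.2
  | rcvLate c P Q _ =>
    exact (Proc.guarded_substData _ _).2 ((Proc.guarded_substData _ _).2 hW.1)
  | tau P => exact hW
  | condThen b P Q _ => exact hW.1
  | condElse b P Q _ => exact hW.2
  | timePar _ _ h₁ h₂ => exact ⟨h₁ hW.1, h₂ hW.2⟩
  | tauParL W₂ _ h => exact ⟨h hW.1, hW.2⟩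
  | tauParR W₁ _ h => exact ⟨hW.1, h hW.2⟩
  | recur _ h => exact h (Proc.guarded_unfold hW)
  | sumTauL Q _ h => exact h hW.1
  | sumTauR P _ h => exact h hW.2
  | sumSndL Q _ h => exact h hW.1
  | sumSndR P _ h => exact h hW.2
  | sumTime _ _ h₁ h₂ => exact ⟨h₁ hW.1, h₂ hW.2⟩
  | sumRcvL Q _ _ _ h => exact h hW.1
  | sumRcvR P _ _ _ h => exact h hW.2
  | resI _ h => exact h hW
  | resV _ h => exact h hW

theorem Sys.chans_step {C : Type u} {Γ : Env S C} {W W' : Sys S C} {a : Act S C}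
    (h : Step Γ W a W') : W'.chans ⊆ W.chans := by
  induction h with
  | snd c e P => simp [chans, Proc.chans]
  | rcv c x P Q _ => exact Set.insert_subset_insert Set.subset_union_left
  | rcvIgn => exact subset_rfl
  | syncL _ _ h₁ h₂ => exact Set.union_subset_union h₁ h₂
  | syncR _ _ h₁ h₂ => exact Set.union_subset_union h₁ h₂
  | rcvPar _ _ h₁ h₂ => exact Set.union_subset_union h₁ h₂
  | timeNil => exact subset_rfl
  | sleep P => exact subset_rfl
  | actRcv c P _ => exact subset_rfl
  | endRcv c P _ => simp [chans]
  | timeout c P Q _ => exact Set.subset_union_right.trans (Set.subset_insert _ _)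
  | rcvLate c P Q _ =>
    simpa [chans, Proc.chans] using Set.insert_subset_insert Set.subset_union_left
  | tau P => exact subset_rfl
  | condThen b P Q _ => exact Set.subset_union_left.trans Set.subset_union_right
  | condElse b P Q _ => exact Set.subset_union_right.trans Set.subset_union_right
  | timePar _ _ h₁ h₂ => exact Set.union_subset_union h₁ h₂
  | tauParL W₂ _ h => exact Set.union_subset_union h subset_rfl
  | tauParR W₁ _ h => exact Set.union_subset_union subset_rfl h
  | recur _ h => simpa [chans, Proc.chans] using h
  | sumTauL Q _ h => exact h.trans Set.subset_union_left
  | sumTauR P _ h => exact h.trans Set.subset_union_right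
  | sumSndL Q _ h => exact h.trans Set.subset_union_left
  | sumSndR P _ h => exact h.trans Set.subset_union_right
  | sumTime _ _ h₁ h₂ => exact Set.union_subset_union h₁ h₂
  | sumRcvL Q _ _ _ h => exact h.trans Set.subset_union_left
  | sumRcvR P _ _ _ h => exact h.trans Set.subset_union_right
  | resI _ h => exact Set.preimage_mono h
  | resV _ h => exact Set.preimage_mono h

theorem Sys.mem_chans_of_snd {C : Type u} {Γ : Env S C} {W W' : Sys S C} {c : C} {x : S.Val}
    (h : Step Γ W (.snd c x) W') : c ∈ W.chans := by
  generalize ha : Act.snd c x = a at h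
  induction h with
  | snd d e P => cases ha; exact Set.mem_insert _ _
  | syncL _ _ h₁ _ => cases ha; exact .inl (h₁ rfl)
  | syncR _ _ _ h₂ => cases ha; exact .inr (h₂ rfl)
  | recur _ h => simpa [chans, Proc.chans] using h ha
  | sumSndL Q _ h => exact .inl (h ha)
  | sumSndR P _ h => exact .inr (h ha)
  | resV _ h => subst ha; exact h rfl
  | _ => cases ha

/-- The transitions of a system term depend on the environment at its own channels only. -/
theorem Step.congr_env {C : Type u} {Γ Γ' : Env S C} {W W' : Sys S C} {a : Act S C}
    (h : Step Γ W a W') (hΓ : ∀ c ∈ W.chans, Γ c = Γ' c) : Step Γ' W a W' := by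
  induction h with
  | snd c e P => exact .snd c e P
  | rcv c x P Q hc => exact .rcv c x P Q (by rwa [Idle, ← hΓ c (Set.mem_insert _ _)])
  | rcvIgn c x W hc =>
    refine .rcvIgn c x W fun h => hc ⟨?_, h.2⟩
    rw [Idle, hΓ c h.2.mem_chans]; exact h.1
  | syncL _ _ h₁ h₂ =>
    exact .syncL (h₁ fun c hc => hΓ c (.inl hc)) (h₂ fun c hc => hΓ c (.inr hc))
  | syncR _ _ h₁ h₂ =>
    exact .syncR (h₁ fun c hc => hΓ c (.inl hc)) (h₂ fun c hc => hΓ c (.inr hc))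
  | rcvPar _ _ h₁ h₂ =>
    exact .rcvPar (h₁ fun c hc => hΓ c (.inl hc)) (h₂ fun c hc => hΓ c (.inr hc))
  | timeNil => exact .timeNil
  | sleep P => exact .sleep P
  | actRcv c P h => exact .actRcv c P (by rwa [← hΓ c (Set.mem_insert _ _)])
  | endRcv c P h =>
    have e := hΓ c (Set.mem_insert _ _)
    rw [e] at h ⊢
    exact .endRcv c P h
  | timeout c P Q hc => exact .timeout c P Q (by rwa [Idle, ← hΓ c (Set.mem_insert _ _)])
  | rcvLate c P Q hc =>
    exact .rcvLate c P Q (by rwa [Exposed, Idle, ← hΓ c (Set.mem_insert _ _)])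
  | tau P => exact .tau P
  | @condThen _ Γ b P Q hb =>
    refine .condThen b P Q ?_
    cases b with
    | eq => exact hb
    | exposed c => exact fun h => hb (by rwa [Idle, hΓ c (.inl rfl)])
  | @condElse _ Γ b P Q hb =>
    refine .condElse b P Q fun h => hb ?_
    cases b with
    | eq => exact h
    | exposed c => exact fun hc => h (by rwa [Idle, ← hΓ c (.inl rfl)])
  | timePar _ _ h₁ h₂ =>
    exact .timePar (h₁ fun c hc => hΓ c (.inl hc)) (h₂ fun c hc => hΓ c (.inr hc))
  | tauParL W₂ _ h => exact .tauParL W₂ (h fun c hc => hΓ c (.inl hc))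
  | tauParR W₁ _ h => exact .tauParR W₁ (h fun c hc => hΓ c (.inr hc))
  | recur _ h => exact .recur (h fun c hc => hΓ c (by simpa [Sys.chans, Proc.chans] using hc))
  | sumTauL Q _ h => exact .sumTauL Q (h fun c hc => hΓ c (.inl hc))
  | sumTauR P _ h => exact .sumTauR P (h fun c hc => hΓ c (.inr hc))
  | sumSndL Q _ h => exact .sumSndL Q (h fun c hc => hΓ c (.inl hc))
  | sumSndR P _ h => exact .sumSndR P (h fun c hc => hΓ c (.inr hc))
  | sumTime _ _ h₁ h₂ =>
    exact .sumTime (h₁ fun c hc => hΓ c (.inl hc)) (h₂ fun c hc => hΓ c (.inr hc))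
  | sumRcvL Q _ hc hP h =>
    exact .sumRcvL Q (h fun c hc => hΓ c (.inl hc))
      (by rwa [Idle, ← hΓ _ (.inl hP.mem_chans)]) hP
  | sumRcvR P _ hc hQ h =>
    exact .sumRcvR P (h fun c hc => hΓ c (.inr hc))
      (by rwa [Idle, ← hΓ _ (.inr hQ.mem_chans)]) hQ
  | @resI _ Γ s x W W' _ h =>
    have : Step (Γ'.ext s) W (.snd none x) W' := h fun c hc => by
      cases c with
      | none => rfl
      | some c => exact hΓ c hc
    -- Both extensions give the restricted channel the state `s`, so the updated restriction is the
    -- same in both environments.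
    rw [upd_congr (Γ := Γ.ext s) (Γ' := Γ'.ext s) _ rfl]
    exact .resI this
  | @resV _ Γ s a W W' _ h =>
    have : Step (Γ'.ext s) W a.lift W' := h fun c hc => by
      cases c with
      | none => rfl
      | some c => exact hΓ c hc
    rw [upd_congr (Γ := Γ.ext s) (Γ' := Γ'.ext s) _ rfl]
    exact .resV this

/-! ## Well-formedness -/

theorem WNets.mono {C : Type u} {Γ Γ' : Env S C} {W : Sys S C} (h : WNets Γ W)
    (hΓ : ∀ c ∈ W.chans, Exposed Γ c → Exposed Γ' c) : WNets Γ' W := by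
  induction h with
  | proc P => exact .proc P
  | arcv c P hc => exact .arcv c P (hΓ c (Set.mem_insert _ _) hc)
  | par _ _ h₁ h₂ => exact .par (h₁ fun c hc => hΓ c (.inl hc)) (h₂ fun c hc => hΓ c (.inr hc))
  | @res _ Γ s W _ h =>
    refine .res (h fun c hc => ?_)
    cases c with
    | none => exact id
    | some c => exact hΓ c hc

theorem WNets.transmit {C : Type u} {Γ : Env S C} {W : Sys S C} (h : WNets Γ W) (c : C)
    (x : S.Val) : WNets (Γ.transmit c x) W :=
  h.mono fun _ _ => Exposed.transmit

/-- An active receiver arises from an input, which exposes the channel, or from a late reception,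
which presupposes exposure. It survives `σ` only if more than one time slot is left. -/
theorem WNets.step {C : Type u} {Γ : Env S C} {W W' : Sys S C} {a : Act S C}
    (h : Step Γ W a W') (hW : WNets Γ W) : WNets (upd a Γ) W' := by
  induction h with
  | rcv c x P Q _ => exact .arcv c P Env.exposed_transmit
  | rcvIgn c x W _ => exact hW.transmit c x
  | syncL _ _ h₁ h₂ => cases hW with | par w₁ w₂ => exact .par (h₁ w₁) (h₂ w₂)
  | syncR _ _ h₁ h₂ => cases hW with | par w₁ w₂ => exact .par (h₁ w₁) (h₂ w₂)
  | rcvPar _ _ h₁ h₂ => cases hW with | par w₁ w₂ => exact .par (h₁ w₁) (h₂ w₂)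
  | actRcv c P h => exact .arcv c P (by simp only [Exposed, Idle, upd]; omega)
  | rcvLate c P Q h => exact .arcv c _ h
  | timePar _ _ h₁ h₂ => cases hW with | par w₁ w₂ => exact .par (h₁ w₁) (h₂ w₂)
  | tauParL W₂ _ h => cases hW with | par w₁ w₂ => exact .par (h w₁) w₂
  | tauParR W₁ _ h => cases hW with | par w₁ w₂ => exact .par w₁ (h w₂)
  | recur _ h => exact h (.proc _)
  | sumTauL Q _ h => exact h (.proc _)
  | sumTauR P _ h => exact h (.proc _)
  | sumSndL Q _ h => exact h (.proc _)
  | sumSndR P _ h => exact h (.proc _)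
  | sumRcvL Q _ _ _ h => exact h (.proc _)
  | sumRcvR P _ _ _ h => exact h (.proc _)
  | resI _ h => cases hW with | res w => exact .res (upd_snd_none_ext _ _ _ ▸ h w)
  | resV _ h => cases hW with | res w => exact .res (upd_lift_ext _ _ _ ▸ h w)
  | _ => exact .proc _

/-! ## Receptiveness and the passage of time -/

/-- If there is an idle receiver, the rule for ignored messages is unavailable and the receiver has
to be dug out of sums and recursions; the induction is on urgency because of the unfoldings. -/
theorem Proc.exists_rcv_step (Γ : Env S C) (c : C) (x : S.Val) (P : Proc S C 0 0)
    (hP : P.Guarded) : ∃ W', Step Γ (.proc P) (.rcv c x) W' := by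
  by_cases hc : Idle Γ c ∧ P.IsRcv c
  · obtain ⟨hi, hr⟩ := hc
    induction hn : P.urgency using Nat.strong_induction_on generalizing P with
    | _ n ih =>
      cases P with
      | rcv d P Q => cases hr; exact ⟨_, .rcv c x P Q hi⟩
      | choice P Q =>
        simp only [urgency] at hn
        rcases hr with hr | hr
        · obtain ⟨W, h⟩ := ih _ (by omega) P hP.1 hr rfl
          exact ⟨W, .sumRcvL Q h hi hr⟩
        · obtain ⟨W, h⟩ := ih _ (by omega) Q hP.2 hr rfl
          exact ⟨W, .sumRcvR P h hi hr⟩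
      | fix P =>
        simp only [urgency] at hn
        obtain ⟨W, h⟩ := ih P.unfold.urgency (by rw [urgency_unfold hP]; omega) P.unfold
          (guarded_unfold hP) ((isRcv_unfold _ _).2 hr) rfl
        exact ⟨W, .recur h⟩
      | _ => exact hr.elim
  · exact ⟨_, .rcvIgn c x _ hc⟩

theorem Sys.exists_rcv_step {C : Type u} (Γ : Env S C) (c : C) (x : S.Val) (W : Sys S C)
    (hW : W.Guarded) : ∃ W', Step Γ W (.rcv c x) W' := by
  induction W with
  | proc P => exact P.exists_rcv_step Γ c x hW
  | arcv d P => exact ⟨_, .rcvIgn c x _ fun h => h.2⟩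
  | par W₁ W₂ h₁ h₂ =>
    obtain ⟨W₁', h₁⟩ := h₁ Γ c hW.1
    obtain ⟨W₂', h₂⟩ := h₂ Γ c hW.2
    exact ⟨_, .rcvPar h₁ h₂⟩
  | res s W h =>
    obtain ⟨W', h⟩ := h (Γ.ext s) (some c) hW
    exact ⟨_, .resV (a := .rcv c x) h⟩

/-- Needed for the components that hear a broadcast: a receiver that starts to listen drops to
urgency zero, a sum loses a summand, and an ignored message at most unfolds recursion. -/
theorem Sys.urgency_rcv_step {C : Type u} {Γ : Env S C} {W W' : Sys S C} {c : C} {x : S.Val}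
    (h : Step Γ W (.rcv c x) W') (hW : W.Guarded) : W'.urgency ≤ W.urgency := by
  generalize ha : Act.rcv c x = a at h
  induction h with
  | rcv => exact Nat.zero_le _
  | rcvIgn => exact le_rfl
  | rcvPar _ _ h₁ h₂ => exact add_le_add (h₁ hW.1 ha) (h₂ hW.2 ha)
  | recur _ h =>
    refine (h (Proc.guarded_unfold hW) ha).trans ?_
    exact (Proc.urgency_unfold hW).le.trans (Nat.le_succ _)
  | sumRcvL Q _ _ _ h =>
    have := h hW.1 ha
    simp only [urgency, Proc.urgency] at *; omega
  | sumRcvR P _ _ _ h =>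
    have := h hW.2 ha
    simp only [urgency, Proc.urgency] at *; omega
  | resV _ h => subst ha; exact h hW rfl
  | _ => cases ha

/-- The residuals are not urgent: a broadcast leaves a delay of positive length, since `delta` is
positive, a test leaves a delay, and a late reception leaves an active receiver. -/
theorem Sys.urgency_instant_step {C : Type u} {Γ : Env S C} {W W' : Sys S C} {a : Act S C}
    (h : Step Γ W a W') (hW : W.Guarded) (ha : a = .tau ∨ ∃ c x, a = .snd c x) :
    W'.urgency < W.urgency := by
  induction h with
  | snd c e P =>
    rw [urgency, Proc.urgency_delays (S.delta_pos _)]; exact Nat.one_pos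
  | syncL _ h₂ h₁ _ => exact add_lt_add_of_lt_of_le (h₁ hW.1 ha) (urgency_rcv_step h₂ hW.2)
  | syncR h₁ _ _ h₂ => exact add_lt_add_of_le_of_lt (urgency_rcv_step h₁ hW.1) (h₂ hW.2 ha)
  | rcvLate => exact Nat.one_pos
  | tau => exact Nat.lt_succ_self _
  | condThen => exact Nat.one_pos
  | condElse => exact Nat.one_pos
  | tauParL W₂ _ h => exact Nat.add_lt_add_right (h hW.1 ha) _
  | tauParR W₁ _ h => exact Nat.add_lt_add_left (h hW.2 ha) _
  | recur _ h =>
    refine (h (Proc.guarded_unfold hW) ha).trans ?_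
    exact (Proc.urgency_unfold hW).le.trans_lt (Nat.lt_succ_self _)
  | sumTauL Q _ h | sumSndL Q _ h =>
    have := h hW.1 ha
    simp only [urgency, Proc.urgency] at *; omega
  | sumTauR P _ h | sumSndR P _ h =>
    have := h hW.2 ha
    simp only [urgency, Proc.urgency] at *; omega
  | resI _ h => exact h hW (.inr ⟨_, _, rfl⟩)
  | resV _ h =>
    refine h hW ?_
    rcases ha with rfl | ⟨c, x, rfl⟩
    · exact .inl rfl
    · exact .inr ⟨_, _, rfl⟩
  | _ => simp at ha

theorem Proc.instant_or_time (Γ : Env S C) (P : Proc S C 0 0) (hP : P.Guarded) :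
    (∃ a W', Step Γ (.proc P) a W' ∧ (a = .tau ∨ ∃ c x, a = .snd c x)) ∨
      ∃ P', Step Γ (.proc P) .sigma (.proc P') := by
  induction hn : P.urgency using Nat.strong_induction_on generalizing P with
  | _ n ih =>
    cases P with
    | bcast c e P => exact .inl ⟨_, _, .snd c e P, .inr ⟨_, _, rfl⟩⟩
    | rcv c P Q =>
      by_cases hc : Idle Γ c
      · exact .inr ⟨_, .timeout c P Q hc⟩
      · exact .inl ⟨_, _, .rcvLate c P Q hc, .inl rfl⟩
    | delay P => exact .inr ⟨_, .sleep P⟩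
    | tau P => exact .inl ⟨_, _, .tau P, .inl rfl⟩
    | choice P Q =>
      simp only [urgency] at hn
      rcases ih _ (by omega) P hP.1 rfl with ⟨a, W', h, rfl | ⟨c, x, rfl⟩⟩ | ⟨P', h⟩
      · exact .inl ⟨_, _, .sumTauL Q h, .inl rfl⟩
      · exact .inl ⟨_, _, .sumSndL Q h, .inr ⟨_, _, rfl⟩⟩
      rcases ih _ (by omega) Q hP.2 rfl with ⟨a, W', h, rfl | ⟨c, x, rfl⟩⟩ | ⟨Q', h'⟩
      · exact .inl ⟨_, _, .sumTauR P h, .inl rfl⟩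
      · exact .inl ⟨_, _, .sumSndR P h, .inr ⟨_, _, rfl⟩⟩
      exact .inr ⟨_, .sumTime h h'⟩
    | cond b P Q =>
      by_cases hb : b.Holds Γ
      · exact .inl ⟨_, _, .condThen b P Q hb, .inl rfl⟩
      · exact .inl ⟨_, _, .condElse b P Q hb, .inl rfl⟩
    | var X => exact X.elim0
    | nil => exact .inr ⟨_, .timeNil⟩
    | fix P =>
      simp only [urgency] at hn
      rcases ih P.unfold.urgency (by rw [urgency_unfold hP]; omega) P.unfold
        (guarded_unfold hP) rfl with ⟨a, W', h, ha⟩ | ⟨P', h⟩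
      · exact .inl ⟨a, W', .recur h, ha⟩
      · exact .inr ⟨P', .recur h⟩

/-- The only term that would block time without an instantaneous step is an active receiver along an
idle channel, which well-formedness excludes. In a parallel composition a broadcast of one component
always goes through, because the other is receptive. -/
theorem WNets.instant_or_time {C : Type u} {Γ : Env S C} {W : Sys S C} (hw : WNets Γ W)
    (hW : W.Guarded) :
    (∃ a W', Step Γ W a W' ∧ (a = .tau ∨ ∃ c x, a = .snd c x)) ∨ ∃ W', Step Γ W .sigma W' := by
  induction hw with
  | @proc _ Γ P => exact (P.instant_or_time Γ hW).imp_right fun ⟨P', h⟩ => ⟨_, h⟩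
  | @arcv _ Γ c P hc =>
    rcases Nat.lt_or_ge 1 (Γ c).1 with h | h
    · exact .inr ⟨_, .actRcv c P h⟩
    · exact .inr ⟨_, .endRcv c P (le_antisymm h (Nat.pos_of_ne_zero hc))⟩
  | @par _ Γ W₁ W₂ _ _ h₁ h₂ =>
    rcases h₁ hW.1 with ⟨a, W', h, rfl | ⟨c, x, rfl⟩⟩ | ⟨W₁', h⟩
    · exact .inl ⟨_, _, .tauParL W₂ h, .inl rfl⟩
    · obtain ⟨W₂', h'⟩ := W₂.exists_rcv_step Γ c x hW.2
      exact .inl ⟨_, _, .syncL h h', .inr ⟨_, _, rfl⟩⟩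
    rcases h₂ hW.2 with ⟨a, W', h', rfl | ⟨c, x, rfl⟩⟩ | ⟨W₂', h'⟩
    · exact .inl ⟨_, _, .tauParR W₁ h', .inl rfl⟩
    · obtain ⟨W₁', h''⟩ := W₁.exists_rcv_step Γ c x hW.1
      exact .inl ⟨_, _, .syncR h'' h', .inr ⟨_, _, rfl⟩⟩
    exact .inr ⟨_, .timePar h h'⟩
  | res _ h =>
    rcases h hW with ⟨a, W', h, rfl | ⟨c, x, rfl⟩⟩ | ⟨W', h⟩
    · exact .inl ⟨_, _, .resV (a := .tau) h, .inl rfl⟩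
    · cases c with
      | none => exact .inl ⟨_, _, .resI h, .inl rfl⟩
      | some c => exact .inl ⟨_, _, .resV (a := .snd c x) h, .inr ⟨_, _, rfl⟩⟩
    · exact .inr ⟨_, .resV (a := .sigma) h⟩

/-! ## Parallel composition -/

/-- The transitions of `A | B`, by the contributions of the components. -/
inductive ParStep (Γ : Env S C) (A B : Sys S C) : Act S C → Sys S C → Sys S C → Prop where
  | sndL {c : C} {x : S.Val} {A' B' : Sys S C} :
      Step Γ A (.snd c x) A' → Step Γ B (.rcv c x) B' → ParStep Γ A B (.snd c x) A' B'
  | sndR {c : C} {x : S.Val} {A' B' : Sys S C} :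
      Step Γ A (.rcv c x) A' → Step Γ B (.snd c x) B' → ParStep Γ A B (.snd c x) A' B'
  | rcv {c : C} {x : S.Val} {A' B' : Sys S C} :
      Step Γ A (.rcv c x) A' → Step Γ B (.rcv c x) B' → ParStep Γ A B (.rcv c x) A' B'
  | time {A' B' : Sys S C} :
      Step Γ A .sigma A' → Step Γ B .sigma B' → ParStep Γ A B .sigma A' B'
  | tauL {A' : Sys S C} : Step Γ A .tau A' → ParStep Γ A B .tau A' B
  | tauR {B' : Sys S C} : Step Γ B .tau B' → ParStep Γ A B .tau A B'

theorem step_par_iff {Γ : Env S C} {A B V : Sys S C} {a : Act S C} :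
    Step Γ (.par A B) a V ↔ ∃ A' B', V = .par A' B' ∧ ParStep Γ A B a A' B' := by
  constructor
  · intro h
    cases h with
    -- A composition that ignores a message has no idle receiver in either component, so both
    -- components ignore it; the rule thus needs no case of its own in `ParStep`.
    | rcvIgn c x _ h =>
      exact ⟨_, _, rfl, .rcv (.rcvIgn c x A fun k => h ⟨k.1, .inl k.2⟩)
        (.rcvIgn c x B fun k => h ⟨k.1, .inr k.2⟩)⟩
    | syncL h₁ h₂ => exact ⟨_, _, rfl, .sndL h₁ h₂⟩
    | syncR h₁ h₂ => exact ⟨_, _, rfl, .sndR h₁ h₂⟩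
    | rcvPar h₁ h₂ => exact ⟨_, _, rfl, .rcv h₁ h₂⟩
    | timePar h₁ h₂ => exact ⟨_, _, rfl, .time h₁ h₂⟩
    | tauParL _ h => exact ⟨_, _, rfl, .tauL h⟩
    | tauParR _ h => exact ⟨_, _, rfl, .tauR h⟩
  · rintro ⟨A', B', rfl, h⟩
    cases h with
    | sndL h₁ h₂ => exact .syncL h₁ h₂
    | sndR h₁ h₂ => exact .syncR h₁ h₂
    | rcv h₁ h₂ => exact .rcvPar h₁ h₂
    | time h₁ h₂ => exact .timePar h₁ h₂
    | tauL h => exact .tauParL _ h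
    | tauR h => exact .tauParR _ h

theorem ParStep.step {Γ : Env S C} {A B A' B' : Sys S C} {a : Act S C}
    (h : ParStep Γ A B a A' B') : Step Γ (.par A B) a (.par A' B') :=
  step_par_iff.2 ⟨_, _, rfl, h⟩

theorem ParStep.symm {Γ : Env S C} {A B A' B' : Sys S C} {a : Act S C}
    (h : ParStep Γ A B a A' B') : ParStep Γ B A a B' A' := by
  cases h with
  | sndL h₁ h₂ => exact .sndR h₂ h₁
  | sndR h₁ h₂ => exact .sndL h₂ h₁
  | rcv h₁ h₂ => exact .rcv h₂ h₁
  | time h₁ h₂ => exact .time h₂ h₁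
  | tauL h => exact .tauR h
  | tauR h => exact .tauL h

/-! ## Structural equivalence -/

/-- The congruence generated by the unfolding of recursion and by the commutativity and
associativity of parallel composition. -/
inductive SEq : {C : Type u} → Sys S C → Sys S C → Prop where
  | refl {C : Type u} (W : Sys S C) : SEq W W
  | symm {C : Type u} {W V : Sys S C} : SEq W V → SEq V W
  | trans {C : Type u} {W V U : Sys S C} : SEq W V → SEq V U → SEq W U
  | unfold {C : Type u} (P : Proc S C 0 1) : SEq (.proc (.fix P)) (.proc P.unfold)
  | comm {C : Type u} (A B : Sys S C) : SEq (.par A B) (.par B A)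
  | assoc {C : Type u} (A B D : Sys S C) : SEq (.par (.par A B) D) (.par A (.par B D))
  | par {C : Type u} {A A' B B' : Sys S C} :
      SEq A A' → SEq B B' → SEq (.par A B) (.par A' B')
  | res {C : Type u} (s : ℕ × S.Val) {W V : Sys S (Option C)} :
      SEq W V → SEq (.res s W) (.res s V)

theorem SEq.isRcv {C : Type u} {W V : Sys S C} (h : SEq W V) (c : C) :
    W.IsRcv c ↔ V.IsRcv c := by
  induction h with
  | refl => exact Iff.rfl
  | symm _ h => exact (h c).symm
  | trans _ _ h₁ h₂ => exact (h₁ c).trans (h₂ c)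
  | unfold P => exact (Proc.isRcv_unfold P c).symm
  | comm => exact or_comm
  | assoc => exact or_assoc
  | par _ _ h₁ h₂ => exact or_congr (h₁ c) (h₂ c)
  | res s _ h => exact h (some c)

theorem SEq.chans {C : Type u} {W V : Sys S C} (h : SEq W V) : W.chans = V.chans := by
  induction h with
  | refl => rfl
  | symm _ h => exact h.symm
  | trans _ _ h₁ h₂ => exact h₁.trans h₂
  | unfold P => exact (Proc.chans_unfold P).symm
  | comm => exact Set.union_comm _ _
  | assoc => exact Set.union_assoc _ _ _
  | par _ _ h₁ h₂ => exact congrArg₂ (· ∪ ·) h₁ h₂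
  | res s _ h => exact congrArg (fun A => some ⁻¹' A) h

theorem ParStep.simulate {Γ : Env S C} {A A₁ A' B B₁ B' : Sys S C} {a : Act S C}
    (hA : SEq A A₁) (hB : SEq B B₁)
    (sA : ∀ a V, Step Γ A a V → ∃ V', Step Γ A₁ a V' ∧ SEq V V')
    (sB : ∀ a V, Step Γ B a V → ∃ V', Step Γ B₁ a V' ∧ SEq V V')
    (h : ParStep Γ A B a A' B') :
    ∃ V, Step Γ (.par A₁ B₁) a V ∧ SEq (.par A' B') V := by
  cases h with
  | sndL h₁ h₂ =>
    obtain ⟨_, h₁, e₁⟩ := sA _ _ h₁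
    obtain ⟨_, h₂, e₂⟩ := sB _ _ h₂
    exact ⟨_, .syncL h₁ h₂, .par e₁ e₂⟩
  | sndR h₁ h₂ =>
    obtain ⟨_, h₁, e₁⟩ := sA _ _ h₁
    obtain ⟨_, h₂, e₂⟩ := sB _ _ h₂
    exact ⟨_, .syncR h₁ h₂, .par e₁ e₂⟩
  | rcv h₁ h₂ =>
    obtain ⟨_, h₁, e₁⟩ := sA _ _ h₁
    obtain ⟨_, h₂, e₂⟩ := sB _ _ h₂
    exact ⟨_, .rcvPar h₁ h₂, .par e₁ e₂⟩
  | time h₁ h₂ =>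
    obtain ⟨_, h₁, e₁⟩ := sA _ _ h₁
    obtain ⟨_, h₂, e₂⟩ := sB _ _ h₂
    exact ⟨_, .timePar h₁ h₂, .par e₁ e₂⟩
  | tauL h =>
    obtain ⟨_, h, e⟩ := sA _ _ h
    exact ⟨_, .tauParL _ h, .par e hB⟩
  | tauR h =>
    obtain ⟨_, h, e⟩ := sB _ _ h
    exact ⟨_, .tauParR _ h, .par hA e⟩

theorem SEq.res_simulate {Γ : Env S C} {s : ℕ × S.Val} {W W₁ : Sys S (Option C)} {V : Sys S C}
    {a : Act S C} (e : SEq W W₁)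
    (sW : ∀ a V, Step (Γ.ext s) W a V → ∃ V', Step (Γ.ext s) W₁ a V' ∧ SEq V V')
    (h : Step Γ (.res s W) a V) : ∃ V', Step Γ (.res s W₁) a V' ∧ SEq V V' := by
  cases h with
  | rcvIgn c x _ h =>
    exact ⟨_, .rcvIgn c x _ fun k => h ⟨k.1, (e.isRcv _).2 k.2⟩, .res s e⟩
  | resI h =>
    obtain ⟨_, h, e⟩ := sW _ _ h
    exact ⟨_, .resI h, .res _ e⟩
  | resV h =>
    obtain ⟨_, h, e⟩ := sW _ _ h
    exact ⟨_, .resV h, .res _ e⟩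

/-- Communication is broadcast: all components take part in a transmission at once, so their order
and bracketing do not matter. Messages ignored by a recursion or a restriction transfer because
equivalent terms have the same unguarded receivers. -/
theorem SEq.simulate {C : Type u} {W V : Sys S C} (h : SEq W V) (Γ : Env S C) :
    (∀ a W', Step Γ W a W' → ∃ V', Step Γ V a V' ∧ SEq W' V') ∧
      (∀ a V', Step Γ V a V' → ∃ W', Step Γ W a W' ∧ SEq V' W') := by
  induction h with
  | refl W => exact ⟨fun a W' h => ⟨W', h, .refl _⟩, fun a W' h => ⟨W', h, .refl _⟩⟩
  | symm _ h => exact (h Γ).symm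
  | trans _ _ h₁ h₂ =>
    constructor
    · intro a W' h
      obtain ⟨V', h, e⟩ := (h₁ Γ).1 a W' h
      obtain ⟨U', h, e'⟩ := (h₂ Γ).1 a V' h
      exact ⟨U', h, e.trans e'⟩
    · intro a W' h
      obtain ⟨V', h, e⟩ := (h₂ Γ).2 a W' h
      obtain ⟨U', h, e'⟩ := (h₁ Γ).2 a V' h
      exact ⟨U', h, e.trans e'⟩
  | unfold P =>
    constructor
    · intro a W' h
      cases h with
      | rcvIgn c x _ h =>
        exact ⟨_, .rcvIgn c x _ fun k => h ⟨k.1, (Proc.isRcv_unfold P c).1 k.2⟩, .unfold P⟩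
      | recur h => exact ⟨_, h, .refl _⟩
    · exact fun a V' h => ⟨V', .recur h, .refl _⟩
  | comm A B =>
    refine ⟨fun a W' h => ?_, fun a W' h => ?_⟩ <;>
    · obtain ⟨A', B', rfl, k⟩ := step_par_iff.1 h
      exact ⟨_, k.symm.step, .comm _ _⟩
  | assoc A B D =>
    constructor
    · intro a W' h
      obtain ⟨X', D', rfl, k⟩ := step_par_iff.1 h
      clear h
      cases k with
      | sndL h h₃ =>
        obtain ⟨A', B', rfl, k⟩ := step_par_iff.1 h
        clear h
        cases k with
        | sndL h₁ h₂ => exact ⟨_, .syncL h₁ (.rcvPar h₂ h₃), .assoc _ _ _⟩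
        | sndR h₁ h₂ => exact ⟨_, .syncR h₁ (.syncL h₂ h₃), .assoc _ _ _⟩
      | sndR h h₃ =>
        obtain ⟨A', B', rfl, k⟩ := step_par_iff.1 h
        clear h
        cases k with
        | rcv h₁ h₂ => exact ⟨_, .syncR h₁ (.syncR h₂ h₃), .assoc _ _ _⟩
      | rcv h h₃ =>
        obtain ⟨A', B', rfl, k⟩ := step_par_iff.1 h
        clear h
        cases k with
        | rcv h₁ h₂ => exact ⟨_, .rcvPar h₁ (.rcvPar h₂ h₃), .assoc _ _ _⟩
      | time h h₃ =>
        obtain ⟨A', B', rfl, k⟩ := step_par_iff.1 h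
        clear h
        cases k with
        | time h₁ h₂ => exact ⟨_, .timePar h₁ (.timePar h₂ h₃), .assoc _ _ _⟩
      | tauL h =>
        obtain ⟨A', B', rfl, k⟩ := step_par_iff.1 h
        clear h
        cases k with
        | tauL h => exact ⟨_, .tauParL _ h, .assoc _ _ _⟩
        | tauR h => exact ⟨_, .tauParR _ (.tauParL _ h), .assoc _ _ _⟩
      | tauR h => exact ⟨_, .tauParR _ (.tauParR _ h), .assoc _ _ _⟩
    · intro a W' h
      obtain ⟨A', X', rfl, k⟩ := step_par_iff.1 h
      clear h
      cases k with
      | sndL h₁ h =>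
        obtain ⟨B', D', rfl, k⟩ := step_par_iff.1 h
        clear h
        cases k with
        | rcv h₂ h₃ => exact ⟨_, .syncL (.syncL h₁ h₂) h₃, .symm (.assoc _ _ _)⟩
      | sndR h₁ h =>
        obtain ⟨B', D', rfl, k⟩ := step_par_iff.1 h
        clear h
        cases k with
        | sndL h₂ h₃ => exact ⟨_, .syncL (.syncR h₁ h₂) h₃, .symm (.assoc _ _ _)⟩
        | sndR h₂ h₃ => exact ⟨_, .syncR (.rcvPar h₁ h₂) h₃, .symm (.assoc _ _ _)⟩
      | rcv h₁ h =>
        obtain ⟨B', D', rfl, k⟩ := step_par_iff.1 h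
        clear h
        cases k with
        | rcv h₂ h₃ => exact ⟨_, .rcvPar (.rcvPar h₁ h₂) h₃, .symm (.assoc _ _ _)⟩
      | time h₁ h =>
        obtain ⟨B', D', rfl, k⟩ := step_par_iff.1 h
        clear h
        cases k with
        | time h₂ h₃ => exact ⟨_, .timePar (.timePar h₁ h₂) h₃, .symm (.assoc _ _ _)⟩
      | tauL h => exact ⟨_, .tauParL _ (.tauParL _ h), .symm (.assoc _ _ _)⟩
      | tauR h =>
        obtain ⟨B', D', rfl, k⟩ := step_par_iff.1 h
        clear h
        cases k with
        | tauL h => exact ⟨_, .tauParL _ (.tauParR _ h), .symm (.assoc _ _ _)⟩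
        | tauR h => exact ⟨_, .tauParR _ h, .symm (.assoc _ _ _)⟩
  | par e₁ e₂ h₁ h₂ =>
    constructor
    · intro a W' h
      obtain ⟨A', B', rfl, k⟩ := step_par_iff.1 h
      exact k.simulate e₁ e₂ (h₁ Γ).1 (h₂ Γ).1
    · intro a W' h
      obtain ⟨A', B', rfl, k⟩ := step_par_iff.1 h
      exact k.simulate e₁.symm e₂.symm (h₁ Γ).2 (h₂ Γ).2
  | res s e h =>
    exact ⟨fun a W' k => e.res_simulate (h _).1 k, fun a W' k => e.symm.res_simulate (h _).2 k⟩

/-- A term that ignores a transmission changes at most by the unfolding of recursion. -/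
theorem SEq.of_ignored {C : Type u} {Γ : Env S C} {W W' : Sys S C} {c : C} {x : S.Val}
    (h : Step Γ W (.rcv c x) W') (hc : ¬ W.IsRcv c) : SEq W W' := by
  generalize ha : Act.rcv c x = a at h
  induction h with
  | rcv => cases ha; exact absurd rfl hc
  | rcvIgn => exact .refl _
  | rcvPar _ _ h₁ h₂ =>
    exact .par (h₁ (fun h => hc (.inl h)) ha) (h₂ (fun h => hc (.inr h)) ha)
  | @recur _ Γ P a W _ h =>
    exact (SEq.unfold P).trans (h (fun h => hc ((Proc.isRcv_unfold P c).1 h)) ha)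
  | sumRcvL Q _ _ hP h => cases ha; exact absurd (.inl hP) hc
  | sumRcvR P _ _ hQ h => cases ha; exact absurd (.inr hQ) hc
  | resV _ h =>
    subst ha
    rw [upd_lift_none_of_ne_sigma (by simp)]
    exact .res _ (h hc rfl)
  | _ => cases ha

/-! ## Configurations -/

namespace Config

theorem ext' {K L : Config S C} (h₁ : K.env = L.env) (h₂ : K.sys = L.sys) : K = L := by
  cases K; cases L; cases h₁; cases h₂; rfl

/-- The configuration reached by an intensional transition. -/
noncomputable def after (K : Config S C) {a : Act S C} {W : Sys S C}
    (h : Step K.env K.sys a W) : Config S C :=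
  ⟨upd a K.env, W, Sys.guarded_step h K.guarded⟩

theorem performs_after (K : Config S C) {a : Act S C} {W : Sys S C}
    (h : Step K.env K.sys a W) : K.Performs a (K.after h) := ⟨h, rfl⟩

/-- The same system term in another channel environment. -/
def withEnv (K : Config S C) (Γ : Env S C) : Config S C := ⟨Γ, K.sys, K.guarded⟩

/-- The same channel environment and structurally equivalent system terms. -/
def StrEq (K L : Config S C) : Prop := K.env = L.env ∧ SEq K.sys L.sys

theorem StrEq.symm {K L : Config S C} (h : K.StrEq L) : L.StrEq K := ⟨h.1.symm, h.2.symm⟩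

theorem StrEq.trans {K L M : Config S C} (h : K.StrEq L) (k : L.StrEq M) : K.StrEq M :=
  ⟨h.1.trans k.1, h.2.trans k.2⟩

theorem StrEq.performs {K L K' : Config S C} {a : Act S C} (h : K.StrEq L)
    (hK : K.Performs a K') : ∃ L', L.Performs a L' ∧ K'.StrEq L' := by
  obtain ⟨V, hV, e⟩ := (h.2.simulate K.env).1 _ _ hK.1
  rw [h.1] at hV
  exact ⟨L.after hV, L.performs_after hV, by rw [hK.2, h.1]; rfl, e⟩

/-- The channel `c` is idle and does not occur. -/
def Dead (K : Config S C) (c : C) : Prop := Idle K.env c ∧ c ∉ K.sys.chans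

end Config

/-! ### Reductions as extensional transitions -/

theorem extStep_tau_iff {K K' : Config S C} :
    ExtStep K .tau K' ↔ K.Performs .tau K' ∨ ∃ c x, K.Performs (.snd c x) K' := by
  constructor
  · intro h
    cases h with
    | shh c x h => exact .inr ⟨c, x, h⟩
    | tauExt h => exact .inl h
  · rintro (h | ⟨c, x, h⟩)
    · exact .tauExt h
    · exact .shh c x h

theorem extStep_sigma_iff {K K' : Config S C} :
    ExtStep K .sigma K' ↔ K.Performs .sigma K' :=
  ⟨fun h => by cases h; assumption, .time⟩

theorem red_iff {K K' : Config S C} :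
    Config.Red K K' ↔ ExtStep K .tau K' ∨ ExtStep K .sigma K' := by
  constructor
  · intro h
    cases h with
    | transmission c x h => exact .inl (.shh c x h)
    | time h => exact .inr (.time h)
    | internal h => exact .inl (.tauExt h)
  · rintro (h | h)
    · rcases extStep_tau_iff.1 h with h | ⟨c, x, h⟩
      · exact .internal h
      · exact .transmission c x h
    · exact .time (extStep_sigma_iff.1 h)

theorem ExtStep.red {K K' : Config S C} (h : ExtStep K .tau K') : Config.Red K K' :=
  red_iff.2 (.inl h)

theorem ExtTaus.reds {K K' : Config S C} (h : ExtTaus K K') :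
    Relation.ReflTransGen Config.Red K K' := by
  induction h with
  | refl => exact .refl
  | tail _ h ih => exact ih.tail (ExtStep.red h)

theorem Config.StrEq.tau {K L K' : Config S C} (h : K.StrEq L) (hK : ExtStep K .tau K') :
    ∃ L', ExtStep L .tau L' ∧ K'.StrEq L' := by
  rcases extStep_tau_iff.1 hK with hK | ⟨c, x, hK⟩ <;> obtain ⟨L', hL, e⟩ := h.performs hK
  · exact ⟨L', .tauExt hL, e⟩
  · exact ⟨L', .shh c x hL, e⟩

theorem Config.StrEq.sigma {K L K' : Config S C} (h : K.StrEq L) (hK : ExtStep K .sigma K') :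
    ∃ L', ExtStep L .sigma L' ∧ K'.StrEq L' := by
  obtain ⟨L', hL, e⟩ := h.performs (extStep_sigma_iff.1 hK)
  exact ⟨L', .time hL, e⟩

theorem Config.StrEq.red {K L K' : Config S C} (h : K.StrEq L) (hK : Red K K') :
    ∃ L', Red L L' ∧ K'.StrEq L' := by
  rcases red_iff.1 hK with hK | hK
  · obtain ⟨L', hL, e⟩ := h.tau hK
    exact ⟨L', red_iff.2 (.inl hL), e⟩
  · obtain ⟨L', hL, e⟩ := h.sigma hK
    exact ⟨L', red_iff.2 (.inr hL), e⟩

theorem Config.StrEq.reds {K L K' : Config S C} (h : K.StrEq L)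
    (hK : Relation.ReflTransGen Red K K') :
    ∃ L', Relation.ReflTransGen Red L L' ∧ K'.StrEq L' := by
  induction hK with
  | refl => exact ⟨L, .refl, h⟩
  | tail _ hr ih =>
    obtain ⟨L', hL, e⟩ := ih
    obtain ⟨L'', hr, e⟩ := e.red hr
    exact ⟨L'', hL.tail hr, e⟩

theorem Config.StrEq.weakBarb {K L : Config S C} (h : K.StrEq L) {c : C} (hK : K.WeakBarb c) :
    L.WeakBarb c := by
  obtain ⟨K', hr, hb⟩ := hK
  obtain ⟨L', hL, e⟩ := h.reds hr
  exact ⟨L', hL, by unfold Barb; rwa [← e.1]⟩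

/-! ## Channels that do not occur -/

theorem ExtStep.env_eq {K K' : Config S C} (h : ExtStep K .tau K') {c : C}
    (hc : c ∉ K.sys.chans) : K'.env c = K.env c := by
  rcases extStep_tau_iff.1 h with h | ⟨d, x, h⟩
  · rw [h.2]; rfl
  · rw [h.2]
    exact Env.transmit_of_ne fun e => hc (e ▸ Sys.mem_chans_of_snd h.1)

theorem Config.Red.chans_subset {K K' : Config S C} (h : Red K K') :
    K'.sys.chans ⊆ K.sys.chans := by
  cases h with
  | transmission c x h => exact Sys.chans_step h.1
  | time h => exact Sys.chans_step h.1
  | internal h => exact Sys.chans_step h.1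

theorem ExtStep.chans_subset {K K' : Config S C} (h : ExtStep K .tau K') :
    K'.sys.chans ⊆ K.sys.chans := h.red.chans_subset

theorem ExtTaus.chans_subset {K K' : Config S C} (h : ExtTaus K K') :
    K'.sys.chans ⊆ K.sys.chans := by
  induction h with
  | refl => exact subset_rfl
  | tail _ h ih => exact h.chans_subset.trans ih

theorem ExtTaus.env_eq {K K' : Config S C} (h : ExtTaus K K') {c : C}
    (hc : c ∉ K.sys.chans) : K'.env c = K.env c := by
  induction h with
  | refl => rfl
  | tail h₁ h ih => rw [h.env_eq fun k => hc (ExtTaus.chans_subset h₁ k), ih]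

theorem ExtTaus.exposed {K K' : Config S C} (h : ExtTaus K K') {c : C}
    (hc : Exposed K.env c) : Exposed K'.env c := by
  induction h with
  | refl => exact hc
  | tail _ h ih =>
    rcases extStep_tau_iff.1 h with h | ⟨d, x, h⟩
    · rw [h.2]; exact ih
    · rw [h.2]; exact ih.transmit

theorem Config.Dead.red {K K' : Config S C} {c : C} (h : K.Dead c) (hr : Red K K') :
    K'.Dead c := by
  refine ⟨?_, fun k => h.2 (hr.chans_subset k)⟩
  rcases red_iff.1 hr with hr | hr
  · rw [Idle, hr.env_eq h.2]; exact h.1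
  · rw [Idle, (extStep_sigma_iff.1 hr).2]
    exact Nat.sub_eq_zero_of_le (h.1.le.trans (Nat.zero_le _))

theorem Config.Dead.reds {K K' : Config S C} {c : C} (h : K.Dead c)
    (hr : Relation.ReflTransGen Red K K') : K'.Dead c := by
  induction hr with
  | refl => exact h
  | tail _ hr ih => exact ih.red hr

/-- The source of all negative observations: only a term in which a channel occurs can transmit
along it, so a dead channel stays dead. -/
theorem Config.Dead.not_weakBarb {K : Config S C} {c : C} (h : K.Dead c) : ¬ K.WeakBarb c :=
  fun ⟨_, hr, hb⟩ => hb (h.reds hr).1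

theorem Config.WeakBarb.of_reds {K K' : Config S C} {c : C}
    (hr : Relation.ReflTransGen Red K K') (h : K'.WeakBarb c) : K.WeakBarb c := by
  obtain ⟨L, h, hb⟩ := h
  exact ⟨L, hr.trans h, hb⟩

theorem Config.Barb.weakBarb {K : Config S C} {c : C} (h : K.Barb c) : K.WeakBarb c :=
  ⟨K, .refl, h⟩

/-! ## Transitions of parallel compositions -/

theorem ExtStep.tau_par {K M : Config S C} {X : Sys S C} {hX : X.Guarded}
    (h : ExtStep (K.par X hX) .tau M) :
    ∃ K' X' hX', M = Config.par K' X' hX' ∧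
      ((ExtStep K .tau K' ∧ (X' = X ∨ ∃ c x, Step K.env X (.rcv c x) X')) ∨
        (Step K.env X .tau X' ∧ K' = K) ∨
        ∃ c x, Step K.env X (.snd c x) X' ∧ K.Performs (.rcv c x) K') := by
  rcases extStep_tau_iff.1 h with ⟨h, e⟩ | ⟨c, x, h, e⟩ <;>
    obtain ⟨A', B', eM, h⟩ := step_par_iff.1 h
  · cases h with
    | tauL h =>
      exact ⟨K.after h, X, hX, Config.ext' e eM, .inl ⟨.tauExt (K.performs_after h), .inl rfl⟩⟩
    | tauR h =>
      exact ⟨K, B', Sys.guarded_step h hX, Config.ext' e eM, .inr (.inl ⟨h, rfl⟩)⟩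
  · cases h with
    | sndL h₁ h₂ =>
      exact ⟨K.after h₁, B', Sys.guarded_step h₂ hX, Config.ext' e eM,
        .inl ⟨.shh c x (K.performs_after h₁), .inr ⟨c, x, h₂⟩⟩⟩
    | sndR h₁ h₂ =>
      exact ⟨K.after h₁, B', Sys.guarded_step h₂ hX, Config.ext' e eM,
        .inr (.inr ⟨c, x, h₂, K.performs_after h₁⟩)⟩

theorem ExtStep.sigma_par {K M : Config S C} {X : Sys S C} {hX : X.Guarded}
    (h : ExtStep (K.par X hX) .sigma M) :
    ∃ K' X' hX', M = Config.par K' X' hX' ∧ ExtStep K .sigma K' ∧ Step K.env X .sigma X' := by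
  obtain ⟨h, e⟩ := extStep_sigma_iff.1 h
  obtain ⟨A', B', eM, h⟩ := step_par_iff.1 h
  cases h with
  | time h₁ h₂ =>
    exact ⟨K.after h₁, B', Sys.guarded_step h₂ hX, Config.ext' e eM, .time (K.performs_after h₁),
      h₂⟩

/-- Without the condition on receivers, a transmission of `K` could change `X`. -/
theorem ExtStep.par_left {K K' : Config S C} (h : ExtStep K .tau K') {X : Sys S C}
    (hX : X.Guarded) (hd : ∀ c ∈ K.sys.chans, ¬ X.IsRcv c) :
    ExtStep (K.par X hX) .tau (K'.par X hX) := by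
  rcases extStep_tau_iff.1 h with ⟨h, e⟩ | ⟨c, x, h, e⟩
  · exact .tauExt ⟨.tauParL _ h, e⟩
  · exact .shh c x ⟨.syncL h (.rcvIgn c x X fun k => hd c (Sys.mem_chans_of_snd h) k.2), e⟩

theorem ExtTaus.par_left {K K' : Config S C} (h : ExtTaus K K') {X : Sys S C}
    (hX : X.Guarded) (hd : ∀ c ∈ K.sys.chans, ¬ X.IsRcv c) :
    ExtTaus (K.par X hX) (K'.par X hX) := by
  induction h with
  | refl => exact .refl
  | tail h₁ h ih =>
    exact ih.tail (h.par_left hX fun c hc => hd c (ExtTaus.chans_subset h₁ hc))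

theorem ExtStep.par_tau_right (K : Config S C) {X X' : Sys S C} {hX : X.Guarded}
    (hX' : X'.Guarded) (h : Step K.env X .tau X') :
    ExtStep (K.par X hX) .tau (K.par X' hX') :=
  .tauExt ⟨.tauParR _ h, rfl⟩

theorem ExtStep.par_snd_right {K K' : Config S C} {X X' : Sys S C} {hX : X.Guarded}
    (hX' : X'.Guarded) {c : C} {x : S.Val} (h : Step K.env X (.snd c x) X')
    (hK : K.Performs (.rcv c x) K') : ExtStep (K.par X hX) .tau (K'.par X' hX') :=
  .shh c x ⟨.syncR hK.1 h, hK.2⟩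

theorem ExtStep.par_sigma {K K' : Config S C} {X X' : Sys S C} {hX : X.Guarded}
    (hX' : X'.Guarded) (hK : ExtStep K .sigma K') (h : Step K.env X .sigma X') :
    ExtStep (K.par X hX) .sigma (K'.par X' hX') :=
  .time ⟨.timePar (extStep_sigma_iff.1 hK).1 h, (extStep_sigma_iff.1 hK).2⟩

/-- The configuration in which a transmission has been ignored. -/
noncomputable def Config.transmit (K : Config S C) (c : C) (x : S.Val) : Config S C :=
  K.withEnv (K.env.transmit c x)

theorem Config.performs_transmit {K : Config S C} {c : C} (hc : ¬ K.sys.IsRcv c) (x : S.Val) :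
    K.Performs (.rcv c x) (K.transmit c x) :=
  ⟨.rcvIgn c x _ fun h => hc h.2, rfl⟩

/-- Well-formed configurations let time pass after finitely many instantaneous reductions. -/
theorem Config.WellFormed.exists_time {K : Config S C} (h : K.WellFormed) :
    ∃ K' K'', ExtTaus K K' ∧ K'.WellFormed ∧ ExtStep K' .sigma K'' := by
  induction hn : K.sys.urgency using Nat.strong_induction_on generalizing K with
  | _ n ih =>
    rcases WNets.instant_or_time h K.guarded with ⟨a, W', h', ha⟩ | ⟨W', h'⟩
    · obtain ⟨K', K'', h₁, h₂, h₃⟩ := ih _ (hn ▸ Sys.urgency_instant_step h' K.guarded ha)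
        (K := K.after h') (WNets.step h' h) rfl
      refine ⟨K', K'', .head ?_ h₁, h₂, h₃⟩
      rcases ha with rfl | ⟨c, x, rfl⟩
      · exact .tauExt (K.performs_after h')
      · exact .shh c x (K.performs_after h')
    · exact ⟨K, K.after h', .refl, h, .time (K.performs_after h')⟩

theorem Config.WellFormed.performs {K K' : Config S C} (h : K.WellFormed) {a : Act S C}
    (hr : K.Performs a K') : K'.WellFormed := by
  unfold WellFormed; rw [hr.2]; exact WNets.step hr.1 h

theorem Config.WellFormed.tau {K K' : Config S C} (h : K.WellFormed)
    (hr : ExtStep K .tau K') : K'.WellFormed := by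
  rcases extStep_tau_iff.1 hr with hr | ⟨c, x, hr⟩ <;> exact h.performs hr

theorem Config.WellFormed.taus {K K' : Config S C} (h : K.WellFormed)
    (hr : ExtTaus K K') : K'.WellFormed := by
  induction hr with
  | refl => exact h
  | tail _ hr ih => exact ih.tau hr

/-! ## Closure properties of reduction barbed congruence -/

namespace BarbedCongruent

theorem symm {K L : Config S C} (h : BarbedCongruent K L) : BarbedCongruent L K := by
  obtain ⟨R, hs, hb, hr, hc, h⟩ := h
  exact ⟨R, hs, hb, hr, hc, hs _ _ h⟩

theorem weakBarb {K L : Config S C} (h : BarbedCongruent K L) {c : C} (hK : K.WeakBarb c) :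
    L.WeakBarb c := by
  obtain ⟨R, hs, hb, hr, hc, h⟩ := h
  exact hb _ _ h _ hK

theorem reds {K L K' : Config S C} (h : BarbedCongruent K L)
    (hK : Relation.ReflTransGen Config.Red K K') :
    ∃ L', Relation.ReflTransGen Config.Red L L' ∧ BarbedCongruent K' L' := by
  obtain ⟨R, hs, hb, hr, hc, h⟩ := h
  induction hK with
  | refl => exact ⟨L, .refl, R, hs, hb, hr, hc, h⟩
  | tail _ hK ih =>
    obtain ⟨L', hL, R, hs, hb, hr, hc, h⟩ := ih
    obtain ⟨L'', hL', h⟩ := hr _ _ h _ hK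
    exact ⟨L'', hL.trans hL', R, hs, hb, hr, hc, h⟩

theorem par {K L : Config S C} (h : BarbedCongruent K L) (W : Sys S C) (hW : W.Guarded) :
    BarbedCongruent (K.par W hW) (L.par W hW) := by
  obtain ⟨R, hs, hb, hr, hc, h⟩ := h
  exact ⟨R, hs, hb, hr, hc, hc _ _ h W hW⟩

/-- A witness of barbed congruence can be closed under structural equivalence on both sides:
environments are kept, so barbs are, and reductions transfer since structural equivalence is a
strong bisimulation. -/
theorem congr {K L K' L' : Config S C} (h : BarbedCongruent K L) (hK : K.StrEq K')
    (hL : L.StrEq L') : BarbedCongruent K' L' := by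
  obtain ⟨R, hs, hb, hr, hc, h⟩ := h
  refine ⟨fun A B => ∃ A' B', A.StrEq A' ∧ B.StrEq B' ∧ R A' B', ?_, ?_, ?_, ?_,
    K, L, hK.symm, hL.symm, h⟩
  · rintro A B ⟨A', B', hA, hB, h⟩
    exact ⟨B', A', hB, hA, hs _ _ h⟩
  · rintro A B ⟨A', B', hA, hB, h⟩ c hw
    exact hB.symm.weakBarb (hb _ _ h _ (hA.weakBarb hw))
  · rintro A B ⟨A', B', hA, hB, h⟩ A₁ hr₁
    obtain ⟨A₂, hr₂, e⟩ := hA.red hr₁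
    obtain ⟨B₂, hr₃, h⟩ := hr _ _ h _ hr₂
    obtain ⟨B₁, hr₄, e'⟩ := hB.symm.reds hr₃
    exact ⟨B₁, hr₄, A₂, B₂, e, e'.symm, h⟩
  · rintro A B ⟨A', B', hA, hB, h⟩ W hW
    exact ⟨A'.par W hW, B'.par W hW, ⟨hA.1, .par hA.2 (.refl _)⟩, ⟨hB.1, .par hB.2 (.refl _)⟩,
      hc _ _ h W hW⟩

end BarbedCongruent

/-! ## Test processes -/

namespace Proc

/-- The transmission of a signal along `c`. -/
def out {n : ℕ} (c : C) : Proc S C n 0 := bcast c (.val S.err) nil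

/-- The choice between two signals; it does not let time pass. -/
def halt (g h : C) : Proc S C 0 0 := choice (out g) (out h)

/-- An internal step to `halt e f`, or else a signal along `p`. -/
def gate (e f p : C) : Proc S C 0 0 := choice (tau (halt e f)) (out p)

/-- A test of `b`, or else a signal along `q`. -/
def watch {n : ℕ} (b : BExp S C n) (P Q : Proc S C n 0) (q : C) : Proc S C n 0 :=
  choice (cond b P Q) (out q)

theorem delays_succ {n m : ℕ} (k : ℕ) (P : Proc S C n m) :
    delays (k + 1) P = delay (delays k P) :=
  Function.iterate_succ_apply' _ _ _

theorem not_isRcv_delays_nil {n m : ℕ} (k : ℕ) (c : C) :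
    ¬ (delays k (nil : Proc S C n m)).IsRcv c := by
  cases k with
  | zero => exact id
  | succ k => rw [delays_succ]; exact id

@[simp] theorem chans_out {n : ℕ} (c : C) : (out c : Proc S C n 0).chans = {c} := by
  simp [out, chans]

@[simp] theorem chans_halt (g h : C) : (halt g h : Proc S C 0 0).chans = {g, h} := by
  simp [halt, chans, Set.pair_comm]

@[simp] theorem chans_gate (e f p : C) :
    (gate e f p : Proc S C 0 0).chans = {e, f} ∪ {p} := by
  simp [gate, chans]

theorem guarded_out {n : ℕ} (c : C) : (out c : Proc S C n 0).Guarded := trivial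

theorem guarded_halt (g h : C) : (halt g h : Proc S C 0 0).Guarded := ⟨trivial, trivial⟩

theorem guarded_gate (e f p : C) : (gate e f p : Proc S C 0 0).Guarded :=
  ⟨guarded_halt e f, trivial⟩

theorem guarded_delays_nil {n m : ℕ} (k : ℕ) : (delays k (nil : Proc S C n m)).Guarded :=
  guarded_delays k trivial

end Proc

open Proc

section Steps

variable {Γ : Env S C} {V : Sys S C} {a : Act S C}

theorem step_out {g : C} (h : Step Γ (.proc (out g)) a V) :
    (∃ c x, a = .rcv c x ∧ V = .proc (out g)) ∨
      (a = .snd g S.err ∧ ∃ k, V = .proc (delays k nil)) := by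
  cases h with
  | snd => exact .inr ⟨rfl, _, rfl⟩
  | rcvIgn c x _ _ => exact .inl ⟨c, x, rfl, rfl⟩

theorem step_out_snd (Γ : Env S C) (g : C) :
    Step Γ (.proc (out g)) (.snd g S.err) (.proc (delays (S.delta S.err) nil)) :=
  .snd g (.val S.err) nil

theorem step_halt {g k : C} (h : Step Γ (.proc (halt g k)) a V) :
    (∃ c x, a = .rcv c x ∧ V = .proc (halt g k)) ∨
      ∃ c, (c = g ∨ c = k) ∧ a = .snd c S.err ∧ ∃ n, V = .proc (delays n nil) := by
  cases h with
  | rcvIgn c x _ _ => exact .inl ⟨c, x, rfl, rfl⟩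
  | sumTauL _ h => (rcases step_out h with ⟨c, x, ⟨⟩, _⟩ | ⟨⟨⟩, _⟩)
  | sumTauR _ h => (rcases step_out h with ⟨c, x, ⟨⟩, _⟩ | ⟨⟨⟩, _⟩)
  | sumSndL _ h =>
    rcases step_out h with ⟨c, x, ⟨⟩, _⟩ | ⟨e, h⟩
    exact .inr ⟨g, .inl rfl, e, h⟩
  | sumSndR _ h =>
    rcases step_out h with ⟨c, x, ⟨⟩, _⟩ | ⟨e, h⟩
    exact .inr ⟨k, .inr rfl, e, h⟩
  | sumTime h _ => (rcases step_out h with ⟨c, x, ⟨⟩, _⟩ | ⟨⟨⟩, _⟩)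
  | sumRcvL _ _ _ h => exact h.elim
  | sumRcvR _ _ _ h => exact h.elim

theorem step_halt_left (Γ : Env S C) (g h : C) :
    Step Γ (.proc (halt g h)) (.snd g S.err) (.proc (delays (S.delta S.err) nil)) :=
  .sumSndL _ (step_out_snd Γ g)

theorem step_halt_right (Γ : Env S C) (g h : C) :
    Step Γ (.proc (halt g h)) (.snd h S.err) (.proc (delays (S.delta S.err) nil)) :=
  .sumSndR _ (step_out_snd Γ h)

theorem step_delay {P : Proc S C 0 0} (h : Step Γ (.proc (delay P)) a V) :
    (∃ c x, a = .rcv c x ∧ V = .proc (delay P)) ∨ (a = .sigma ∧ V = .proc P) := by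
  cases h with
  | rcvIgn c x _ _ => exact .inl ⟨c, x, rfl, rfl⟩
  | sleep => exact .inr ⟨rfl, rfl⟩

theorem step_delays_nil {k : ℕ} (h : Step Γ (.proc (delays k nil)) a V) :
    (∃ c x, a = .rcv c x ∧ V = .proc (delays k nil)) ∨
      (a = .sigma ∧ ∃ n, V = .proc (delays n nil)) := by
  cases k with
  | zero =>
    cases h with
    | rcvIgn c x _ _ => exact .inl ⟨c, x, rfl, rfl⟩
    | timeNil => exact .inr ⟨rfl, 0, rfl⟩
  | succ k =>
    rw [delays_succ] at h ⊢
    exact (step_delay h).imp_right fun h => ⟨h.1, k, h.2⟩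

theorem step_arcv {d : C} {P : Proc S C 1 0} (h : Step Γ (.arcv d P) a V) :
    (∃ c x, a = .rcv c x ∧ V = .arcv d P) ∨
      (a = .sigma ∧ (V = .arcv d P ∨ (Γ d).1 = 1 ∧ V = .proc (P.inst (Γ d).2))) := by
  cases h with
  | rcvIgn c x _ _ => exact .inl ⟨c, x, rfl, rfl⟩
  | actRcv => exact .inr ⟨rfl, .inl rfl⟩
  | endRcv _ _ h => exact .inr ⟨rfl, .inr ⟨h, rfl⟩⟩

theorem step_gate {e f p : C} (h : Step Γ (.proc (gate e f p)) a V) :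
    (∃ c x, a = .rcv c x ∧ V = .proc (gate e f p)) ∨
      (a = .tau ∧ V = .proc (halt e f)) ∨
      (a = .snd p S.err ∧ ∃ k, V = .proc (delays k nil)) := by
  cases h with
  | rcvIgn c x _ _ => exact .inl ⟨c, x, rfl, rfl⟩
  | sumTauL _ h => cases h; exact .inr (.inl ⟨rfl, rfl⟩)
  | sumTauR _ h => (rcases step_out h with ⟨c, x, ⟨⟩, _⟩ | ⟨⟨⟩, _⟩)
  | sumSndL _ h => cases h
  | sumSndR _ h =>
    rcases step_out h with ⟨c, x, ⟨⟩, _⟩ | ⟨e, h⟩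
    exact .inr (.inr ⟨e, h⟩)
  | sumTime h _ => cases h
  | sumRcvL _ _ _ h => exact h.elim
  | sumRcvR _ _ _ h => exact h.elim

theorem step_watch {b : BExp S C 0} {P Q : Proc S C 0 0} {q : C}
    (h : Step Γ (.proc (watch b P Q q)) a V) :
    (∃ c x, a = .rcv c x ∧ V = .proc (watch b P Q q)) ∨
      (a = .tau ∧ b.Holds Γ ∧ V = .proc (delay P)) ∨
      (a = .tau ∧ ¬ b.Holds Γ ∧ V = .proc (delay Q)) ∨
      (a = .snd q S.err ∧ ∃ k, V = .proc (delays k nil)) := by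
  cases h with
  | rcvIgn c x _ _ => exact .inl ⟨c, x, rfl, rfl⟩
  | sumTauL _ h =>
    cases h with
    | condThen _ _ _ h => exact .inr (.inl ⟨rfl, h, rfl⟩)
    | condElse _ _ _ h => exact .inr (.inr (.inl ⟨rfl, h, rfl⟩))
  | sumTauR _ h => (rcases step_out h with ⟨c, x, ⟨⟩, _⟩ | ⟨⟨⟩, _⟩)
  | sumSndL _ h => cases h
  | sumSndR _ h =>
    rcases step_out h with ⟨c, x, ⟨⟩, _⟩ | ⟨e, h⟩
    exact .inr (.inr (.inr ⟨e, h⟩))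
  | sumTime h _ => cases h
  | sumRcvL _ _ _ h => exact h.elim
  | sumRcvR _ _ _ h => exact h.elim

end Steps

/-! ## Barbs of tests -/

theorem Config.weakBarb_of_snd {K : Config S C} {X X' : Sys S C} {hX : X.Guarded} {c : C}
    {x : S.Val} (h : Step K.env X (.snd c x) X') (hc : ¬ K.sys.IsRcv c) :
    (K.par X hX).WeakBarb c := by
  refine .of_reds (.single (ExtStep.par_snd_right (Sys.guarded_step h hX) h
    (Config.performs_transmit hc x)).red) (Config.Barb.weakBarb ?_)
  exact Env.exposed_transmit

theorem Config.Dead.not_isRcv {K : Config S C} {c : C} (h : K.Dead c) : ¬ K.sys.IsRcv c :=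
  fun k => h.2 k.mem_chans

/-- If a test stays as it is until, with the passage of time, it can signal along `p`, then a
barb on a channel that occurs in the test only cannot come before one on `p`. -/
theorem Config.weakBarb_of_waiting {X : Sys S C} {hX : X.Guarded} {e p : C}
    (hw : ∀ Γ a X', Step Γ X a X' → X' = X ∧ (a = .sigma ∨ ∃ c x, a = .rcv c x) ∨
      a = .sigma ∧ ∀ Γ', ∃ x X'', Step Γ' X' (.snd p x) X'')
    {K : Config S C} (he : K.Dead e) (hp : K.Dead p) (h : (K.par X hX).WeakBarb e) :
    (K.par X hX).WeakBarb p := by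
  obtain ⟨M, hr, hb⟩ := h
  generalize hL : K.par X hX = L at hr
  induction hr using Relation.ReflTransGen.head_induction_on generalizing K with
  | refl => subst hL; exact absurd he.1 hb
  | head h₁ _ ih =>
    subst hL
    refine .of_reds (.single h₁) ?_
    rcases red_iff.1 h₁ with h | h
    · obtain ⟨K', X', hX', rfl, ⟨k, hx⟩ | ⟨k, _⟩ | ⟨c, x, k, _⟩⟩ := h.tau_par
      · have : X' = X := by
          rcases hx with rfl | ⟨c, x, hx⟩
          · rfl
          · rcases hw _ _ _ hx with ⟨e, _⟩ | ⟨⟨⟩, _⟩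
            exact e
        subst this
        exact ih (he.red k.red) (hp.red k.red) rfl
      · rcases hw _ _ _ k with ⟨_, ⟨⟨⟩⟩ | ⟨_, _, ⟨⟩⟩⟩ | ⟨⟨⟩, _⟩
      · rcases hw _ _ _ k with ⟨_, ⟨⟨⟩⟩ | ⟨_, _, ⟨⟩⟩⟩ | ⟨⟨⟩, _⟩
    · obtain ⟨K', X', hX', rfl, h, hx⟩ := h.sigma_par
      have hr := red_iff.2 (.inr h)
      rcases hw _ _ _ hx with ⟨rfl, _⟩ | ⟨_, hs⟩
      · exact ih (he.red hr) (hp.red hr) rfl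
      · obtain ⟨x, X'', hs⟩ := hs K'.env
        exact Config.weakBarb_of_snd hs (hp.red hr).not_isRcv

/-! ## Configurations within a context of private channels -/

/-- `T` uses channels of `F` only, `K` uses none of these, and `Γ` is the environment of `K`
outside `F`. -/
structure Half (F : Set C) (K : Config S C) (Γ : Env S C) (T : Sys S C) : Prop where
  env_eq : ∀ c ∉ F, Γ c = K.env c
  disjoint : ∀ c ∈ F, c ∉ K.sys.chans
  subset : T.chans ⊆ F
  wf : WNets Γ T

theorem Half.congr_env {F : Set C} {K : Config S C} {Γ : Env S C} {T : Sys S C}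
    (h : Half F K Γ T) : ∀ c ∈ K.sys.chans, Γ c = K.env c :=
  fun c hc => h.env_eq c fun k => h.disjoint c k hc

theorem Half.mono {F F' : Set C} {K : Config S C} {Γ : Env S C} {T : Sys S C}
    (h : Half F K Γ T) (hF : F ⊆ F') (hd : ∀ c ∈ F', c ∉ K.sys.chans) : Half F' K Γ T :=
  ⟨fun c hc => h.env_eq c fun k => hc (hF k), hd, h.subset.trans hF, h.wf⟩

/-- The transitions of `K | T` are due to `K`, or else they concern the private channels. -/
theorem Half.parStep {F : Set C} {K L : Config S C} {T W' T' : Sys S C} {a : Act S C}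
    (h : Half F K L.env T) (e : SEq K.sys L.sys) (hs : ParStep L.env L.sys T a W' T')
    (ha : ∀ c x, a = .rcv c x → c ∈ F) :
    ∃ K', Half F K' (upd a L.env) T' ∧ SEq K'.sys W' ∧
      ((a ≠ .sigma ∧ ExtTaus K K' ∧ ∀ c x, a = .rcv c x → K' = K) ∨
        (a = .sigma ∧ ExtStep K .sigma K')) := by
  -- `L` moves in its own environment, `K` in that of `K`; the two agree on the channels of `K`, and
  -- transitions depend on nothing else.
  have real : ∀ {b : Act S C} {W'}, Step L.env L.sys b W' →
      ∃ K', K.Performs b K' ∧ SEq K'.sys W' := by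
    intro b W' hb
    have hb := hb.congr_env (Γ' := K.env) (e.chans ▸ h.congr_env)
    obtain ⟨V, hV, e'⟩ := (e.simulate K.env).2 _ _ hb
    exact ⟨K.after hV, K.performs_after hV, e'.symm⟩
  have half : ∀ {b : Act S C} {K'}, K.Performs b K' → T'.chans ⊆ F → WNets (upd b L.env) T' →
      Half F K' (upd b L.env) T' := fun hb hT hw =>
    ⟨fun c hc => by rw [hb.2]; exact upd_congr _ (h.env_eq c hc),
      fun c hc k => h.disjoint c hc (Sys.chans_step hb.1 k), hT, hw⟩
  -- A channel of `F` does not occur in `K`, so a message along it is ignored, up to unfolding, and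
  -- changes the environment inside `F` only.
  have own : ∀ {c : C} {x : S.Val} {W'}, c ∈ F → Step L.env L.sys (.rcv c x) W' →
      SEq K.sys W' ∧ ∀ d ∉ F, L.env.transmit c x d = K.env d := by
    intro c x W' hc hW
    refine ⟨e.trans (SEq.of_ignored hW fun k => h.disjoint c hc (e.chans ▸ k.mem_chans)),
      fun d hd => ?_⟩
    rw [Env.transmit_of_ne (by rintro rfl; exact hd hc), h.env_eq d hd]
  cases hs with
  | sndL h₁ h₂ =>
    obtain ⟨K', hp, e'⟩ := real h₁
    exact ⟨K', half hp ((Sys.chans_step h₂).trans h.subset)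
      (WNets.step (a := .rcv _ _) h₂ h.wf), e', .inl ⟨by simp, .single (.shh _ _ hp), by simp⟩⟩
  | sndR h₁ h₂ =>
    obtain ⟨e', hu⟩ := own (h.subset (Sys.mem_chans_of_snd h₂)) h₁
    exact ⟨K, ⟨hu, h.disjoint, (Sys.chans_step h₂).trans h.subset, WNets.step h₂ h.wf⟩, e',
      .inl ⟨by simp, .refl, by simp⟩⟩
  | rcv h₁ h₂ =>
    obtain ⟨e', hu⟩ := own (ha _ _ rfl) h₁
    exact ⟨K, ⟨hu, h.disjoint, (Sys.chans_step h₂).trans h.subset, WNets.step h₂ h.wf⟩, e',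
      .inl ⟨by simp, .refl, by simp⟩⟩
  | time h₁ h₂ =>
    obtain ⟨K', hp, e'⟩ := real h₁
    exact ⟨K', half hp ((Sys.chans_step h₂).trans h.subset) (WNets.step h₂ h.wf), e',
      .inr ⟨rfl, .time hp⟩⟩
  | tauL h₁ =>
    obtain ⟨K', hp, e'⟩ := real h₁
    exact ⟨K', half hp h.subset h.wf, e', .inl ⟨by simp, .single (.tauExt hp), by simp⟩⟩
  | tauR h₂ =>
    exact ⟨K, ⟨h.env_eq, h.disjoint, (Sys.chans_step h₂).trans h.subset, WNets.step h₂ h.wf⟩, e,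
      .inl ⟨by simp, .refl, by simp⟩⟩

/-- `M` runs the test `Y` next to a configuration that satisfies `Q` and a private term; the
channels of `D` are dead except for `Y`. -/
def Testing (F : Set C) (Q : Config S C → Prop) (Y : Sys S C) (D : Set C) (M : Config S C) :
    Prop :=
  ∃ K L T hT hY, Q K ∧ Half F K L.env T ∧ SEq K.sys L.sys ∧
    (∀ c ∈ D, (Config.par L T hT).Dead c) ∧ M = (L.par T hT).par Y hY

theorem Testing.mono {F : Set C} {Q : Config S C → Prop} {Y : Sys S C} {D D' : Set C}
    {M : Config S C} (h : Testing F Q Y D M) (hD : D' ⊆ D) : Testing F Q Y D' M := by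
  obtain ⟨K, L, T, hT, hY, hQ, hh, e, hd, rfl⟩ := h
  exact ⟨K, L, T, hT, hY, hQ, hh, e, fun c hc => hd c (hD hc), rfl⟩

theorem Testing.imp {F : Set C} {Q Q' : Config S C → Prop} {Y : Sys S C} {D : Set C}
    {M : Config S C} (h : Testing F Q Y D M) (hQ : ∀ K, Q K → Q' K) : Testing F Q' Y D M := by
  obtain ⟨K, L, T, hT, hY, hK, h⟩ := h
  exact ⟨K, L, T, hT, hY, hQ K hK, h⟩

theorem Testing.dead {F : Set C} {Q : Config S C → Prop} {Y : Sys S C} {D : Set C}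
    {M : Config S C} (h : Testing F Q Y D M) {c : C} (hc : c ∈ D) (hY : c ∉ Y.chans) :
    M.Dead c := by
  obtain ⟨K, L, T, hT, hY, hQ, hh, e, hd, rfl⟩ := h
  exact ⟨(hd c hc).1, fun k => k.elim (hd c hc).2 (by assumption)⟩

theorem Testing.weakBarb {F : Set C} {Q : Config S C → Prop} {Y : Sys S C} {D : Set C}
    {M : Config S C} (h : Testing F Q Y D M) {c : C} (hc : c ∈ D)
    (hY : ∀ Γ, ∃ x Y', Step Γ Y (.snd c x) Y') : M.WeakBarb c := by
  obtain ⟨K, L, T, hT, _, hQ, hh, e, hd, rfl⟩ := h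
  obtain ⟨x, Y', h⟩ := hY L.env
  exact Config.weakBarb_of_snd h (hd c hc).not_isRcv

/-- Whichever of the configuration, the private term and the test moves, the shape is preserved.
Instantaneous moves of the configuration are absorbed by `Q`, the passage of time is recorded in the
predicate, and only a transmission by the test itself can expose a channel of `D`. The alternatives
are the moves of `Y`, so an analysis of a test reduces to its own few transitions. -/
theorem Testing.red {F : Set C} {Q : Config S C → Prop} {Y : Sys S C} {D : Set C}
    {M M' : Config S C} (h : Testing F Q Y D M) (hr : Config.Red M M')
    (hQ : ∀ K K', Q K → ExtTaus K K' → Q K') (hY : Y.chans ⊆ F) :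
    (∃ Y', (Y' = Y ∨ ∃ Γ c x, Step Γ Y (.rcv c x) Y') ∧ Testing F Q Y' D M') ∨
      (∃ Y' Γ, Step Γ Y .sigma Y' ∧
        Testing F (fun K' => ∃ K, Q K ∧ ExtStep K .sigma K') Y' D M') ∨
      (∃ Y' Γ, Step Γ Y .tau Y' ∧ Testing F Q Y' D M') ∨
      ∃ Y' Γ c x, Step Γ Y (.snd c x) Y' ∧ Testing F Q Y' (D \ {c}) M' := by
  obtain ⟨K, L, T, hT, gY, hK, hh, e, hd, rfl⟩ := h
  -- Here `a` is the action of `L | T` and `b` that of the whole. They differ when `Y` transmits: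
  -- then `a` is an input and `b` an output, with the same update.
  have key : ∀ {a b : Act S C} {W' T' : Sys S C} {Y'} (gY' : Y'.Guarded),
      M'.env = upd b L.env → M'.sys = .par (.par W' T') Y' → upd a L.env = upd b L.env →
      (hs : ParStep L.env L.sys T a W' T') → ∀ {Q' : Config S C → Prop} {K'}, Q' K' →
      Half F K' (upd a L.env) T' → SEq K'.sys W' → ∀ {D' : Set C},
      (∀ c ∈ D', Idle (upd a L.env) c) → D' ⊆ D → Testing F Q' Y' D' M' := by
    intro a b W' T' Y' gY' e₁ e₂ hab hs Q' K' hK' hh' e' D' hi hD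
    have hg := Sys.guarded_step hs.step ⟨L.guarded, hT⟩
    refine ⟨K', ⟨upd a L.env, W', hg.1⟩, T', hg.2, gY', hK', hh', e', fun c hc => ?_, ?_⟩
    · exact ⟨hi c hc, fun k => (hd c (hD hc)).2 (Sys.chans_step hs.step k)⟩
    · exact Config.ext' (e₁.trans hab.symm) e₂
  have idle : ∀ {a : Act S C}, (∀ c x, a = .snd c x ∨ a = .rcv c x → c ∉ D) →
      ∀ c ∈ D, Idle (upd a L.env) c := by
    intro a ha c hc
    have hi : (L.env c).1 = 0 := (hd c hc).1
    cases a with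
    | snd d x =>
      exact (congrArg Prod.fst (Env.transmit_of_ne (by
        rintro rfl; exact ha _ x (.inl rfl) hc))).trans hi
    | rcv d x =>
      exact (congrArg Prod.fst (Env.transmit_of_ne (by
        rintro rfl; exact ha _ x (.inr rfl) hc))).trans hi
    | sigma => exact Nat.sub_eq_zero_of_le (hi.le.trans (Nat.zero_le _))
    | tau => exact hi
  have inner : ∀ {a : Act S C} {W' T' : Sys S C}, ParStep L.env L.sys T a W' T' → ∀ {c x},
      a = .snd c x → c ∉ D := by
    rintro a W' T' hs c x rfl hc
    exact (hd c hc).2 (Sys.mem_chans_of_snd hs.step)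
  cases hr with
  | transmission c x hr =>
    obtain ⟨hr, e₁⟩ := hr
    obtain ⟨V, Y', e₂, hp⟩ := step_par_iff.1 hr
    cases hp with
    | sndL h₁ h₂ =>
      obtain ⟨W', T', rfl, hs⟩ := step_par_iff.1 h₁
      obtain ⟨K', hh', e', ⟨_, hK', _⟩ | ⟨⟨⟩, _⟩⟩ := hh.parStep e hs (by simp)
      refine .inl ⟨Y', .inr ⟨_, _, _, h₂⟩, key (Sys.guarded_step h₂ gY) e₁ e₂ rfl hs
        (hQ _ _ hK hK') hh' e' (idle ?_) subset_rfl⟩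
      rintro d y (k | ⟨⟨⟩⟩)
      exact inner hs k
    | sndR h₁ h₂ =>
      obtain ⟨W', T', rfl, hs⟩ := step_par_iff.1 h₁
      have hc := hY (Sys.mem_chans_of_snd h₂)
      obtain ⟨K', hh', e', ⟨_, hK', _⟩ | ⟨⟨⟩, _⟩⟩ := hh.parStep e hs (by
        rintro _ _ ⟨⟩; exact hc)
      refine .inr (.inr (.inr ⟨Y', _, c, x, h₂,
        key (a := .rcv c x) (b := .snd c x) (Sys.guarded_step h₂ gY) e₁ e₂ rfl hs
        (hQ _ _ hK hK') hh' e' (fun d hd' => ?_) Set.sdiff_subset⟩))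
      exact (congrArg Prod.fst (Env.transmit_of_ne fun k => hd'.2 k)).trans (hd d hd'.1).1
  | time hr =>
    obtain ⟨hr, e₁⟩ := hr
    obtain ⟨V, Y', e₂, hp⟩ := step_par_iff.1 hr
    cases hp with
    | time h₁ h₂ =>
      obtain ⟨W', T', rfl, hs⟩ := step_par_iff.1 h₁
      obtain ⟨K', hh', e', ⟨k, _⟩ | ⟨_, hK'⟩⟩ := hh.parStep e hs (by simp)
      · exact absurd rfl k
      exact .inr (.inl ⟨Y', _, h₂, key (Sys.guarded_step h₂ gY) e₁ e₂ rfl hs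
        ⟨K, hK, hK'⟩ hh' e' (idle (by simp)) subset_rfl⟩)
  | internal hr =>
    obtain ⟨hr, e₁⟩ := hr
    obtain ⟨V, Y', e₂, hp⟩ := step_par_iff.1 hr
    cases hp with
    | tauL h₁ =>
      obtain ⟨W', T', rfl, hs⟩ := step_par_iff.1 h₁
      obtain ⟨K', hh', e', ⟨_, hK', _⟩ | ⟨⟨⟩, _⟩⟩ := hh.parStep e hs (by simp)
      exact .inl ⟨Y, .inl rfl, key gY e₁ e₂ rfl hs (hQ _ _ hK hK') hh' e' (idle (by simp))
        subset_rfl⟩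
    | tauR h₂ =>
      exact .inr (.inr (.inl ⟨Y', _, h₂, K, L, T, hT, Sys.guarded_step h₂ gY, hK, hh, e, hd,
        Config.ext' e₁ e₂⟩))

open Proc Relation

/-! ## Barbed congruence next to a private halt test -/

/-- `L` is `K` next to a private term and to a test `halt g h` on private channels. -/
def Armed (F : Set C) (g h : C) (K L : Config S C) : Prop :=
  ∃ Γ T hT, Half F K Γ T ∧ (∀ c ∈ ({g, h} : Set C), (Config.par (K.withEnv Γ) T hT).Dead c) ∧
    L = ((K.withEnv Γ).par T hT).par (.proc (halt g h)) (guarded_halt g h)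

theorem Armed.testing {F : Set C} {g h : C} {K L : Config S C} (hA : Armed F g h K L)
    {Q : Config S C → Prop} (hQ : Q K) : Testing F Q (.proc (halt g h)) {g, h} L := by
  obtain ⟨Γ, T, hT, hh, hd, rfl⟩ := hA
  exact ⟨K, K.withEnv Γ, T, hT, _, hQ, hh, .refl _, hd, rfl⟩

/-- In `Testing` the running term is equivalent to `K.sys` only; passing to `Armed` replaces it by
`K.sys` itself, at the price of a structural equivalence. -/
theorem Testing.armed {F : Set C} {g h : C} {L : Config S C} {Q : Config S C → Prop}
    (ht : Testing F Q (.proc (halt g h)) {g, h} L) :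
    ∃ K L', Q K ∧ Armed F g h K L' ∧ L.StrEq L' := by
  obtain ⟨K, L, T, hT, hY, hK, hh, e, hd, rfl⟩ := ht
  refine ⟨K, _, hK, ⟨L.env, T, hT, hh, fun c hc => ⟨(hd c hc).1, fun k => (hd c hc).2 ?_⟩, rfl⟩,
    rfl, .par (.par e.symm (.refl _)) (.refl _)⟩
  exact k.imp_left fun k => e.chans ▸ k

theorem Armed.weakBarb {F : Set C} {g h : C} {K L : Config S C} (hA : Armed F g h K L) {c : C}
    (hc : c = g ∨ c = h) : L.WeakBarb c := by
  refine (hA.testing (Q := fun _ => True) trivial).weakBarb (c := c) hc fun Γ => ?_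
  rcases hc with rfl | rfl
  · exact ⟨_, _, step_halt_left Γ _ _⟩
  · exact ⟨_, _, step_halt_right Γ _ _⟩

theorem chans_delays_nil (k : ℕ) :
    (Sys.proc (delays k (nil : Proc S C 0 0))).chans = ∅ := by
  simp [Sys.chans, Proc.chans]

/-- The test neither lets time pass nor reacts to messages. It can only fire, and whichever signal
it emits, no other component knows the channel of the one given up. -/
theorem Testing.halt_red {F : Set C} {g h : C} (hg : g ∈ F) (hh : h ∈ F) (ne : g ≠ h)
    {Q : Config S C → Prop} (hQ : ∀ K K', Q K → ExtTaus K K' → Q K') {M M' : Config S C}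
    (ht : Testing F Q (.proc (halt g h)) {g, h} M) (hr : Config.Red M M') :
    Testing F Q (.proc (halt g h)) {g, h} M' ∨ M'.Dead g ∨ M'.Dead h := by
  rcases ht.red hr hQ (by
      rintro c hc; simp only [Sys.chans, chans_halt] at hc; rcases hc with rfl | rfl <;> assumption)
    with ⟨Y', hY, ht⟩ | ⟨Y', Γ, hY, ht⟩ | ⟨Y', Γ, hY, ht⟩ | ⟨Y', Γ, c, x, hY, ht⟩
  · rcases hY with rfl | ⟨Γ, c, x, hY⟩
    · exact .inl ht
    · rcases step_halt hY with ⟨_, _, _, rfl⟩ | ⟨_, _, ⟨⟩, _⟩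
      exact .inl ht
  · rcases step_halt hY with ⟨_, _, ⟨⟩, _⟩ | ⟨_, _, ⟨⟩, _⟩
  · rcases step_halt hY with ⟨_, _, ⟨⟩, _⟩ | ⟨_, _, ⟨⟩, _⟩
  · rcases step_halt hY with ⟨_, _, ⟨⟩, _⟩ | ⟨_, hc, ⟨⟩, k, rfl⟩
    rcases hc with rfl | rfl
    · exact .inr (.inr (ht.dead (c := h) ⟨.inr rfl, ne.symm⟩ (by simp [chans_delays_nil])))
    · exact .inr (.inl (ht.dead (c := g) ⟨.inl rfl, ne⟩ (by simp [chans_delays_nil])))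

/-- Both barbs being still available, the test has not fired, so time has not passed. This is how a
sequence of reductions is recognised as a sequence of `τ`-steps. -/
theorem Testing.halt_reds {F : Set C} {g h : C} (hg : g ∈ F) (hh : h ∈ F) (ne : g ≠ h)
    {Q : Config S C → Prop} (hQ : ∀ K K', Q K → ExtTaus K K' → Q K') {M M' : Config S C}
    (ht : Testing F Q (.proc (halt g h)) {g, h} M) (hr : ReflTransGen Config.Red M M')
    (bg : M'.WeakBarb g) (bh : M'.WeakBarb h) :
    Testing F Q (.proc (halt g h)) {g, h} M' := by
  have : Testing F Q (.proc (halt g h)) {g, h} M' ∨ M'.Dead g ∨ M'.Dead h := by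
    clear bg bh
    induction hr with
    | refl => exact .inl ht
    | tail _ hr ih =>
      rcases ih with ht | hd | hd
      · exact ht.halt_red hg hh ne hQ hr
      · exact .inr (.inl (hd.red hr))
      · exact .inr (.inr (hd.red hr))
  rcases this with ht | hd | hd
  · exact ht
  · exact absurd bg hd.not_weakBarb
  · exact absurd bh hd.not_weakBarb

/-- Once no channel is required to be dead, the test may do anything within `F` and the shape still
persists, which is enough to read off barbs outside `F`. -/
theorem Testing.reds {F : Set C} {Q : Config S C → Prop} {Y : Sys S C} {M M' : Config S C}
    (ht : Testing F Q Y ∅ M) (hY : Y.chans ⊆ F)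
    (hQ : ∀ K K', Q K → ReflTransGen Config.Red K K' → Q K')
    (hr : ReflTransGen Config.Red M M') :
    ∃ Y', Y'.chans ⊆ F ∧ Testing F Q Y' ∅ M' := by
  induction hr with
  | refl => exact ⟨Y, hY, ht⟩
  | tail _ hr ih =>
    obtain ⟨Y, hY, ht⟩ := ih
    rcases ht.red hr (fun K K' h k => hQ K K' h k.reds) hY
      with ⟨Y', h, ht⟩ | ⟨Y', Γ, h, ht⟩ | ⟨Y', Γ, h, ht⟩ | ⟨Y', Γ, c, x, h, ht⟩
    · refine ⟨Y', ?_, ht⟩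
      rcases h with rfl | ⟨Γ, c, x, h⟩
      · exact hY
      · exact (Sys.chans_step h).trans hY
    · exact ⟨Y', (Sys.chans_step h).trans hY,
        ht.imp fun K' ⟨K, hK, k⟩ => hQ K K' hK (.single (red_iff.2 (.inr k)))⟩
    · exact ⟨Y', (Sys.chans_step h).trans hY, ht⟩
    · exact ⟨Y', (Sys.chans_step h).trans hY, ht.mono (by simp)⟩

/-- The environments agree at `c`, up to the value at an idle channel. -/
def Agree (Γ Δ : Env S C) (c : C) : Prop := Γ c = Δ c ∨ (Idle Γ c ∧ Idle Δ c)

theorem Agree.symm {Γ Δ : Env S C} {c : C} (h : Agree Γ Δ c) : Agree Δ Γ c :=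
  h.imp Eq.symm And.symm

theorem Idle.upd_sigma {Γ : Env S C} {c : C} (h : Idle Γ c) : Idle (upd .sigma Γ) c :=
  Nat.sub_eq_zero_of_le (h.le.trans (Nat.zero_le _))

theorem Agree.upd_sigma {Γ Δ : Env S C} {c : C} (h : Agree Γ Δ c) :
    Agree (upd .sigma Γ) (upd .sigma Δ) c :=
  h.imp (upd_congr _) fun h => ⟨h.1.upd_sigma, h.2.upd_sigma⟩

theorem Agree.congr {Γ Γ' Δ Δ' : Env S C} {c : C} (h : Agree Γ Δ c) (h₁ : Γ' c = Γ c)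
    (h₂ : Δ' c = Δ c) : Agree Γ' Δ' c := by
  unfold Agree Idle; rw [h₁, h₂]; exact h

/-- Barbed congruence next to private terms and a private halt test, which allows to tell
instantaneous reductions from the passage of time. -/
structure Rel (F : Set C) (g h : C) (K₁ K₂ : Config S C) : Prop where
  finite : F.Finite
  left_mem : g ∈ F
  right_mem : h ∈ F
  ne : g ≠ h
  agree : ∀ c ∈ F, Agree K₁.env K₂.env c
  infinite : {c | Idle K₁.env c ∧ Idle K₂.env c}.Infinite
  congruent : ∃ L₁ L₂, Armed F g h K₁ L₁ ∧ Armed F g h K₂ L₂ ∧ BarbedCongruent L₁ L₂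

theorem Armed.disjoint {F : Set C} {g h : C} {K L : Config S C} (hA : Armed F g h K L) :
    ∀ c ∈ F, c ∉ K.sys.chans := by
  obtain ⟨_, _, _, hh, _⟩ := hA
  exact hh.disjoint

theorem infinite_idle {K₁ K₂ K₁' K₂' : Config S C}
    (h : {c | Idle K₁.env c ∧ Idle K₂.env c}.Infinite)
    (h₁ : ∀ c ∉ K₁.sys.chans, Idle K₁.env c → Idle K₁'.env c)
    (h₂ : ∀ c ∉ K₂.sys.chans, Idle K₂.env c → Idle K₂'.env c) :
    {c | Idle K₁'.env c ∧ Idle K₂'.env c}.Infinite := by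
  refine (h.sdiff (K₁.sys.finite_chans.union K₂.sys.finite_chans)).mono fun c hc => ?_
  exact ⟨h₁ c (fun k => hc.2 (.inl k)) hc.1.1, h₂ c (fun k => hc.2 (.inr k)) hc.1.2⟩

namespace Rel

variable {F : Set C} {g h : C} {K₁ K₂ : Config S C}

theorem symm (hR : Rel F g h K₁ K₂) : Rel F g h K₂ K₁ where
  finite := hR.finite
  left_mem := hR.left_mem
  right_mem := hR.right_mem
  ne := hR.ne
  agree c hc := (hR.agree c hc).symm
  infinite := hR.infinite.mono fun _ hc => ⟨hc.2, hc.1⟩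
  congruent := by
    obtain ⟨L₁, L₂, h₁, h₂, hb⟩ := hR.congruent
    exact ⟨L₂, L₁, h₂, h₁, hb.symm⟩

theorem disjoint_left (hR : Rel F g h K₁ K₂) : ∀ c ∈ F, c ∉ K₁.sys.chans := by
  obtain ⟨L₁, L₂, h₁, h₂, hb⟩ := hR.congruent
  exact h₁.disjoint

theorem disjoint_right (hR : Rel F g h K₁ K₂) : ∀ c ∈ F, c ∉ K₂.sys.chans :=
  hR.symm.disjoint_left

theorem exists_fresh (hR : Rel F g h K₁ K₂) {A : Set C} (hA : A.Finite) :
    ∃ c, c ∉ A ∧ c ∉ F ∧ K₁.Dead c ∧ K₂.Dead c := by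
  obtain ⟨c, hc, hn⟩ := (hR.infinite.sdiff (hA.union (hR.finite.union
    (K₁.sys.finite_chans.union K₂.sys.finite_chans)))).nonempty
  simp only [Set.mem_union, not_or] at hn
  exact ⟨c, hn.1, hn.2.1, ⟨hc.1, hn.2.2.1⟩, hc.2, hn.2.2.2⟩

/-- The step is carried out next to the private term and the pending `halt g h`, so both signals
stay available; the answer must keep them and hence is instantaneous. -/
theorem tau (hR : Rel F g h K₁ K₂) {K₁' : Config S C} (hK : ExtStep K₁ .tau K₁') :
    ∃ K₂', ExtTaus K₂ K₂' ∧ Rel F g h K₁' K₂' := by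
  obtain ⟨L₁, L₂, h₁, h₂, hb⟩ := hR.congruent
  obtain ⟨L₁', hr, hA⟩ : ∃ L₁', Config.Red L₁ L₁' ∧ Armed F g h K₁' L₁' := by
    obtain ⟨Γ, T, hT, hh, hd, rfl⟩ := h₁
    -- The step of `K₁` is replayed in `Γ`, the environment of the composition, which agrees with
    -- `K₁.env` on the channels of `K₁`.
    have key : ∀ a, K₁.Performs a K₁' → (a = .tau ∨ ∃ c x, a = .snd c x) →
        ∃ Γ', ExtStep (K₁.withEnv Γ) .tau (K₁'.withEnv Γ') ∧ (∀ c ∉ F, Γ' c = K₁'.env c) ∧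
          WNets Γ' T := by
      rintro a ⟨hs, e⟩ ha
      have hs' := hs.congr_env fun c hc => (hh.congr_env c hc).symm
      refine ⟨upd a Γ, ?_, fun c hc => ?_, ?_⟩
      · rcases ha with rfl | ⟨c, x, rfl⟩
        · exact .tauExt ⟨hs', rfl⟩
        · exact .shh c x ⟨hs', rfl⟩
      · rw [e]; exact upd_congr _ (hh.env_eq c hc)
      · rcases ha with rfl | ⟨c, x, rfl⟩
        · exact hh.wf
        · exact hh.wf.transmit c x
    obtain ⟨Γ', hs, he, hw⟩ : ∃ Γ', ExtStep (K₁.withEnv Γ) .tau (K₁'.withEnv Γ') ∧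
        (∀ c ∉ F, Γ' c = K₁'.env c) ∧ WNets Γ' T := by
      rcases extStep_tau_iff.1 hK with hp | ⟨c, x, hp⟩
      · exact key _ hp (.inl rfl)
      · exact key _ hp (.inr ⟨c, x, rfl⟩)
    have hs₁ := hs.par_left hT fun c hc k => hh.disjoint c (hh.subset k.mem_chans) hc
    refine ⟨_, (hs₁.par_left (X := .proc (halt g h)) (guarded_halt g h) fun c hc k => ?_).red,
      Γ', T, hT, ⟨he, fun c hc k => hh.disjoint c hc (hK.chans_subset k), hh.subset, hw⟩,
      fun c hc => (hd c hc).red hs₁.red, rfl⟩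
    exact k.elim id id
  obtain ⟨L₂', hr₂, hb⟩ := hb.reds (.single hr)
  have ht := (h₂.testing (Q := ExtTaus K₂) .refl).halt_reds hR.left_mem hR.right_mem hR.ne
    (fun _ _ h k => h.trans k) hr₂ (hb.weakBarb (hA.weakBarb (.inl rfl)))
    (hb.weakBarb (hA.weakBarb (.inr rfl)))
  obtain ⟨K₂', M, hK₂, hA', e⟩ := ht.armed
  refine ⟨K₂', hK₂, hR.finite, hR.left_mem, hR.right_mem, hR.ne, fun c hc => ?_, ?_,
    L₁', M, hA, hA', hb.congr ⟨rfl, .refl _⟩ e⟩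
  · exact (hR.agree c hc).congr (hK.env_eq (hR.disjoint_left c hc))
      (hK₂.env_eq (hR.disjoint_right c hc))
  · refine infinite_idle hR.infinite (fun c hc hi => ?_) (fun c hc hi => ?_)
    · rwa [Idle, hK.env_eq hc]
    · rwa [Idle, hK₂.env_eq hc]

/-- At private channels the composition says nothing about `K₁`, but there the environments agree by
definition of `Rel`. Elsewhere the barbs of the composition are those of the configuration it
contains. -/
theorem weakBarb_of_barb (hR : Rel F g h K₁ K₂) {c : C} (hc : K₁.Barb c) : K₂.WeakBarb c := by
  by_cases hF : c ∈ F
  · rcases hR.agree c hF with e | ⟨k, _⟩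
    · refine Config.Barb.weakBarb ?_
      unfold Config.Barb Exposed Idle; rwa [← e]
    · exact absurd k hc
  · obtain ⟨L₁, L₂, h₁, h₂, hb⟩ := hR.congruent
    have hL : L₁.Barb c := by
      obtain ⟨Γ, T, hT, hh, hd, rfl⟩ := h₁
      exact fun k => hc ((congrArg Prod.fst (hh.env_eq c hF)).symm.trans k)
    obtain ⟨M, hr, hM⟩ := hb.weakBarb hL.weakBarb
    obtain ⟨Y, hY, K, L, T, hT, _, hK, hh, e, _, rfl⟩ :=
      ((h₂.testing (Q := ReflTransGen Config.Red K₂) .refl).mono (Set.empty_subset _)).reds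
        (by rintro d hd; simp [Sys.chans] at hd
            rcases hd with rfl | rfl
            exacts [hR.left_mem, hR.right_mem])
        (fun _ _ h k => h.trans k) hr
    exact ⟨K, hK, fun k => hM ((congrArg Prod.fst (hh.env_eq c hF)).trans k)⟩

end Rel

/-! ## Matching the passage of time -/

theorem SEq.exchange (W T J Y : Sys S C) :
    SEq (.par T (.par W (.par J Y))) (.par (.par W (.par T J)) Y) := by
  refine (SEq.assoc _ _ _).symm.trans ((SEq.par (.comm _ _) (.refl _)).trans ?_)
  refine (SEq.assoc _ _ _).trans ?_
  exact (SEq.par (.refl _) (SEq.assoc _ _ _).symm).trans (SEq.assoc _ _ _).symm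

/-- A run of the composition around one `σ` of `K`, with two checkpoints. At `N` the old `halt` has
signalled on `g` and given up `h`; at `N'` time has passed once and the gate has become `halt e f`,
giving up `p`. Before `N` the private term must exhaust its instantaneous steps, since it could
otherwise block time. -/
theorem Armed.pass_time {F F' : Set C} {g h e f p : C} {K K' L : Config S C}
    (hA : Armed F g h K L) (hK : ExtStep K .sigma K') (hg : g ∈ F) (hh : h ∈ F) (ne : g ≠ h)
    (hF : F ⊆ F') (hd : ∀ c ∈ F', c ∉ K.sys.chans)
    (hn : ∀ c, c = e ∨ c = f ∨ c = p → c ∉ F ∧ Idle K.env c ∧ c ∈ F')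
    (hpe : p ≠ e) (hpf : p ≠ f) :
    ∃ M N N' N'', (L.par (.proc (delay (gate e f p))) (guarded_gate e f p)).StrEq M ∧
      ReflTransGen Config.Red M N ∧ N.Barb g ∧ N.Dead h ∧ ReflTransGen Config.Red N N' ∧
      N'.StrEq N'' ∧ Armed F' e f K' N'' ∧ N''.Dead p := by
  obtain ⟨Γ, T, hT, half, hdead, rfl⟩ := hA
  have hgT : g ∉ T.chans := fun k => (hdead g (.inl rfl)).2 (.inr k)
  have hhT : h ∉ T.chans := fun k => (hdead h (.inr rfl)).2 (.inr k)
  obtain ⟨D, D', hD, hwD, hD'⟩ :=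
    Config.WellFormed.exists_time (K := ⟨Γ, T, hT⟩) (by exact half.wf)
  have hcD : D.sys.chans ⊆ T.chans := hD.chans_subset
  obtain ⟨hsD, eD'⟩ := extStep_sigma_iff.1 hD'
  obtain ⟨hsK, eK'⟩ := extStep_sigma_iff.1 hK
  have hcD' : D'.sys.chans ⊆ T.chans := (Sys.chans_step hsD).trans hcD
  have envD : ∀ c ∉ F, D.env.transmit g S.err c = K.env c := fun c hc => by
    rw [Env.transmit_of_ne (by rintro rfl; exact hc hg),
      hD.env_eq (c := c) fun k => hc (half.subset k)]
    exact half.env_eq c hc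
  -- Since `delta` is positive, what is left of the signal on `g` is a delay with at least one slot
  -- to go, and it lets time pass.
  obtain ⟨m, hm⟩ := Nat.exists_eq_add_of_lt (S.delta_pos S.err)
  rw [zero_add] at hm
  let X : Sys S C := .proc (delay (gate e f p))
  let V : Sys S C := .par K.sys (.par (.proc (halt g h)) X)
  have hV : V.Guarded := ⟨K.guarded, guarded_halt g h, guarded_gate e f p⟩
  have r₁ : ExtTaus (Config.par ⟨Γ, T, hT⟩ V hV) (D.par V hV) := by
    refine hD.par_left hV fun c hc k => ?_
    rcases k with k | (k | k) | k
    · exact half.disjoint c (half.subset hc) k.mem_chans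
    · exact k.elim
    · exact k.elim
    · exact k.elim
  have s₂ : Step (D.par V hV).env (D.par V hV).sys (.snd g S.err)
      (.par D.sys (.par K.sys (.par (.proc (delays (S.delta S.err) nil)) X))) :=
    .syncR (.rcvIgn _ _ _ fun k => hgT (hcD k.2.mem_chans))
      (.syncR (.rcvIgn _ _ _ fun k => half.disjoint g hg k.2.mem_chans)
        (.syncL (step_halt_left _ g h) (.rcvIgn _ _ _ fun k => k.2)))
  let N := (D.par V hV).after s₂
  have t₁ : Step N.env D.sys .sigma D'.sys := hsD.congr_env fun c hc =>
    (Env.transmit_of_ne (by rintro rfl; exact hgT (hcD hc))).symm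
  have t₂ : Step N.env K.sys .sigma K'.sys := hsK.congr_env fun c hc =>
    (envD c fun k => half.disjoint c k hc).symm
  have t₃ : Step N.env (.proc (delays (S.delta S.err) nil)) .sigma (.proc (delays m nil)) := by
    rw [hm, delays_succ]; exact .sleep _
  have s₃ : Step N.env N.sys .sigma
      (.par D'.sys (.par K'.sys (.par (.proc (delays m nil)) (.proc (gate e f p))))) :=
    .timePar t₁ (.timePar t₂ (.timePar t₃ (.sleep _)))
  have s₄ : Step (N.after s₃).env (N.after s₃).sys .tau
      (.par D'.sys (.par K'.sys (.par (.proc (delays m nil)) (.proc (halt e f))))) :=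
    .tauParR _ (.tauParR _ (.tauParR _ (.sumTauL _ (.tau _))))
  -- The new private term: the old one after the passage of time, and the remaining delay of the
  -- signal on `g`.
  let J : Sys S C := .par D'.sys (.proc (delays m nil))
  have hJ : J.Guarded := ⟨D'.guarded, guarded_delays_nil m⟩
  have idleN : ∀ c, c = e ∨ c = f ∨ c = p → Idle (upd .sigma N.env) c := fun c hc => by
    obtain ⟨h₁, h₂, -⟩ := hn c hc
    exact Idle.upd_sigma ((congrArg Prod.fst (envD c h₁)).trans h₂)
  have deadN : ∀ c, c = e ∨ c = f ∨ c = p →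
      (Config.par (K'.withEnv (upd .sigma N.env)) J hJ).Dead c := fun c hc => by
    refine ⟨idleN c hc, ?_⟩
    rintro (k | k | k)
    · exact hd c (hn c hc).2.2 (Sys.chans_step hsK k)
    · exact (hn c hc).1 (half.subset (hcD' k))
    · rw [chans_delays_nil] at k; exact k
  refine ⟨Config.par ⟨Γ, T, hT⟩ V hV, N, (N.after s₃).after s₄,
    ((K'.withEnv (upd .sigma N.env)).par J hJ).par (.proc (halt e f)) (guarded_halt e f),
    ⟨rfl, ?_⟩, ?_, ?_, ⟨?_, ?_⟩, ?_, ⟨rfl, SEq.exchange _ _ _ _⟩,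
    ⟨_, J, hJ, ⟨?_, ?_, ?_, ?_⟩, ?_, rfl⟩,
    (deadN p (.inr (.inr rfl))).1, ?_⟩
  · refine (SEq.assoc _ _ _).trans ((SEq.assoc _ _ _).trans ?_)
    refine (SEq.assoc _ _ _).symm.trans ((SEq.par (.comm _ _) (.refl _)).trans ?_)
    exact SEq.assoc _ _ _
  · exact r₁.reds.tail (ExtStep.shh _ _ ((D.par V hV).performs_after s₂)).red
  · exact Env.exposed_transmit
  · refine (congrArg Prod.fst (Env.transmit_of_ne ne.symm)).trans ?_
    exact (congrArg Prod.fst (hD.env_eq (c := h) hhT)).trans (hdead h (.inr rfl)).1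
  · rintro (k | k | k | k)
    · exact hhT (hcD k)
    · exact half.disjoint h hh k
    · rw [chans_delays_nil] at k; exact k
    · simp only [X, Sys.chans, Proc.chans, chans_gate] at k
      rcases k with (k | k) | k
      · exact (hn e (.inl rfl)).1 (k ▸ hh)
      · exact (hn f (.inr (.inl rfl))).1 (k ▸ hh)
      · exact (hn p (.inr (.inr rfl))).1 (k ▸ hh)
  · exact (ReflTransGen.single (red_iff.2 (.inr (.time (N.performs_after s₃))))).tail
      (ExtStep.tauExt ((N.after s₃).performs_after s₄)).red
  · intro c hc
    rw [eK']
    exact upd_congr _ (envD c fun k => hc (hF k))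
  · exact fun c hc k => hd c hc (Sys.chans_step hsK k)
  · rintro c (k | k)
    · exact hF (half.subset (hcD' k))
    · rw [chans_delays_nil] at k; exact k.elim
  · exact .par (WNets.step t₁ (WNets.transmit hwD g S.err)) (.proc _)
  · rintro c (rfl | rfl)
    · exact deadN _ (.inl rfl)
    · exact deadN _ (.inr (.inl rfl))
  · rintro (k | k)
    · exact (deadN p (.inr (.inr rfl))).2 k
    · simp only [Sys.chans, chans_halt] at k
      rcases k with k | k
      · exact hpe k
      · exact hpf k

theorem WeakExtStep.taus {K K' K'' : Config S C} {α : ExtAct S C} (h : WeakExtStep K α K')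
    (hr : ExtTaus K' K'') : WeakExtStep K α K'' := by
  rcases h with ⟨rfl, h⟩ | ⟨hα, L, L', h₁, h₂, h₃⟩
  · exact .inl ⟨rfl, h.trans hr⟩
  · exact .inr ⟨hα, L, L', h₁, h₂, h₃.trans hr⟩

theorem WeakExtStep.of_sigma {K L L' : Config S C} (h : ExtTaus K L) (hs : ExtStep L .sigma L') :
    WeakExtStep K .sigma L' :=
  .inr ⟨by simp, L, L', h, hs, .refl⟩

theorem WeakExtStep.sigma_cases {K K' : Config S C} (h : WeakExtStep K .sigma K') :
    ∃ L L', ExtTaus K L ∧ ExtStep L .sigma L' ∧ ExtTaus L' K' := by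
  rcases h with ⟨⟨⟩, _⟩ | ⟨_, h⟩
  exact h

theorem WeakExtStep.sigma_env {K K' : Config S C} (h : WeakExtStep K .sigma K') {c : C}
    (hc : c ∉ K.sys.chans) : K'.env c = upd .sigma K.env c := by
  obtain ⟨L, L', h₁, h₂, h₃⟩ := h.sigma_cases
  have hs := extStep_sigma_iff.1 h₂
  rw [h₃.env_eq fun k => hc (h₁.chans_subset (Sys.chans_step hs.1 k)), hs.2]
  exact upd_congr _ (h₁.env_eq hc)

/-! ### Runs of the test for the passage of time -/

section Run

variable {F : Set C} {e f p : C} {K M M' : Config S C}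

/-- The test that is about to be triggered by the passage of time. -/
def waiting (k : ℕ) (e f p : C) : Sys S C :=
  .par (.proc (delays k nil)) (.proc (delay (gate e f p)))

/-- The test just after the passage of time. -/
def triggered (k : ℕ) (e f p : C) : Sys S C := .par (.proc (delays k nil)) (.proc (gate e f p))

/-- The test that prevents a further passage of time. -/
def halting (k : ℕ) (e f : C) : Sys S C := .par (.proc (delays k nil)) (.proc (halt e f))

theorem chans_waiting (k : ℕ) : (waiting k e f p : Sys S C).chans = {e, f} ∪ {p} := by
  rw [waiting, Sys.chans, chans_delays_nil, Set.empty_union]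
  exact chans_gate e f p

theorem chans_triggered (k : ℕ) : (triggered k e f p : Sys S C).chans = {e, f} ∪ {p} := by
  rw [triggered, Sys.chans, chans_delays_nil, Set.empty_union]
  exact chans_gate e f p

theorem chans_halting (k : ℕ) : (halting k e f : Sys S C).chans = {e, f} := by
  rw [halting, Sys.chans, chans_delays_nil, Set.empty_union]
  exact chans_halt e f

/-- While `halt g h` is pending, time is blocked and the gate remains delayed. A signal on `g`
releases time; a signal on `h` gives up `g` for ever. -/
theorem Testing.armed_red {g h : C} (hg : g ∈ F) (hh : h ∈ F) (ne : g ≠ h)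
    (hn : ∀ c, c = e ∨ c = f ∨ c = p → c ∈ F ∧ c ≠ g ∧ c ≠ h)
    (ht : Testing F (ExtTaus K)
      (.par (.proc (halt g h)) (.proc (delay (gate e f p)))) {g, h, e, f, p} M)
    (hr : Config.Red M M') :
    Testing F (ExtTaus K)
      (.par (.proc (halt g h)) (.proc (delay (gate e f p)))) {g, h, e, f, p} M' ∨
      (∃ k, Testing F (ExtTaus K) (waiting k e f p) {e, f, p} M') ∨ M'.Dead g := by
  have hY : (Sys.par (.proc (halt g h)) (.proc (delay (gate e f p))) : Sys S C).chans ⊆ F := by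
    rintro c hc
    simp only [Sys.chans, Proc.chans, chans_gate, chans_halt] at hc
    rcases hc with (rfl | rfl) | (hc | hc) | hc
    exacts [hg, hh, (hn c (.inl hc)).1, (hn c (.inr (.inl hc))).1, (hn c (.inr (.inr hc))).1]
  rcases ht.red hr (fun _ _ h k => h.trans k) hY
    with ⟨Y', hY, ht⟩ | ⟨Y', Γ, hY, ht⟩ | ⟨Y', Γ, hY, ht⟩ | ⟨Y', Γ, c, x, hY, ht⟩
  · rcases hY with rfl | ⟨Γ, c, x, hY⟩
    · exact .inl ht
    · obtain ⟨A, B, rfl, hp⟩ := step_par_iff.1 hY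
      cases hp with
      | rcv h₁ h₂ =>
        rcases step_halt h₁ with ⟨_, _, _, rfl⟩ | ⟨_, _, ⟨⟩, _⟩
        rcases step_delay h₂ with ⟨_, _, _, rfl⟩ | ⟨⟨⟩, _⟩
        exact .inl ht
  · obtain ⟨A, B, rfl, hp⟩ := step_par_iff.1 hY
    cases hp with
    | time h₁ _ => (rcases step_halt h₁ with ⟨_, _, ⟨⟩, _⟩ | ⟨_, _, ⟨⟩, _⟩)
  · obtain ⟨A, B, rfl, hp⟩ := step_par_iff.1 hY
    cases hp with
    | tauL h₁ => (rcases step_halt h₁ with ⟨_, _, ⟨⟩, _⟩ | ⟨_, _, ⟨⟩, _⟩)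
    | tauR h₂ => (rcases step_delay h₂ with ⟨_, _, ⟨⟩, _⟩ | ⟨⟨⟩, _⟩)
  · obtain ⟨A, B, rfl, hp⟩ := step_par_iff.1 hY
    cases hp with
    | sndL h₁ h₂ =>
      rcases step_delay h₂ with ⟨_, _, _, rfl⟩ | ⟨⟨⟩, _⟩
      rcases step_halt h₁ with ⟨_, _, ⟨⟩, _⟩ | ⟨_, hc, ⟨⟩, k, rfl⟩
      rcases hc with rfl | rfl
      · refine .inr (.inl ⟨k, ht.mono ?_⟩)
        rintro d hd
        exact ⟨.inr (.inr hd), (hn d hd).2.1⟩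
      · refine .inr (.inr (ht.dead (c := g) ⟨.inl rfl, ne⟩ fun k => ?_))
        rcases (chans_waiting _).subset k with (k | k) | k
        · exact (hn e (.inl rfl)).2.1 k.symm
        · exact (hn f (.inr (.inl rfl))).2.1 k.symm
        · exact (hn p (.inr (.inr rfl))).2.1 k.symm
    | sndR _ h₂ => (rcases step_delay h₂ with ⟨_, _, ⟨⟩, _⟩ | ⟨⟨⟩, _⟩)

/-- Only the passage of time changes the test, and that very `σ` is the one counted by the weak
transition. -/
theorem Testing.waiting_red (hn : ∀ c, c = e ∨ c = f ∨ c = p → c ∈ F) {k : ℕ}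
    (ht : Testing F (ExtTaus K) (waiting k e f p) {e, f, p} M) (hr : Config.Red M M') :
    Testing F (ExtTaus K) (waiting k e f p) {e, f, p} M' ∨
      ∃ k, Testing F (WeakExtStep K .sigma) (triggered k e f p) {e, f, p} M' := by
  have hY : (waiting k e f p : Sys S C).chans ⊆ F := by
    rw [chans_waiting]
    rintro c ((hc | hc) | hc)
    exacts [hn c (.inl hc), hn c (.inr (.inl hc)), hn c (.inr (.inr hc))]
  rcases ht.red hr (fun _ _ h k => h.trans k) hY
    with ⟨Y', hY, ht⟩ | ⟨Y', Γ, hY, ht⟩ | ⟨Y', Γ, hY, ht⟩ | ⟨Y', Γ, c, x, hY, ht⟩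
  · rcases hY with rfl | ⟨Γ, c, x, hY⟩
    · exact .inl ht
    · obtain ⟨A, B, rfl, hp⟩ := step_par_iff.1 hY
      cases hp with
      | rcv h₁ h₂ =>
        rcases step_delays_nil h₁ with ⟨_, _, _, rfl⟩ | ⟨⟨⟩, _⟩
        rcases step_delay h₂ with ⟨_, _, _, rfl⟩ | ⟨⟨⟩, _⟩
        exact .inl ht
  · obtain ⟨A, B, rfl, hp⟩ := step_par_iff.1 hY
    cases hp with
    | time h₁ h₂ =>
      rcases step_delays_nil h₁ with ⟨_, _, ⟨⟩, _⟩ | ⟨_, n, rfl⟩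
      rcases step_delay h₂ with ⟨_, _, ⟨⟩, _⟩ | ⟨_, rfl⟩
      exact .inr ⟨n, ht.imp fun K' ⟨L, hL, hs⟩ => .of_sigma hL hs⟩
  · obtain ⟨A, B, rfl, hp⟩ := step_par_iff.1 hY
    cases hp with
    | tauL h₁ => (rcases step_delays_nil h₁ with ⟨_, _, ⟨⟩, _⟩ | ⟨⟨⟩, _⟩)
    | tauR h₂ => (rcases step_delay h₂ with ⟨_, _, ⟨⟩, _⟩ | ⟨⟨⟩, _⟩)
  · obtain ⟨A, B, rfl, hp⟩ := step_par_iff.1 hY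
    cases hp with
    | sndL h₁ _ => (rcases step_delays_nil h₁ with ⟨_, _, ⟨⟩, _⟩ | ⟨⟨⟩, _⟩)
    | sndR _ h₂ => (rcases step_delay h₂ with ⟨_, _, ⟨⟩, _⟩ | ⟨⟨⟩, _⟩)

/-- The gate blocks time, so no second `σ` can occur before it opens; if it signals on `p` instead,
then `e` is lost. -/
theorem Testing.triggered_red (hn : ∀ c, c = e ∨ c = f ∨ c = p → c ∈ F) (hpe : p ≠ e) {k : ℕ}
    (ht : Testing F (WeakExtStep K .sigma) (triggered k e f p) {e, f, p} M)
    (hr : Config.Red M M') :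
    Testing F (WeakExtStep K .sigma) (triggered k e f p) {e, f, p} M' ∨
      Testing F (WeakExtStep K .sigma) (halting k e f) {e, f} M' ∨ M'.Dead e := by
  have hY : (triggered k e f p : Sys S C).chans ⊆ F := by
    rw [chans_triggered]
    rintro c ((hc | hc) | hc)
    exacts [hn c (.inl hc), hn c (.inr (.inl hc)), hn c (.inr (.inr hc))]
  rcases ht.red hr (fun _ _ h k => h.taus k) hY
    with ⟨Y', hY, ht⟩ | ⟨Y', Γ, hY, ht⟩ | ⟨Y', Γ, hY, ht⟩ | ⟨Y', Γ, c, x, hY, ht⟩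
  · rcases hY with rfl | ⟨Γ, c, x, hY⟩
    · exact .inl ht
    · obtain ⟨A, B, rfl, hp⟩ := step_par_iff.1 hY
      cases hp with
      | rcv h₁ h₂ =>
        rcases step_delays_nil h₁ with ⟨_, _, _, rfl⟩ | ⟨⟨⟩, _⟩
        rcases step_gate h₂ with ⟨_, _, _, rfl⟩ | ⟨⟨⟩, _⟩ | ⟨⟨⟩, _⟩
        exact .inl ht
  · obtain ⟨A, B, rfl, hp⟩ := step_par_iff.1 hY
    cases hp with
    | time _ h₂ => (rcases step_gate h₂ with ⟨_, _, ⟨⟩, _⟩ | ⟨⟨⟩, _⟩ | ⟨⟨⟩, _⟩)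
  · obtain ⟨A, B, rfl, hp⟩ := step_par_iff.1 hY
    cases hp with
    | tauL h₁ => (rcases step_delays_nil h₁ with ⟨_, _, ⟨⟩, _⟩ | ⟨⟨⟩, _⟩)
    | tauR h₂ =>
      rcases step_gate h₂ with ⟨_, _, ⟨⟩, _⟩ | ⟨_, rfl⟩ | ⟨⟨⟩, _⟩
      refine .inr (.inl (ht.mono ?_))
      rintro c (hc | hc)
      exacts [.inl hc, .inr (.inl hc)]
  · obtain ⟨A, B, rfl, hp⟩ := step_par_iff.1 hY
    cases hp with
    | sndL h₁ _ => (rcases step_delays_nil h₁ with ⟨_, _, ⟨⟩, _⟩ | ⟨⟨⟩, _⟩)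
    | sndR h₁ h₂ =>
      rcases step_delays_nil h₁ with ⟨_, _, _, rfl⟩ | ⟨⟨⟩, _⟩
      rcases step_gate h₂ with ⟨_, _, ⟨⟩, _⟩ | ⟨⟨⟩, _⟩ | ⟨⟨⟩, n, rfl⟩
      refine .inr (.inr (ht.dead (c := e) ⟨.inl rfl, hpe.symm⟩ ?_))
      rw [Sys.chans, chans_delays_nil, chans_delays_nil]
      simp

theorem Testing.halting_red (he : e ∈ F) (hf : f ∈ F) (hef : e ≠ f) {k : ℕ}
    (ht : Testing F (WeakExtStep K .sigma) (halting k e f) {e, f} M)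
    (hr : Config.Red M M') :
    Testing F (WeakExtStep K .sigma) (halting k e f) {e, f} M' ∨ M'.Dead e ∨ M'.Dead f := by
  have hY : (halting k e f : Sys S C).chans ⊆ F := by
    rw [chans_halting]
    rintro c (rfl | rfl) <;> assumption
  rcases ht.red hr (fun _ _ h k => h.taus k) hY
    with ⟨Y', hY, ht⟩ | ⟨Y', Γ, hY, ht⟩ | ⟨Y', Γ, hY, ht⟩ | ⟨Y', Γ, c, x, hY, ht⟩
  · rcases hY with rfl | ⟨Γ, c, x, hY⟩
    · exact .inl ht
    · obtain ⟨A, B, rfl, hp⟩ := step_par_iff.1 hY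
      cases hp with
      | rcv h₁ h₂ =>
        rcases step_delays_nil h₁ with ⟨_, _, _, rfl⟩ | ⟨⟨⟩, _⟩
        rcases step_halt h₂ with ⟨_, _, _, rfl⟩ | ⟨_, _, ⟨⟩, _⟩
        exact .inl ht
  · obtain ⟨A, B, rfl, hp⟩ := step_par_iff.1 hY
    cases hp with
    | time _ h₂ => (rcases step_halt h₂ with ⟨_, _, ⟨⟩, _⟩ | ⟨_, _, ⟨⟩, _⟩)
  · obtain ⟨A, B, rfl, hp⟩ := step_par_iff.1 hY
    cases hp with
    | tauL h₁ => (rcases step_delays_nil h₁ with ⟨_, _, ⟨⟩, _⟩ | ⟨⟨⟩, _⟩)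
    | tauR h₂ => (rcases step_halt h₂ with ⟨_, _, ⟨⟩, _⟩ | ⟨_, _, ⟨⟩, _⟩)
  · obtain ⟨A, B, rfl, hp⟩ := step_par_iff.1 hY
    cases hp with
    | sndL h₁ _ => (rcases step_delays_nil h₁ with ⟨_, _, ⟨⟩, _⟩ | ⟨⟨⟩, _⟩)
    | sndR h₁ h₂ =>
      rcases step_delays_nil h₁ with ⟨_, _, _, rfl⟩ | ⟨⟨⟩, _⟩
      rcases step_halt h₂ with ⟨_, _, ⟨⟩, _⟩ | ⟨_, hc, ⟨⟩, n, rfl⟩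
      have hj : (Sys.par (.proc (delays k nil)) (.proc (delays n nil)) : Sys S C).chans = ∅ := by
        rw [Sys.chans, chans_delays_nil, chans_delays_nil]; simp
      rcases hc with rfl | rfl
      · exact .inr (.inr (ht.dead (c := f) ⟨.inr rfl, hef.symm⟩ fun k => hj.subset k))
      · exact .inr (.inl (ht.dead (c := e) ⟨.inl rfl, hef⟩ fun k => hj.subset k))

/-- The states of the test for the passage of time after it has been released. -/
def Released (F : Set C) (e f p : C) (K M : Config S C) : Prop :=
  (∃ k, Testing F (ExtTaus K) (waiting k e f p) {e, f, p} M) ∨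
    (∃ k, Testing F (WeakExtStep K .sigma) (triggered k e f p) {e, f, p} M) ∨
    (∃ k, Testing F (WeakExtStep K .sigma) (halting k e f) {e, f} M) ∨ M.Dead e ∨ M.Dead f

theorem Released.reds (hn : ∀ c, c = e ∨ c = f ∨ c = p → c ∈ F) (hpe : p ≠ e) (hef : e ≠ f)
    (h : Released F e f p K M) (hr : ReflTransGen Config.Red M M') : Released F e f p K M' := by
  induction hr with
  | refl => exact h
  | tail _ hr ih =>
    rcases ih with ⟨k, ht⟩ | ⟨k, ht⟩ | ⟨k, ht⟩ | hd | hd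
    · rcases ht.waiting_red hn hr with ht | ht
      · exact .inl ⟨k, ht⟩
      · exact .inr (.inl ht)
    · rcases ht.triggered_red hn hpe hr with ht | ht | hd
      · exact .inr (.inl ⟨k, ht⟩)
      · exact .inr (.inr (.inl ⟨k, ht⟩))
      · exact .inr (.inr (.inr (.inl hd)))
    · rcases ht.halting_red (hn e (.inl rfl)) (hn f (.inr (.inl rfl))) hef hr with ht | hd
      · exact .inr (.inr (.inl ⟨k, ht⟩))
      · exact .inr (.inr (.inr hd))
    · exact .inr (.inr (.inr (.inl (hd.red hr))))
    · exact .inr (.inr (.inr (.inr (hd.red hr))))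

theorem step_gate_snd (Γ : Env S C) :
    Step Γ (.proc (gate e f p)) (.snd p S.err) (.proc (delays (S.delta S.err) nil)) :=
  .sumSndR _ (step_out_snd Γ p)

/-- Without a barb on `p` the gate must have opened. A delayed gate reaches `e` only after a passage
of time that also makes `p` available, and a triggered gate can signal on `p` at once. The barbs on
`e` and `f` show that the new `halt` has not fired. -/
theorem Released.halting (h : Released F e f p K M) (be : M.WeakBarb e) (bf : M.WeakBarb f)
    (bp : ¬ M.WeakBarb p) :
    ∃ k, Testing F (WeakExtStep K .sigma) (halting k e f) {e, f} M := by
  rcases h with ⟨k, ht⟩ | ⟨k, ht⟩ | ht | hd | hd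
  · refine absurd ?_ bp
    obtain ⟨K', L, T, hT, hY, -, -, -, hd, rfl⟩ := ht
    -- The remaining delay of the earlier signal is moved next to the configuration, so that the
    -- delayed gate alone is the test.
    have e₁ : ((L.par T hT).par (waiting k e f p) hY).StrEq
        (((L.par T hT).par _ hY.1).par _ hY.2) := ⟨rfl, (SEq.assoc _ _ _).symm⟩
    have dead : ∀ c ∈ ({e, f, p} : Set C),
        ((L.par T hT).par (.proc (delays k nil)) hY.1).Dead c := fun c hc => by
      refine ⟨(hd c hc).1, fun h => h.elim (hd c hc).2 fun h => ?_⟩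
      rw [chans_delays_nil] at h; exact h
    refine e₁.symm.weakBarb (Config.weakBarb_of_waiting (e := e) ?_ (dead e (.inl rfl))
      (dead p (.inr (.inr rfl))) (e₁.weakBarb be))
    intro Γ a X' h
    rcases step_delay h with ⟨c, x, rfl, rfl⟩ | ⟨rfl, rfl⟩
    · exact .inl ⟨rfl, .inr ⟨c, x, rfl⟩⟩
    · exact .inr ⟨rfl, fun Γ' => ⟨_, _, step_gate_snd Γ'⟩⟩
  · refine absurd (ht.weakBarb (c := p) (.inr (.inr rfl)) fun Γ => ?_) bp
    exact ⟨_, _, .syncR (.rcvIgn _ _ _ fun h => not_isRcv_delays_nil _ _ h.2) (step_gate_snd Γ)⟩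
  · exact ht
  · exact absurd be hd.not_weakBarb
  · exact absurd bf hd.not_weakBarb

theorem Testing.halting_armed {k : ℕ} {Q : Config S C → Prop}
    (ht : Testing F Q (halting k e f) {e, f} M) :
    ∃ K M', Q K ∧ Armed F e f K M' ∧ M.StrEq M' := by
  obtain ⟨K, L, T, hT, hY, hQ, hh, hs, hd, rfl⟩ := ht
  have : Testing F Q (.proc (halt e f)) {e, f}
      ((L.par (.par T (.proc (delays k nil))) ⟨hT, hY.1⟩).par (.proc (halt e f)) hY.2) := by
    refine ⟨K, L, .par T (.proc (delays k nil)), ⟨hT, hY.1⟩, hY.2, hQ,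
      ⟨hh.env_eq, hh.disjoint, ?_, .par hh.wf (.proc _)⟩,
      hs, fun c hc => ⟨(hd c hc).1, ?_⟩, rfl⟩
    · rw [Sys.chans, chans_delays_nil, Set.union_empty]; exact hh.subset
    · rintro (h | h | h)
      · exact (hd c hc).2 (.inl h)
      · exact (hd c hc).2 (.inr h)
      · rw [chans_delays_nil] at h; exact h
  obtain ⟨K, M', hQ, hA, e'⟩ := this.armed
  have e₁ : ((L.par T hT).par (halting k e f) hY).StrEq
      ((L.par (.par T (.proc (delays k nil))) ⟨hT, hY.1⟩).par (.proc (halt e f)) hY.2) :=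
    ⟨rfl, (SEq.assoc _ _ _).symm.trans (.par (.assoc _ _ _) (.refl _))⟩
  exact ⟨K, M', hQ, hA, e₁.trans e'⟩

end Run

/-- Three fresh channels `e`, `f`, `p` extend `F`. The two checkpoints of `Armed.pass_time` are
answered in turn, and their barbs force the answer to contain exactly one `σ` of `K₂`; the new `halt
e f` takes the place of `halt g h`. -/
theorem Rel.sigma {F : Set C} {g h : C} {K₁ K₂ K₁' : Config S C} (hR : Rel F g h K₁ K₂)
    (hK : ExtStep K₁ .sigma K₁') :
    ∃ F' g' h' K₂', WeakExtStep K₂ .sigma K₂' ∧ Rel F' g' h' K₁' K₂' := by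
  obtain ⟨e, -, heF, he₁, he₂⟩ := hR.exists_fresh Set.finite_empty
  obtain ⟨f, hfe, hfF, hf₁, hf₂⟩ := hR.exists_fresh (Set.finite_singleton e)
  obtain ⟨p, hp, hpF, hp₁, hp₂⟩ := hR.exists_fresh (Set.toFinite {e, f})
  have hpe : p ≠ e := fun h => hp (.inl h)
  have hpf : p ≠ f := fun h => hp (.inr h)
  have hef : e ≠ f := fun h => hfe h.symm
  have hfresh : ∀ c, c = e ∨ c = f ∨ c = p → c ∉ F ∧ K₁.Dead c ∧ K₂.Dead c := by
    rintro c (rfl | rfl | rfl)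
    exacts [⟨heF, he₁, he₂⟩, ⟨hfF, hf₁, hf₂⟩, ⟨hpF, hp₁, hp₂⟩]
  obtain ⟨F', hF'⟩ : ∃ F', F' = F ∪ {e, f, p} := ⟨_, rfl⟩
  have hsub : F ⊆ F' := hF' ▸ Set.subset_union_left
  have hmem : ∀ c, c = e ∨ c = f ∨ c = p → c ∈ F' := fun c hc => hF' ▸ .inr hc
  have hcase : ∀ c ∈ F', c ∈ F ∨ K₁.Dead c ∧ K₂.Dead c := by
    rw [hF']
    rintro c (hc | hc)
    exacts [.inl hc, .inr (hfresh c hc).2]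
  have hd₁ : ∀ c ∈ F', c ∉ K₁.sys.chans := fun c hc =>
    (hcase c hc).elim (hR.disjoint_left c) fun h => h.1.2
  have hd₂ : ∀ c ∈ F', c ∉ K₂.sys.chans := fun c hc =>
    (hcase c hc).elim (hR.disjoint_right c) fun h => h.2.2
  obtain ⟨L₁, L₂, hA₁, hA₂, hb⟩ := hR.congruent
  obtain ⟨M, N, N', N'', hM, hN, bg, dh, hN', eN, hA', dp⟩ :=
    hA₁.pass_time (e := e) (f := f) (p := p) hK hR.left_mem hR.right_mem hR.ne hsub hd₁
      (fun c hc => ⟨(hfresh c hc).1, (hfresh c hc).2.1.1, hmem c hc⟩) hpe hpf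
  obtain ⟨Γ, T, hT, half, hdead, rfl⟩ := hA₂
  have hX : (Sys.proc (delay (gate e f p)) : Sys S C).Guarded := guarded_gate e f p
  have gY : (Sys.par (.proc (halt g h)) (.proc (delay (gate e f p))) : Sys S C).Guarded :=
    ⟨guarded_halt g h, guarded_gate e f p⟩
  have hb := (hb.par _ hX).congr hM
    (L' := ((K₂.withEnv Γ).par T hT).par _ gY) ⟨rfl, .assoc _ _ _⟩
  have ht : Testing F' (ExtTaus K₂)
      (.par (.proc (halt g h)) (.proc (delay (gate e f p)))) {g, h, e, f, p}
      (((K₂.withEnv Γ).par T hT).par _ gY) := by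
    refine ⟨K₂, K₂.withEnv Γ, T, hT, gY, .refl, half.mono hsub hd₂, .refl _, ?_, rfl⟩
    rintro c (hc | hc | hc)
    · exact hdead c (.inl hc)
    · exact hdead c (.inr hc)
    · obtain ⟨h₁, -, h₂⟩ := hfresh c hc
      exact ⟨(congrArg Prod.fst (half.env_eq c h₁)).trans h₂.1,
        fun k => k.elim h₂.2 fun k => h₁ (half.subset k)⟩
  have hn : ∀ c, c = e ∨ c = f ∨ c = p → c ∈ F' ∧ c ≠ g ∧ c ≠ h := fun c hc =>
    ⟨hmem c hc, fun k => (hfresh c hc).1 (k ▸ hR.left_mem),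
      fun k => (hfresh c hc).1 (k ▸ hR.right_mem)⟩
  -- First checkpoint: a pending `halt g h` would have a barb on `h`, and one fired on `h` would
  -- have none on `g`; so it has fired on `g`.
  obtain ⟨P, hP, hb⟩ := hb.reds hN
  have hrel : Released F' e f p K₂ P := by
    have inv : Testing F' (ExtTaus K₂)
        (.par (.proc (halt g h)) (.proc (delay (gate e f p)))) {g, h, e, f, p} P ∨
        Released F' e f p K₂ P ∨ P.Dead g := by
      clear hb
      induction hP with
      | refl => exact .inl ht
      | tail _ hr ih =>
        rcases ih with ht | ht | hd
        · rcases ht.armed_red (hsub hR.left_mem) (hsub hR.right_mem) hR.ne hn hr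
            with ht | ht | hd
          · exact .inl ht
          · exact .inr (.inl (.inl ht))
          · exact .inr (.inr hd)
        · exact .inr (.inl (ht.reds hmem hpe hef (.single hr)))
        · exact .inr (.inr (hd.red hr))
    rcases inv with ht | ht | hd
    · refine absurd (hb.symm.weakBarb (ht.weakBarb (c := h) (.inr (.inl rfl)) fun Γ => ?_))
        dh.not_weakBarb
      exact ⟨_, _, .syncL (step_halt_right Γ g h) (.rcvIgn _ _ _ fun h => h.2)⟩
    · exact ht
    · exact absurd (hb.weakBarb bg.weakBarb) hd.not_weakBarb
  -- Second checkpoint: the barbs on `e` and `f` and the absence of one on `p` show that time has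
  -- passed exactly once.
  obtain ⟨P', hP', hb⟩ := hb.reds hN'
  have hb := hb.congr eN (L' := P') ⟨rfl, .refl _⟩
  obtain ⟨k, ht⟩ := (hrel.reds hmem hpe hef hP').halting
    (hb.weakBarb (hA'.weakBarb (.inl rfl))) (hb.weakBarb (hA'.weakBarb (.inr rfl)))
    fun bp => dp.not_weakBarb (hb.symm.weakBarb bp)
  obtain ⟨K₂', L₂', hK₂, hA₂, e₂⟩ := ht.halting_armed
  have hs := extStep_sigma_iff.1 hK
  refine ⟨F', e, f, K₂', hK₂, ?_, hmem e (.inl rfl), hmem f (.inr (.inl rfl)), hef,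
    fun c hc => ?_, ?_, N'', L₂', hA', hA₂, hb.congr ⟨rfl, .refl _⟩ e₂⟩
  · exact hF' ▸ hR.finite.union (Set.toFinite _)
  · refine Agree.congr (Agree.upd_sigma ?_) (congrFun hs.2 c) (hK₂.sigma_env (hd₂ c hc))
    exact (hcase c hc).elim (hR.agree c) fun h => .inr ⟨h.1.1, h.2.1⟩
  · refine infinite_idle hR.infinite (fun c hc hi => ?_) (fun c hc hi => ?_)
    · rw [hs.2]; exact hi.upd_sigma
    · exact (congrArg Prod.fst (hK₂.sigma_env hc)).trans hi.upd_sigma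

/-! ## Contexts -/

theorem Armed.par {F : Set C} {g h : C} {K L : Config S C} (hA : Armed F g h K L)
    (hg : g ∈ F) (hh : h ∈ F) (X : Sys S C) (hX : X.Guarded) (hd : ∀ c ∈ F, c ∉ X.chans) :
    ∃ L', (L.par X hX).StrEq L' ∧ Armed F g h (K.par X hX) L' := by
  obtain ⟨Γ, T, hT, half, hdead, rfl⟩ := hA
  refine ⟨(((K.par X hX).withEnv Γ).par T hT).par (.proc (halt g h)) (guarded_halt g h),
    ⟨rfl, ?_⟩, Γ, T, hT, ⟨half.env_eq, ?_, half.subset, half.wf⟩, ?_, rfl⟩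
  · refine (SEq.assoc _ _ _).trans ((SEq.par (.refl _) (.comm _ _)).trans ?_)
    refine (SEq.assoc _ _ _).symm.trans (.par ?_ (.refl _))
    refine (SEq.assoc _ _ _).trans ((SEq.par (.refl _) (.comm _ _)).trans ?_)
    exact (SEq.assoc _ _ _).symm
  · rintro c hc (k | k)
    · exact half.disjoint c hc k
    · exact hd c hc k
  · intro c hc
    refine ⟨(hdead c hc).1, ?_⟩
    rintro ((k | k) | k)
    · exact (hdead c hc).2 (.inl k)
    · rcases hc with rfl | rfl
      exacts [hd _ hg k, hd _ hh k]
    · exact (hdead c hc).2 (.inr k)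

/-- A spent test is declared private instead of being removed. It has to be well-formed, because
private terms must let time pass when the next `σ` is matched. -/
theorem Armed.absorb {F N : Set C} {g h : C} {K L : Config S C} {X : Sys S C} {hX : X.Guarded}
    (hA : Armed F g h (K.par X hX) L) (hN : X.chans ⊆ N) (hNF : ∀ c ∈ N, c ∉ F)
    (hNK : ∀ c ∈ N, c ∉ K.sys.chans) (hw : WNets K.env X) :
    ∃ L', L.StrEq L' ∧ Armed (F ∪ N) g h K L' := by
  obtain ⟨Γ, T, hT, half, hdead, rfl⟩ := hA
  refine ⟨((K.withEnv Γ).par (.par X T) ⟨hX, hT⟩).par (.proc (halt g h)) (guarded_halt g h),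
    ⟨rfl, .par (.assoc _ _ _) (.refl _)⟩, Γ, .par X T, ⟨hX, hT⟩,
    ⟨fun c hc => half.env_eq c fun k => hc (.inl k), ?_, ?_, .par ?_ half.wf⟩, ?_, rfl⟩
  · rintro c (hc | hc) k
    · exact half.disjoint c hc (.inl k)
    · exact hNK c hc k
  · rintro c (hc | hc)
    · exact .inr (hN hc)
    · exact .inl (half.subset hc)
  · refine hw.mono fun c hc k => ?_
    unfold Exposed Idle
    rw [half.env_eq c (hNF c (hN hc))]
    exact k
  · intro c hc
    refine ⟨(hdead c hc).1, ?_⟩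
    rintro (k | k | k)
    · exact (hdead c hc).2 (.inl (.inl k))
    · exact (hdead c hc).2 (.inl (.inr k))
    · exact (hdead c hc).2 (.inr k)

/-- The composition has an environment `Γ` of its own at the private channels, so that of the
configuration may be changed there without effect. -/
theorem Armed.congr {F : Set C} {g h : C} {K K' L : Config S C} (hA : Armed F g h K L)
    (hs : SEq K.sys K'.sys) (he : ∀ c ∉ F, K'.env c = K.env c) :
    ∃ L', L.StrEq L' ∧ Armed F g h K' L' := by
  obtain ⟨Γ, T, hT, half, hdead, rfl⟩ := hA
  refine ⟨((K'.withEnv Γ).par T hT).par (.proc (halt g h)) (guarded_halt g h),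
    ⟨rfl, .par (.par hs (.refl _)) (.refl _)⟩, Γ, T, hT,
    ⟨fun c hc => (half.env_eq c hc).trans (he c hc).symm,
      fun c hc k => half.disjoint c hc (hs.chans ▸ k), half.subset, half.wf⟩,
    fun c hc => ⟨(hdead c hc).1, ?_⟩, rfl⟩
  exact fun k => (hdead c hc).2 (k.imp_left fun k => hs.chans ▸ k)

theorem Agree.transmit {Γ Δ : Env S C} {d : C} (h : Agree Γ Δ d) (c : C) (x : S.Val) :
    Agree (Γ.transmit c x) (Δ.transmit c x) d := by
  by_cases e : d = c
  · subst e
    rcases h with h | ⟨h₁, h₂⟩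
    · exact .inl (Env.transmit_congr h)
    · exact .inl ((Env.transmit_idle h₁).trans (Env.transmit_idle h₂).symm)
  · exact h.congr (Env.transmit_of_ne e) (Env.transmit_of_ne e)

/-- A decision leaves a delay, which no instantaneous step alters, and a signal on `q` leaves `q`
exposed until time passes. Hence a run reveals a moment `L` at which `b` was evaluated, or that the
test is pending, or a barb on `q`. -/
theorem ExtTaus.watch {b : BExp S C 0} {P Q : Proc S C 0 0} {q : C}
    {hX : (Sys.proc (watch b P Q q)).Guarded} {K M : Config S C}
    (h : ExtTaus (K.par (.proc (watch b P Q q)) hX) M) :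
    ∃ K', (ExtTaus K K' ∧ M = K'.par _ hX) ∨
      (∃ L, ExtTaus K L ∧ ExtTaus L K' ∧ b.Holds L.env ∧
        M = K'.par (.proc (delay P)) hX.1.1) ∨
      (∃ L, ExtTaus K L ∧ ExtTaus L K' ∧ ¬ b.Holds L.env ∧
        M = K'.par (.proc (delay Q)) hX.1.2) ∨
      Exposed M.env q := by
  have delayed : ∀ {R : Proc S C 0 0} {hR : (Sys.proc (delay R)).Guarded} {K' M : Config S C},
      ExtStep (K'.par _ hR) .tau M → ∃ K'', ExtStep K' .tau K'' ∧ M = K''.par _ hR := by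
    intro R hR K' M hr
    obtain ⟨K'', X', hX', rfl, ⟨k, rfl | ⟨c, x, hx⟩⟩ | ⟨hx, _⟩ | ⟨c, x, hx, _⟩⟩ := hr.tau_par
    · exact ⟨K'', k, rfl⟩
    · rcases step_delay hx with ⟨_, _, _, rfl⟩ | ⟨⟨⟩, _⟩
      exact ⟨K'', k, rfl⟩
    · rcases step_delay hx with ⟨_, _, ⟨⟩, _⟩ | ⟨⟨⟩, _⟩
    · rcases step_delay hx with ⟨_, _, ⟨⟩, _⟩ | ⟨⟨⟩, _⟩
  induction h with
  | refl => exact ⟨K, .inl ⟨.refl, rfl⟩⟩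
  | tail _ hr ih =>
    obtain ⟨K', ⟨h, rfl⟩ | ⟨L, h₁, h₂, hb, rfl⟩ | ⟨L, h₁, h₂, hb, rfl⟩ | he⟩ := ih
    · obtain ⟨K'', X', hX', rfl, ⟨k, rfl | ⟨c, x, hx⟩⟩ | ⟨hx, rfl⟩ | ⟨c, x, hx, hp⟩⟩ := hr.tau_par
      · exact ⟨K'', .inl ⟨h.tail k, rfl⟩⟩
      · rcases step_watch hx with ⟨_, _, _, rfl⟩ | ⟨⟨⟩, _⟩ | ⟨⟨⟩, _⟩ | ⟨⟨⟩, _⟩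
        exact ⟨K'', .inl ⟨h.tail k, rfl⟩⟩
      · rcases step_watch hx with ⟨_, _, ⟨⟩, _⟩ | ⟨_, hb, rfl⟩ | ⟨_, hb, rfl⟩ | ⟨⟨⟩, _⟩
        · exact ⟨_, .inr (.inl ⟨_, h, .refl, hb, rfl⟩)⟩
        · exact ⟨_, .inr (.inr (.inl ⟨_, h, .refl, hb, rfl⟩))⟩
      · rcases step_watch hx with ⟨_, _, ⟨⟩, _⟩ | ⟨⟨⟩, _⟩ | ⟨⟨⟩, _⟩ | ⟨⟨⟩, _⟩
        refine ⟨K', .inr (.inr (.inr ?_))⟩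
        change Exposed K''.env _
        rw [hp.2]
        exact Env.exposed_transmit
    · obtain ⟨K'', k, rfl⟩ := delayed hr
      exact ⟨K'', .inr (.inl ⟨L, h₁, h₂.tail k, hb, rfl⟩)⟩
    · obtain ⟨K'', k, rfl⟩ := delayed hr
      exact ⟨K'', .inr (.inr (.inl ⟨L, h₁, h₂.tail k, hb, rfl⟩))⟩
    · exact ⟨K', .inr (.inr (.inr (ExtTaus.exposed (.single hr) he)))⟩

/-- The transmission of `x` along `c`, or else a signal along `p`. -/
def Proc.offer (c : C) (x : S.Val) (p : C) : Proc S C 0 0 :=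
  choice (bcast c (.val x) nil) (out p)

theorem step_offer {Γ : Env S C} {V : Sys S C} {a : Act S C} {c : C} {x : S.Val} {p : C}
    (h : Step Γ (.proc (offer c x p)) a V) :
    (∃ d y, a = .rcv d y ∧ V = .proc (offer c x p)) ∨
      (a = .snd c x ∧ ∃ k, V = .proc (delays k nil)) ∨ ∃ y, a = .snd p y := by
  cases h with
  | rcvIgn c x _ _ => exact .inl ⟨c, x, rfl, rfl⟩
  | sumTauL _ h => cases h
  | sumTauR _ h => cases h
  | sumSndL _ h => cases h; exact .inr (.inl ⟨rfl, _, rfl⟩)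
  | sumSndR _ h => cases h; exact .inr (.inr ⟨_, rfl⟩)
  | sumTime h _ => cases h
  | sumRcvL _ _ _ h => exact h.elim
  | sumRcvR _ _ _ h => exact h.elim

/-- As for `watch`: the run exhibits the moment at which the configuration received `x`, unless the
offer is pending or `p` is exposed. -/
theorem ExtTaus.offer {c : C} {x : S.Val} {p : C}
    {hX : (Sys.proc (offer c x p)).Guarded} {K M : Config S C}
    (h : ExtTaus (K.par (.proc (offer c x p)) hX) M) :
    ∃ K', (ExtTaus K K' ∧ M = K'.par _ hX) ∨
      (∃ L L' k, ExtTaus K L ∧ L.Performs (.rcv c x) L' ∧ ExtTaus L' K' ∧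
        M = K'.par (.proc (delays k nil)) (guarded_delays_nil k)) ∨
      Exposed M.env p := by
  induction h with
  | refl => exact ⟨K, .inl ⟨.refl, rfl⟩⟩
  | tail _ hr ih =>
    obtain ⟨K', ⟨h, rfl⟩ | ⟨L, L', k, h₁, h₂, h₃, rfl⟩ | he⟩ := ih
    · obtain ⟨K'', X', hX', rfl, ⟨k, rfl | ⟨d, y, hx⟩⟩ | ⟨hx, rfl⟩ | ⟨d, y, hx, hp⟩⟩ := hr.tau_par
      · exact ⟨K'', .inl ⟨h.tail k, rfl⟩⟩
      · rcases step_offer hx with ⟨_, _, _, rfl⟩ | ⟨⟨⟩, _⟩ | ⟨_, ⟨⟩⟩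
        exact ⟨K'', .inl ⟨h.tail k, rfl⟩⟩
      · rcases step_offer hx with ⟨_, _, ⟨⟩, _⟩ | ⟨⟨⟩, _⟩ | ⟨_, ⟨⟩⟩
      · rcases step_offer hx with ⟨_, _, ⟨⟩, _⟩ | ⟨⟨⟩, k, rfl⟩ | ⟨_, ⟨⟩⟩
        · exact ⟨K'', .inr (.inl ⟨_, _, k, h, hp, .refl, rfl⟩)⟩
        · refine ⟨K', .inr (.inr ?_)⟩
          change Exposed K''.env _
          rw [hp.2]
          exact Env.exposed_transmit
    · obtain ⟨K'', X', hX', rfl, ⟨j, rfl | ⟨d, y, hx⟩⟩ | ⟨hx, rfl⟩ | ⟨d, y, hx, hp⟩⟩ := hr.tau_par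
      · exact ⟨K'', .inr (.inl ⟨L, L', k, h₁, h₂, h₃.tail j, rfl⟩)⟩
      · rcases step_delays_nil hx with ⟨_, _, _, rfl⟩ | ⟨⟨⟩, _⟩
        exact ⟨K'', .inr (.inl ⟨L, L', k, h₁, h₂, h₃.tail j, rfl⟩)⟩
      · rcases step_delays_nil hx with ⟨_, _, ⟨⟩, _⟩ | ⟨⟨⟩, _⟩
      · rcases step_delays_nil hx with ⟨_, _, ⟨⟩, _⟩ | ⟨⟨⟩, _⟩
    · exact ⟨K', .inr (.inr (ExtTaus.exposed (.single hr) he))⟩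

theorem ExtTaus.arcv {c : C} {P : Proc S C 1 0} {hX : (Sys.arcv c P).Guarded} {K M : Config S C}
    (h : ExtTaus (K.par (.arcv c P) hX) M) : ∃ K', ExtTaus K K' ∧ M = K'.par _ hX := by
  induction h with
  | refl => exact ⟨K, .refl, rfl⟩
  | tail _ hr ih =>
    obtain ⟨K', h, rfl⟩ := ih
    obtain ⟨K'', X', hX', rfl, ⟨k, rfl | ⟨d, y, hx⟩⟩ | ⟨hx, rfl⟩ | ⟨d, y, hx, hp⟩⟩ := hr.tau_par
    · exact ⟨K'', h.tail k, rfl⟩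
    · rcases step_arcv hx with ⟨_, _, _, rfl⟩ | ⟨⟨⟩, _⟩
      exact ⟨K'', h.tail k, rfl⟩
    · rcases step_arcv hx with ⟨_, _, ⟨⟩, _⟩ | ⟨⟨⟩, _⟩
    · rcases step_arcv hx with ⟨_, _, ⟨⟩, _⟩ | ⟨⟨⟩, _⟩

/-- A delayed signal next to a well-formed configuration is a weak barb. -/
theorem Config.WellFormed.weakBarb_delay {K : Config S C} (hw : K.WellFormed) {e : C}
    (he : K.Dead e) (hX : (Sys.proc (delay (out e)) : Sys S C).Guarded) :
    (K.par (.proc (delay (out e))) hX).WeakBarb e := by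
  obtain ⟨K', K'', h₁, -, h₂⟩ := hw.exists_time
  have r₁ := h₁.par_left hX fun _ _ h => h.elim
  have r₂ : ExtStep (K'.par _ hX) .sigma (K''.par (.proc (out e)) (guarded_out e)) :=
    .par_sigma _ h₂ (.sleep _)
  refine .of_reds (r₁.reds.tail (red_iff.2 (.inr r₂))) ?_
  refine Config.weakBarb_of_snd (step_out_snd _ e) (Config.Dead.not_isRcv ?_)
  exact he.reds (h₁.reds.tail (red_iff.2 (.inr h₂)))

theorem WeakExtStep.reds_of_sigma {K K' : Config S C} (h : WeakExtStep K .sigma K') :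
    ReflTransGen Config.Red K K' := by
  obtain ⟨L, L', h₁, h₂, h₃⟩ := h.sigma_cases
  exact (h₁.reds.tail (red_iff.2 (.inr h₂))).trans h₃.reds

/-! ### Matching the extensional actions -/

namespace Rel

variable {F : Set C} {g h : C} {K₁ K₂ : Config S C}

/-- Congruence of the compositions is not enough by itself: they hide the state of private channels,
and `halt` blocks the reductions in which time passes. The reductions are therefore matched one by
one. -/
theorem weakBarb (hR : Rel F g h K₁ K₂) {c : C} (hb : K₁.WeakBarb c) : K₂.WeakBarb c := by
  obtain ⟨K₁', hr, hb⟩ := hb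
  induction hr using ReflTransGen.head_induction_on generalizing F g h K₂ with
  | refl => exact hR.weakBarb_of_barb hb
  | head h₁ _ ih =>
    rcases red_iff.1 h₁ with h₁ | h₁
    · obtain ⟨K₂', h₂, hR⟩ := hR.tau h₁
      exact .of_reds h₂.reds (ih hR)
    · obtain ⟨_, _, _, K₂', h₂, hR⟩ := hR.sigma h₁
      exact .of_reds h₂.reds_of_sigma (ih hR)

theorem par (hR : Rel F g h K₁ K₂) (X : Sys S C) (hX : X.Guarded) (hd : ∀ c ∈ F, c ∉ X.chans) :
    Rel F g h (K₁.par X hX) (K₂.par X hX) := by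
  obtain ⟨L₁, L₂, h₁, h₂, hb⟩ := hR.congruent
  obtain ⟨L₁', e₁, h₁⟩ := h₁.par hR.left_mem hR.right_mem X hX hd
  obtain ⟨L₂', e₂, h₂⟩ := h₂.par hR.left_mem hR.right_mem X hX hd
  exact ⟨hR.finite, hR.left_mem, hR.right_mem, hR.ne, hR.agree, hR.infinite,
    L₁', L₂', h₁, h₂, (hb.par X hX).congr e₁ e₂⟩

theorem absorb {X₁ X₂ : Sys S C} {hX₁ : X₁.Guarded} {hX₂ : X₂.Guarded}
    (hR : Rel F g h (K₁.par X₁ hX₁) (K₂.par X₂ hX₂)) {N : Set C} (hN : N.Finite)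
    (h₁ : X₁.chans ⊆ N) (h₂ : X₂.chans ⊆ N) (hNF : ∀ c ∈ N, c ∉ F)
    (hd₁ : ∀ c ∈ N, K₁.Dead c) (hd₂ : ∀ c ∈ N, K₂.Dead c)
    (hw₁ : WNets K₁.env X₁) (hw₂ : WNets K₂.env X₂) : Rel (F ∪ N) g h K₁ K₂ := by
  obtain ⟨L₁, L₂, hA₁, hA₂, hb⟩ := hR.congruent
  obtain ⟨L₁', e₁, hA₁⟩ := hA₁.absorb h₁ hNF (fun c hc => (hd₁ c hc).2) hw₁
  obtain ⟨L₂', e₂, hA₂⟩ := hA₂.absorb h₂ hNF (fun c hc => (hd₂ c hc).2) hw₂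
  refine ⟨hR.finite.union hN, .inl hR.left_mem, .inl hR.right_mem, hR.ne, ?_, hR.infinite,
    L₁', L₂', hA₁, hA₂, hb.congr e₁ e₂⟩
  rintro c (hc | hc)
  · exact hR.agree c hc
  · exact .inr ⟨(hd₁ c hc).1, (hd₂ c hc).1⟩

/-- Neither side listens on a private channel. The environments still agree afterwards, because a
transmission overwrites the stale value of an idle channel. -/
theorem input_private (hR : Rel F g h K₁ K₂) {c : C} (hc : c ∈ F) {x : S.Val}
    {K₁' : Config S C} (hK : K₁.Performs (.rcv c x) K₁') : Rel F g h K₁' (K₂.transmit c x) := by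
  obtain ⟨L₁, L₂, h₁, h₂, hb⟩ := hR.congruent
  have hne : ∀ d ∉ F, d ≠ c := by rintro d hd rfl; exact hd hc
  obtain ⟨L₁', e₁, h₁⟩ := h₁.congr (K' := K₁')
    (SEq.of_ignored hK.1 fun k => hR.disjoint_left c hc k.mem_chans) fun d hd => by
      rw [hK.2]; exact Env.transmit_of_ne (hne d hd)
  obtain ⟨L₂', e₂, h₂⟩ := h₂.congr (K' := K₂.transmit c x) (.refl _) fun d hd =>
    Env.transmit_of_ne (hne d hd)
  refine ⟨hR.finite, hR.left_mem, hR.right_mem, hR.ne, fun d hd => ?_, ?_,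
    L₁', L₂', h₁, h₂, hb.congr e₁ e₂⟩
  · rw [hK.2]; exact (hR.agree d hd).transmit c x
  · refine (hR.infinite.sdiff hR.finite).mono fun d hd => ⟨?_, ?_⟩
    · rw [hK.2]
      exact (congrArg Prod.fst (Env.transmit_of_ne (hne d hd.2))).trans hd.1.1
    · exact (congrArg Prod.fst (Env.transmit_of_ne (hne d hd.2))).trans hd.1.2

/-- When the offer of `x` along `c` is taken up, `p` is dead. On the other side a pending offer
could still signal on `p`, and a signal already given is a barb; so that side has received `x` along
`c` among instantaneous steps. -/
theorem input_public (hR : Rel F g h K₁ K₂) {c : C} (hc : c ∉ F) {x : S.Val}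
    {K₁' : Config S C} (hK : K₁.Performs (.rcv c x) K₁') :
    ∃ F' g' h' K₂', WeakExtStep K₂ (.input c x) K₂' ∧ Rel F' g' h' K₁' K₂' := by
  obtain ⟨p, hpc, hpF, hp₁, hp₂⟩ := hR.exists_fresh (Set.finite_singleton c)
  have hX : (Sys.proc (offer c x p)).Guarded := ⟨trivial, trivial⟩
  -- Here `c ∉ F` is used: a context may not interfere with the private channels.
  have hR' := hR.par _ hX (by
    rintro d hd k
    simp only [Sys.chans, Proc.offer, Proc.chans, chans_out] at k
    rcases k with (rfl | k) | rfl
    exacts [hc hd, k, hpF hd])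
  have hs : Step K₁.env (.proc (offer c x p)) (.snd c x) (.proc (delays (S.delta x) nil)) :=
    .sumSndL _ (.snd c (.val x) nil)
  obtain ⟨M, hM, hR'⟩ := hR'.tau (ExtStep.par_snd_right (by exact guarded_delays_nil _) hs hK)
  have hdead : (K₁'.par (.proc (delays (S.delta x) nil)) (guarded_delays_nil _)).Dead p := by
    refine ⟨?_, ?_⟩
    · change Idle K₁'.env p
      rw [hK.2]
      exact (congrArg Prod.fst (Env.transmit_of_ne hpc)).trans hp₁.1
    · rintro (k | k)
      · exact hp₁.2 (Sys.chans_step hK.1 k)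
      · rw [chans_delays_nil] at k; exact k
  have hn : ¬ M.WeakBarb p := fun k => hdead.not_weakBarb (hR'.symm.weakBarb k)
  obtain ⟨K₂', ⟨h₁, rfl⟩ | ⟨L, L', k, h₁, h₂, h₃, rfl⟩ | he⟩ := hM.offer
  · refine absurd (Config.weakBarb_of_snd (c := p) (.sumSndR _ (step_out_snd _ p)) ?_) hn
    exact (hp₂.reds h₁.reds).not_isRcv
  -- What remains of the offer is a delay without channels, so `F` does not grow.
  · refine ⟨F ∪ ∅, g, h, K₂', .inr ⟨by simp, L, L', h₁, .input c x h₂, h₃⟩,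
      hR'.absorb Set.finite_empty (chans_delays_nil _).subset (chans_delays_nil _).subset
        (by simp) (by simp) (by simp) (.proc _) (.proc _)⟩
  · exact absurd (Config.Barb.weakBarb he) hn

/-- The test of `exp(c)` gives up `q` and, `c` being idle, leads to a signal on `e` after a delay;
well-formedness lets that delay elapse. The other side must thus decide the test too, and in favour
of idleness. -/
theorem idle_public (hR : Rel F g h K₁ K₂) (hw : K₁.WellFormed) {c : C} (hc : c ∉ F)
    (hi : Idle K₁.env c) :
    ∃ F' g' h' K₂', WeakExtStep K₂ (.idle c) K₂' ∧ Rel F' g' h' K₁ K₂' := by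
  obtain ⟨e, -, heF, he₁, he₂⟩ := hR.exists_fresh Set.finite_empty
  obtain ⟨q, hqe, hqF, hq₁, hq₂⟩ := hR.exists_fresh (Set.finite_singleton e)
  have hX : (Sys.proc (watch (.exposed c) nil (out e) q) : Sys S C).Guarded :=
    ⟨⟨trivial, trivial⟩, trivial⟩
  have hR' := hR.par _ hX (by
    rintro d hd k
    simp only [Sys.chans, Proc.watch, Proc.chans, chans_out, BExp.chans] at k
    rcases k with (rfl | k | rfl) | rfl
    exacts [hc hd, k, heF hd, hqF hd])
  have hs : Step K₁.env (.proc (watch (.exposed c) nil (out e) q)) .tau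
      (.proc (delay (out e))) := .sumTauL _ (.condElse _ _ _ fun k => k hi)
  obtain ⟨M, hM, hR'⟩ := hR'.tau (ExtStep.par_tau_right K₁ (by exact guarded_out e) hs)
  have hdead : (K₁.par (.proc (delay (out e))) (guarded_out e)).Dead q := by
    refine ⟨hq₁.1, ?_⟩
    rintro (k | k)
    · exact hq₁.2 k
    · simp only [Sys.chans, Proc.chans, chans_out] at k
      exact hqe k
  have hn : ¬ M.WeakBarb q := fun k => hdead.not_weakBarb (hR'.symm.weakBarb k)
  obtain ⟨K₂', ⟨h₁, rfl⟩ | ⟨L, h₁, h₂, hb, rfl⟩ | ⟨L, h₁, h₂, hb, rfl⟩ | he⟩ := hM.watch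
  · refine absurd (Config.weakBarb_of_snd (c := q) (.sumSndR _ (step_out_snd _ q)) ?_) hn
    exact (hq₂.reds h₁.reds).not_isRcv
  -- Had `c` been exposed, the test would have continued as `nil`, and `e` would be dead.
  · refine absurd (hR'.weakBarb (hw.weakBarb_delay he₁ _)) (Config.Dead.not_weakBarb ?_)
    have hd := (he₂.reds h₁.reds).reds h₂.reds
    exact ⟨hd.1, fun k => k.elim hd.2 id⟩
  · have hch : (Sys.proc (delay (out e)) : Sys S C).chans ⊆ {e} := by
      simp [Sys.chans, Proc.chans]
    refine ⟨F ∪ {e}, g, h, K₂', .inr ⟨by simp, L, L, h₁, .idle c (not_not.1 hb), h₂⟩,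
      hR'.absorb (Set.finite_singleton e) hch hch ?_ ?_ ?_ (.proc _) (.proc _)⟩
    · rintro _ rfl; exact heF
    · rintro _ rfl; exact he₁
    · rintro _ rfl; exact (he₂.reds h₁.reds).reds h₂.reds
  · exact absurd (Config.Barb.weakBarb he) hn

/-- An active receiver along `c` is run through the `σ`, after which it compares what it received
with `x` and signals on `e` only if they are equal. The other side can reach `e` without keeping `q`
available only if its receiver ends at the matching `σ` and with the value `x`, that is, if `c` was
in state `(1, x)`. -/
theorem deliver_public (hR : Rel F g h K₁ K₂) {c : C} (hc : c ∉ F) {x : S.Val}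
    (hx : K₁.env c = (1, x)) {K₁' : Config S C} (hK : ExtStep K₁ .sigma K₁')
    (hw : K₁'.WellFormed) :
    ∃ F' g' h' K₂', WeakExtStep K₂ (.deliver c x) K₂' ∧ Rel F' g' h' K₁' K₂' := by
  obtain ⟨e, -, heF, he₁, he₂⟩ := hR.exists_fresh Set.finite_empty
  obtain ⟨q, hqe, hqF, hq₁, hq₂⟩ := hR.exists_fresh (Set.finite_singleton e)
  let P : Proc S C 1 0 := watch (.eq (.var 0) (.val x)) (out e) nil q
  let P' : S.Val → Proc S C 0 0 := fun y => watch (.eq (.val y) (.val x)) (out e) nil q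
  have hP : ∀ y, P.inst y = P' y := fun y => rfl
  have hX : (Sys.arcv c P).Guarded := ⟨⟨trivial, trivial⟩, trivial⟩
  have hX' : ∀ y, (Sys.proc (P' y)).Guarded := fun y => ⟨⟨trivial, trivial⟩, trivial⟩
  have hR' := hR.par _ hX (by
    rintro d hd k
    simp only [Sys.chans, P, Proc.watch, Proc.chans, chans_out, BExp.chans] at k
    rcases k with rfl | (k | rfl | k) | rfl
    exacts [hc hd, k, heF hd, k, hqF hd])
  have hs : Step K₁.env (.arcv c P) .sigma (.proc (P' x)) := by
    have := Step.endRcv (Γ := K₁.env) c P (by rw [hx])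
    rwa [hx] at this
  obtain ⟨F', g', h', M₀, hM₀, hR'⟩ := hR'.sigma (ExtStep.par_sigma (hX' x) hK hs)
  obtain ⟨M, hM, hR'⟩ := hR'.tau (ExtStep.par_tau_right K₁' (by exact guarded_out e)
    (.sumTauL _ (.condThen _ _ _ rfl)))
  have he₁' := he₁.red (red_iff.2 (.inr hK))
  have hq₁' := hq₁.red (red_iff.2 (.inr hK))
  have hdead : (K₁'.par (.proc (delay (out e))) (guarded_out e)).Dead q := by
    refine ⟨hq₁'.1, ?_⟩
    rintro (k | k)
    · exact hq₁'.2 k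
    · simp only [Sys.chans, Proc.chans, chans_out] at k
      exact hqe k
  have hn : ¬ M.WeakBarb q := fun k => hdead.not_weakBarb (hR'.symm.weakBarb k)
  have hb : M.WeakBarb e := hR'.weakBarb (hw.weakBarb_delay he₁' _)
  obtain ⟨A, B, hA, hB, hM'⟩ := hM₀.sigma_cases
  replace hM := hM'.trans hM
  obtain ⟨L, hL, rfl⟩ := hA.arcv
  obtain ⟨L', X', gX', rfl, hL', hs'⟩ := hB.sigma_par
  have hrL : ReflTransGen Config.Red K₂ L' := hL.reds.tail (red_iff.2 (.inr hL'))
  rcases step_arcv hs' with ⟨_, _, ⟨⟩, _⟩ | ⟨_, rfl | ⟨h₁, rfl⟩⟩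
  · obtain ⟨K₂', hK₂, rfl⟩ := ExtTaus.arcv hM
    refine absurd (Config.weakBarb_of_waiting ?_ ((he₂.reds hrL).reds hK₂.reds)
      ((hq₂.reds hrL).reds hK₂.reds) hb) hn
    intro Γ a Y hY
    rcases step_arcv hY with ⟨d, y, rfl, rfl⟩ | ⟨rfl, rfl | ⟨_, rfl⟩⟩
    · exact .inl ⟨rfl, .inr ⟨d, y, rfl⟩⟩
    · exact .inl ⟨rfl, .inl rfl⟩
    · exact .inr ⟨rfl, fun Γ' => ⟨_, _, .sumSndR _ (step_out_snd Γ' q)⟩⟩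
  -- Substituting the received value into `P` gives `P'` by computation.
  · have hM : ExtTaus (L'.par (.proc (P' (L.env c).2)) (hX' _)) M := hM
    obtain ⟨K₂', ⟨k₁, rfl⟩ | ⟨D, k₁, k₂, hd, rfl⟩ | ⟨D, k₁, k₂, hd, rfl⟩ | he⟩ := hM.watch
    · refine absurd (Config.weakBarb_of_snd (c := q) (.sumSndR _ (step_out_snd _ q)) ?_) hn
      exact ((hq₂.reds hrL).reds k₁.reds).not_isRcv
    · have hch : (Sys.proc (delay (out e)) : Sys S C).chans ⊆ {e} := by
        simp [Sys.chans, Proc.chans]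
      have hv : (L.env c).2 = x := hd
      refine ⟨F' ∪ {e}, g', h', K₂', .inr ⟨by simp, L, L', hL,
        .deliver c x (Prod.ext h₁ hv) (extStep_sigma_iff.1 hL'), k₁.trans k₂⟩,
        hR'.absorb (Set.finite_singleton e) hch hch ?_ ?_ ?_ (.proc _) (.proc _)⟩
      · rintro _ rfl k
        exact hR'.disjoint_left _ k (.inr (by simp [Sys.chans, Proc.chans]))
      · rintro _ rfl; exact he₁'
      · rintro _ rfl; exact ((he₂.reds hrL).reds k₁.reds).reds k₂.reds
    · refine absurd hb (Config.Dead.not_weakBarb ?_)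
      have hd := ((he₂.reds hrL).reds k₁.reds).reds k₂.reds
      exact ⟨hd.1, fun k => k.elim hd.2 id⟩
    · exact absurd (Config.Barb.weakBarb he) hn

/-- Public channels are handled by tests. On private ones no test is allowed, but none is needed:
neither configuration uses them, and their states agree, except for the values at idle channels,
which no action shows. -/
theorem extStep (hR : Rel F g h K₁ K₂) (hw : K₁.WellFormed) {α : ExtAct S C}
    {K₁' : Config S C} (hs : ExtStep K₁ α K₁') :
    ∃ F' g' h' K₂', WeakExtStep K₂ α K₂' ∧ Rel F' g' h' K₁' K₂' := by
  cases hs with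
  | input c x hp =>
    by_cases hc : c ∈ F
    · exact ⟨F, g, h, _, .inr ⟨by simp, K₂, _, .refl, .input c x
        (Config.performs_transmit (fun k => hR.disjoint_right c hc k.mem_chans) x), .refl⟩,
        hR.input_private hc hp⟩
    · exact hR.input_public hc hp
  | time hp => exact hR.sigma (.time hp)
  | shh c x hp =>
    obtain ⟨K₂', h₂, hR⟩ := hR.tau (.shh c x hp)
    exact ⟨F, g, h, K₂', .inl ⟨rfl, h₂⟩, hR⟩
  | tauExt hp =>
    obtain ⟨K₂', h₂, hR⟩ := hR.tau (.tauExt hp)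
    exact ⟨F, g, h, K₂', .inl ⟨rfl, h₂⟩, hR⟩
  | deliver c x hx hp =>
    by_cases hc : c ∈ F
    · obtain ⟨F', g', h', K₂', h₂, hR'⟩ := hR.sigma (.time hp)
      obtain ⟨L, L', h₃, h₄, h₅⟩ := h₂.sigma_cases
      refine ⟨F', g', h', K₂', .inr ⟨by simp, L, L', h₃,
        .deliver c x ?_ (extStep_sigma_iff.1 h₄), h₅⟩, hR'⟩
      rw [h₃.env_eq (hR.disjoint_right c hc)]
      rcases hR.agree c hc with k | ⟨k, _⟩
      · rw [← k, hx]
      · rw [Idle, hx] at k; cases k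
    · exact hR.deliver_public hc hx (.time hp) (hw.performs hp)
  | idle c hi =>
    by_cases hc : c ∈ F
    · refine ⟨F, g, h, K₂, .inr ⟨by simp, K₂, K₂, .refl, .idle c ?_, .refl⟩, hR⟩
      rcases hR.agree c hc with k | ⟨_, k⟩
      · rw [Idle, ← k]; exact hi
      · exact k
    · exact hR.idle_public hw hc hi

end Rel

/-! ### The bisimulation -/

theorem Config.WellFormed.extStep {K K' : Config S C} {α : ExtAct S C} (hw : K.WellFormed)
    (h : ExtStep K α K') : K'.WellFormed := by
  cases h with
  | idle => exact hw
  | _ => exact hw.performs (by assumption)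

theorem Config.WellFormed.weakExtStep {K K' : Config S C} {α : ExtAct S C} (hw : K.WellFormed)
    (h : WeakExtStep K α K') : K'.WellFormed := by
  rcases h with ⟨_, h⟩ | ⟨_, L, L', h₁, h₂, h₃⟩
  · exact hw.taus h
  · exact ((hw.taus h₁).extStep h₂).taus h₃

theorem Config.WeakBarb.exposed_or_mem_chans {K : Config S C} {c : C} (h : K.WeakBarb c) :
    Exposed K.env c ∨ c ∈ K.sys.chans := by
  by_contra hn
  rw [not_or] at hn
  exact Config.Dead.not_weakBarb ⟨not_not.1 hn.1, hn.2⟩ h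

theorem BarbedCongruent.rel {K₁ K₂ : Config S C} (hb : BarbedCongruent K₁ K₂)
    (hf : K₂.HasFreshChannels) : ∃ F g h, Rel F g h K₁ K₂ := by
  have hinf : {c | K₁.Dead c ∧ K₂.Dead c}.Infinite := by
    refine (Set.Infinite.sdiff hf (K₁.sys.finite_chans.union K₂.sys.finite_chans)).mono ?_
    rintro c ⟨hc, hn⟩
    rw [Set.mem_union, not_or] at hn
    refine ⟨⟨?_, hn.1⟩, hc, hn.2⟩
    -- A channel exposed in `K₁` is a weak barb of `K₂`, hence exposed or occurring there. So off a
    -- finite set of channels idleness passes from `K₂` to `K₁`.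
    by_contra hi
    exact (hb.weakBarb (Config.Barb.weakBarb hi)).exposed_or_mem_chans.elim (fun k => k hc) hn.2
  obtain ⟨g, hg₁, hg₂⟩ := hinf.nonempty
  obtain ⟨h, ⟨hh₁, hh₂⟩, ne⟩ := (hinf.sdiff (Set.finite_singleton g)).nonempty
  -- At the start the private term is `nil`, and two channels that are dead on both sides serve the
  -- first `halt`.
  have armed : ∀ K : Config S C, K.Dead g → K.Dead h → Armed {g, h} g h K
      ((K.par (.proc nil) trivial).par (.proc (halt g h)) (guarded_halt g h)) := by
    intro K kg kh
    refine ⟨K.env, .proc nil, trivial, ⟨fun _ _ => rfl, ?_, Set.empty_subset _, .proc _⟩, ?_, rfl⟩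
    · rintro c (rfl | rfl)
      exacts [kg.2, kh.2]
    · rintro c (rfl | rfl)
      exacts [⟨kg.1, fun k => k.elim kg.2 id⟩, ⟨kh.1, fun k => k.elim kh.2 id⟩]
  refine ⟨{g, h}, g, h, Set.toFinite _, .inl rfl, .inr rfl, fun e => ne e.symm, ?_,
    hinf.mono fun c hc => ⟨hc.1.1, hc.2.1⟩,
    _, _, armed K₁ hg₁ hh₁, armed K₂ hg₂ hh₂, (hb.par _ _).par _ _⟩
  rintro c (rfl | rfl)
  exacts [.inr ⟨hg₁.1, hg₂.1⟩, .inr ⟨hh₁.1, hh₂.1⟩]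

theorem BarbedCongruent.bisimilar {K₁ K₂ : Config S C} (hb : BarbedCongruent K₁ K₂)
    (hf : K₂.HasFreshChannels) (hw₁ : K₁.WellFormed) (hw₂ : K₂.WellFormed) :
    Bisimilar K₁ K₂ := by
  -- The set `F` and the channels of the pending `halt` change along a run, so they are quantified
  -- inside the bisimulation.
  refine ⟨fun K L => K.WellFormed ∧ L.WellFormed ∧ ∃ F g h, Rel F g h K L, ?_,
    hw₁, hw₂, hb.rel hf⟩
  rintro K L ⟨hK, hL, F, g, h, hR⟩ α
  constructor
  · intro K' hs
    obtain ⟨F', g', h', L', hw, hR'⟩ := hR.extStep hK hs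
    exact ⟨L', hw, hK.extStep hs, hL.weakExtStep hw, F', g', h', hR'⟩
  · intro L' hs
    obtain ⟨F', g', h', K', hw, hR'⟩ := hR.symm.extStep hL hs
    exact ⟨K', hw, hK.weakExtStep hw, hL.extStep hs, F', g', h', hR'.symm⟩

end CCCP

theorem mainTheorem1 {S : CCCP.Signature.{v, w}} {C : Type u}
    (K₁ K₂ : CCCP.Config S C)
    (hf₁ : K₁.HasFreshChannels) (hf₂ : K₂.HasFreshChannels)
    (hw₁ : K₁.WellFormed) (hw₂ : K₂.WellFormed)
    (h : CCCP.BarbedCongruent K₁ K₂) :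
    CCCP.Bisimilar K₁ K₂ :=
  h.bisimilar hf₂ hw₁ hw₂
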